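/- **Setting.** Let $d\ge 1$, $\mathcal X\subseteq\mathbb R^d$, $\mu$ a probability measure on $\mathcal X$, and $(\varphi_j)_{j\ge1}$ an orthonormal basis of $L^2(\mathcal X,\mu)$ of measurable functions with $\sup_{j,x}|\varphi_j(x)|<\infty$. Let $\sigma,\alpha,\beta>0$. Under $\mathrm P_0$ (with true function $f_0\in L^2(\mathcal X,\mu)$) one observes $n$ independent pairs $(x_i,y_i)$ with $x_i\sim\mu$, $y_i=f_0(x_i)+\varepsilon_i$, and $\varepsilon_i\sim N(0,\sigma^2)$ independent of $x_i$. Let $$\tau_n=n^{-1/(d+2\alpha)}\log n,\qquad c\,e^{-\tau_n j^{1/d}}\le\lambda_{n,j}\le C\,e^{-\tau_n j^{1/d}}\quad(n\ge2,\ j\ge1)$$ with constants $0<c\le C$ that do not depend on $n,j$. For $n\ge2$ the prior $\Pi_n$ on $f$ is the centred Gaussian process with covariance kernel $k_n(x,y)=\sum_{j}\lambda_{n,j}\varphi_j(x)\varphi_j(y)$, that is, the law of $f=\sum_j\theta_j\varphi_j$ with independent $\theta_j\sim N(0,\lambda_{n,j})$; $\Pi_n(\cdot\mid\boldsymbol x,\boldsymbol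 y)$ is the posterior given by Bayes' formula. For $m\ge0$ let $\boldsymbol u=(\langle f,\varphi_1\rangle,\dots,\langle f,\varphi_m\rangle)$ (population spectral features), let $\mathcal Q_m$ be the set of distributions $\int\Pi_n(\cdot\mid\boldsymbol u)\,d\Psi_{\boldsymbol u}(\boldsymbol u)$ with $\Psi_{\boldsymbol u}$ a non-degenerate Gaussian law on $\mathbb R^m$, and let the variational posterior $\Psi(\cdot\mid\boldsymbol x,\boldsymbol y)$ be the minimiser of $\Psi\mapsto D_{\mathrm{KL}}(\Psi\,\|\,\Pi_n(\cdot\mid\boldsymbol x,\boldsymbol y))$ over $\mathcal Q_m$. Let $\mathcal S^\beta=\{f\in L^2(\mathcal X,\mu):\|f\|_\beta<\infty\}$, $\|f\|_\beta^2=\sum_j j^{2\beta/d}\langle f,\varphi_j\rangle^2$. **Statement.** 0. For all $n\ge2$, $m\ge0$ and all data $(\boldsymbol x,\boldsymbol y)\in\mathcal X^n\times\mathbb R^n$ the variational posterior exists and is unique. 1. If $m=m_n\ge n^{d/(d+2\alpha)}$ for all large $n$ and $m_n^2n^{-1}\log n\to0$, then for every (essentially) bounded $f_0\in\mathcal S^\beta$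 the variational posterior contracts around $f_0$ at the rate $\epsilon_n=n^{-(\beta\wedge\alpha)/(d+2\alpha)}$: for every $M_n\to\infty$, $$\mathrm P_0\,\Psi(\|f-f_0\|\ge M_n\epsilon_n\mid\boldsymbol x,\boldsymbol y)\to0 .$$ 2. If $\alpha=\beta$, this rate $\epsilon_n=n^{-\beta/(d+2\beta)}$ is minimax optimal over $\mathcal S^\beta$: for every $R>0$ there are $0<c_R\le C_R<\infty$ such that for all large $n$ $$c_R\,\epsilon_n^2\le\inf_{\hat f}\sup_{\|f_0\|_\beta\le R}\mathrm P_0\|\hat f-f_0\|^2\le C_R\,\epsilon_n^2,$$ the infimum being over all measurable functions $\hat f$ of the $n$ observations with values in $L^2(\mathcal X,\mu)$. 3. If $\alpha=\beta$ and $m_n\le C'n^{r}$ for all $n\ge 2$, for some constant $C'$ and some $r<d/(d+2\alpha)$ (in particular if $m_n=\lfloor n^r\rfloor$), then there exist $f_0\in\mathcal S^\beta$ and $0<p<\beta/(d+2\beta)$ such that the variational posterior contracts around $f_0$ at best at the suboptimal rate $n^{-p}$: for every $M>0$, $$\mathrm P_0\,\Psi(\|f-f_0\|\le M n^{-p}\mid\boldsymbol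 x,\boldsymbol y)\to0 .$$ -/

import Mathlib

open MeasureTheory ProbabilityTheory Filter Topology
open scoped NNReal ENNReal

noncomputable section

namespace SparseGP

section Space

variable {𝒳 : Type*} [MeasurableSpace 𝒳]

/-- The Hilbert space `L²(𝒳, μ)` of real functions. -/
abbrev L2 (μ : Measure 𝒳) : Type _ := Lp ℝ 2 μ

/-- `L²(𝒳, μ)` carries its Borel σ-algebra. -/
instance instMeasurableSpaceL2 (μ : Measure 𝒳) : MeasurableSpace (L2 μ) := borel _

instance instBorelSpaceL2 (μ : Measure 𝒳) : BorelSpace (L2 μ) := ⟨rfl⟩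

instance instFactTwoNeTop : Fact ((2 : ℝ≥0∞) ≠ ∞) := ⟨ENNReal.ofNat_ne_top⟩

end Space

section Model

variable {𝒳 : Type*} [MeasurableSpace 𝒳] {μ : Measure 𝒳}

/-- The law of one observation `(x, y)` with `x ∼ μ`, `y = f₀(x) + ε`, and `ε ∼ N(0, σ²)`
independent of `x`. -/
def obsLaw (σ : ℝ≥0) (f₀ : L2 μ) : Measure (𝒳 × ℝ) :=
  (μ.prod (gaussianReal 0 (σ ^ 2))).map fun p => (p.1, f₀ p.1 + p.2)

/-- The law `P₀` of a sample `(x₁, y₁), …, (xₙ, yₙ)` of independent observations. -/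
def dataLaw (σ : ℝ≥0) (f₀ : L2 μ) (n : ℕ) : Measure (Fin n → 𝒳 × ℝ) :=
  Measure.pi fun _ => obsLaw σ f₀

/-- The squared Sobolev norm `‖f‖²_β = ∑_{j ≥ 1} j^{2β/d} ⟨f, φ_j⟩²`, with values in `[0, ∞]`.
The basis is indexed from `0`, so the `j`-th function of the text is `b (j - 1)`. -/
def sobolevNormSq (b : HilbertBasis ℕ ℝ (L2 μ)) (d : ℕ) (β : ℝ) (f : L2 μ) : ℝ≥0∞ :=
  ∑' j : ℕ, ENNReal.ofReal (((j : ℝ) + 1) ^ (2 * β / d) * inner ℝ (b j) f ^ 2)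

/-- The `β`-Sobolev space relative to the basis `b`. -/
def sobolevSpace (b : HilbertBasis ℕ ℝ (L2 μ)) (d : ℕ) (β : ℝ) : Set (L2 μ) :=
  {f | sobolevNormSq b d β f < ∞}

/-- The ball of radius `R` in the `β`-Sobolev space. -/
def sobolevBall (b : HilbertBasis ℕ ℝ (L2 μ)) (d : ℕ) (β R : ℝ) : Set (L2 μ) :=
  {f | sobolevNormSq b d β f ≤ ENNReal.ofReal (R ^ 2)}

/-- The minimax risk over `S` from `n` observations: infimum over all estimators, that is,
measurable functions of the data, of the largest mean squared error over `S`. -/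
def minimaxRisk (σ : ℝ≥0) (S : Set (L2 μ)) (n : ℕ) : ℝ≥0∞ :=
  ⨅ (T : (Fin n → 𝒳 × ℝ) → L2 μ) (_ : Measurable T),
    ⨆ f₀ ∈ S, ∫⁻ z, ENNReal.ofReal (‖T z - f₀‖ ^ 2) ∂(dataLaw σ f₀ n)

/-- `ε` is the minimax rate for the `β`-Sobolev space: on every ball of it the minimax risk is of
exact order `ε n ^ 2`. -/
def IsMinimaxRate (b : HilbertBasis ℕ ℝ (L2 μ)) (d : ℕ) (β : ℝ) (σ : ℝ≥0) (ε : ℕ → ℝ) : Prop :=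
  ∀ R : ℝ, 0 < R → ∃ c C : ℝ, 0 < c ∧ ∀ᶠ n : ℕ in atTop,
    ENNReal.ofReal (c * ε n ^ 2) ≤ minimaxRisk σ (sobolevBall b d β R) n ∧
    minimaxRisk σ (sobolevBall b d β R) n ≤ ENNReal.ofReal (C * ε n ^ 2)

end Model

section Prior

variable {𝒳 : Type*} [MeasurableSpace 𝒳] {μ : Measure 𝒳}

/-- The centred Gaussian process prior with covariance kernel
`k(x, y) = ∑_j λ_j φ_j(x) φ_j(y)`, as a law on `L²(𝒳, μ)`: the law of `∑_j θ_j φ_j` with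
independent coefficients `θ_j ∼ N(0, λ_j)`.  For summable `λ` the series converges in `L²` almost
surely, and the law is the centred Gaussian law with covariance operator
`T = ∑_j λ_j ⟨·, φ_j⟩ φ_j`. -/
def gpPrior (b : HilbertBasis ℕ ℝ (L2 μ)) (lam : ℕ → ℝ≥0) : Measure (L2 μ) :=
  (Measure.infinitePi fun j => gaussianReal 0 (lam j)).map fun θ => ∑' j, θ j • b j

instance instIsFiniteMeasureGpPrior (b : HilbertBasis ℕ ℝ (L2 μ)) (lam : ℕ → ℝ≥0) :
    IsFiniteMeasure (gpPrior b lam) := by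
  unfold gpPrior; infer_instance

/-- The value at the point `x` of the sample path `f = ∑_j ⟨f, φ_j⟩ φ_j`.  For bounded `φ_j` and
`∑_j √λ_j < ∞` the series converges absolutely, simultaneously at all `x`, for almost every `f`
under the prior, and the values form a centred Gaussian process with covariance kernel `k`. -/
def pathValue (φ : ℕ → 𝒳 → ℝ) (b : HilbertBasis ℕ ℝ (L2 μ)) (f : L2 μ) (x : 𝒳) : ℝ :=
  ∑' j, inner ℝ (b j) f * φ j x

/-- The Gaussian likelihood of the data `z = ((x₁, y₁), …, (xₙ, yₙ))` at `f`. -/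
def likelihood (φ : ℕ → 𝒳 → ℝ) (b : HilbertBasis ℕ ℝ (L2 μ)) (σ : ℝ≥0) {n : ℕ}
    (z : Fin n → 𝒳 × ℝ) (f : L2 μ) : ℝ≥0∞ :=
  ∏ i, gaussianPDF (pathValue φ b f (z i).1) (σ ^ 2) (z i).2

/-- The true posterior, given by Bayes' formula. -/
def posterior (φ : ℕ → 𝒳 → ℝ) (b : HilbertBasis ℕ ℝ (L2 μ)) (lam : ℕ → ℝ≥0) (σ : ℝ≥0) {n : ℕ}
    (z : Fin n → 𝒳 × ℝ) : Measure (L2 μ) :=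
  (∫⁻ f, likelihood φ b σ z f ∂(gpPrior b lam))⁻¹ •
    (gpPrior b lam).withDensity (likelihood φ b σ z)

/-- The population spectral features `u_j = ⟨f, φ_j⟩`, `j = 1, …, m`. -/
def inducing (b : HilbertBasis ℕ ℝ (L2 μ)) (m : ℕ) (f : L2 μ) : EuclideanSpace ℝ (Fin m) :=
  WithLp.toLp 2 fun i => inner ℝ (b i) f

end Prior

section Variational

variable {𝒳 : Type*} [MeasurableSpace 𝒳] [MeasurableSpace.CountablyGenerated 𝒳]
  {μ : Measure 𝒳} [IsFiniteMeasure μ]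

/-- The variational class: the distributions `∫ Π(· ∣ u) dΨ_u(u)`, where `Π(· ∣ u)` is the prior
conditional on the inducing variables and `Ψ_u` is a non-degenerate Gaussian law on `ℝ^m`. -/
def variationalClass (b : HilbertBasis ℕ ℝ (L2 μ)) (lam : ℕ → ℝ≥0) (m : ℕ) :
    Set (Measure (L2 μ)) :=
  {Ψ | ∃ (a : EuclideanSpace ℝ (Fin m)) (S : Matrix (Fin m) (Fin m) ℝ), S.PosDef ∧
    Ψ = (multivariateGaussian a S).bind (condDistrib id (inducing b m) (gpPrior b lam))}

/-- `Ψ` is the variational posterior: it minimises the Kullback-Leibler divergence to the true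
posterior over the variational class. -/
def IsVariationalPosterior (φ : ℕ → 𝒳 → ℝ) (b : HilbertBasis ℕ ℝ (L2 μ)) (lam : ℕ → ℝ≥0)
    (σ : ℝ≥0) (m : ℕ) {n : ℕ} (z : Fin n → 𝒳 × ℝ) (Ψ : Measure (L2 μ)) : Prop :=
  Ψ ∈ variationalClass b lam m ∧ ∀ Ψ' ∈ variationalClass b lam m,
    InformationTheory.klDiv Ψ (posterior φ b lam σ z) ≤
      InformationTheory.klDiv Ψ' (posterior φ b lam σ z)

end Variational

section Rates

variable {𝒳 : Type*} [MeasurableSpace 𝒳] {μ : Measure 𝒳}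

/-- The data-dependent measures `Ψ n z` contract around `f₀` at rate `ε`:
`P₀ Ψ(‖f - f₀‖ ≥ M_n ε_n ∣ data) → 0` for every `M_n → ∞`. -/
def ContractsAtRate (σ : ℝ≥0) (f₀ : L2 μ) (Ψ : ∀ n : ℕ, (Fin n → 𝒳 × ℝ) → Measure (L2 μ))
    (ε : ℕ → ℝ) : Prop :=
  ∀ M : ℕ → ℝ, Tendsto M atTop atTop →
    Tendsto (fun n => ∫⁻ z, Ψ n z {f | M n * ε n ≤ ‖f - f₀‖} ∂(dataLaw σ f₀ n)) atTop (𝓝 0)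

/-- The data-dependent measures `Ψ n z` contract around `f₀` at best at rate `ε`:
`P₀ Ψ(‖f - f₀‖ ≤ M ε_n ∣ data) → 0` for every constant `M`. -/
def ContractsAtBestAtRate (σ : ℝ≥0) (f₀ : L2 μ)
    (Ψ : ∀ n : ℕ, (Fin n → 𝒳 × ℝ) → Measure (L2 μ)) (ε : ℕ → ℝ) : Prop :=
  ∀ M : ℝ, 0 < M →
    Tendsto (fun n => ∫⁻ z, Ψ n z {f | ‖f - f₀‖ ≤ M * ε n} ∂(dataLaw σ f₀ n)) atTop (𝓝 0)

/-- The rescaling sequence `τ_n = n^{-1/(d+2α)} log n`. -/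
def rescaling (d : ℕ) (α : ℝ) (n : ℕ) : ℝ :=
  (n : ℝ) ^ (-(1 : ℝ) / (d + 2 * α)) * Real.log n

end Rates

end SparseGP

end

/-! The variational problem can be solved in closed form, and the rest is an analysis of the
solution. Let u be the first m coefficients. Averaging the conditional prior over a law of u amounts
to reweighting the prior by a function of u (`bind_condDistrib_id`), so in every element of the
class the higher coefficients keep their prior law and stay independent of u. Split each path value
into its part in u and a centred tail. The log-density with respect to the posterior is then a
function of u plus `crossTerm`, whose expectation is the same throughout the class. Hence the
divergence is the divergence of Ψ_u from N(a, P⁻¹), up to a finite constant, with P = Λ⁻¹ + σ⁻²ΦᵀΦ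
and a the ridge regression mean (`exists_klDiv_variationalLaw`). The unique minimiser is
`optPosterior`: Bayesian linear regression on the first m basis functions, with the prior untouched
beyond them.

Contraction follows from a second moment bound. Since m²/n → 0, the empirical Gram matrix is within
Frobenius distance 1/2 of the identity with probability tending to one. On that event the ridge
error splits into noise, bias and prior penalty (`sq_dist_optMean_le`). Everything is cut at the
effective dimension J = ⌊n^{d/(d+2α)}⌋, where τ_n j^{1/d} reaches log n and the eigenvalues have
dropped to about 1/n. The variance is at most of order J/n plus the prior trace beyond J
(`tsum_eigenvalue_tail_le`); the bias is a Sobolev tail; the penalty n⁻¹ ∑_{j<J} λ_j⁻¹ ⟨f₀, φ_j⟩² is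
controlled by comparing λ_j⁻¹ with the Sobolev weights through convexity (`exp_mul_rpow_neg_le`).
Each of these is O(ε_n²).

The minimax rate is classical: a projection estimator gives the upper bound, and Assouad's lemma on
the cube with coefficients ± R n^{-1/2} in the first ⌊n^{d/(d+2β)}⌋ directions gives the lower
bound.

With m ≤ C' n^r and r < d/(d+2α), τ_n (m+1)^{1/d} → 0. The first coefficient outside u then keeps a
prior variance bounded away from zero, and the data never inform it. So no ball whose radius tends
to zero keeps its mass, whatever f₀ is (`contractsAtBestAtRate_of_few_inducing`). -/

noncomputable section

set_option linter.unusedSectionVars false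

namespace SparseGP

/-! ### Coefficients under the prior: independent centred Gaussians. -/

section PriorLaw

variable {𝒳 : Type*} [MeasurableSpace 𝒳] [MeasurableSpace.CountablyGenerated 𝒳]
  {μ : Measure 𝒳} [IsProbabilityMeasure μ]

/-- The `j`-th coordinate of an element of `L²`. -/
def coord (b : HilbertBasis ℕ ℝ (L2 μ)) (j : ℕ) (f : L2 μ) : ℝ := inner ℝ (b j) f

lemma measurable_coord (b : HilbertBasis ℕ ℝ (L2 μ)) (j : ℕ) : Measurable (coord b j) := by
  unfold coord
  exact (continuous_const.inner continuous_id).measurable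

lemma measurable_inducing (b : HilbertBasis ℕ ℝ (L2 μ)) (m : ℕ) : Measurable (inducing b m) := by
  unfold inducing
  exact (WithLp.measurable_toLp 2 _).comp (measurable_pi_lambda _ fun i => measurable_coord b i)

lemma lintegral_sq_gaussianReal (v : ℝ≥0) :
    ∫⁻ x, ENNReal.ofReal (x ^ 2) ∂(gaussianReal 0 v) = v := by
  have h := variance_fun_id_gaussianReal (μ := 0) (v := v)
  rw [variance_eq_integral (by fun_prop)] at h
  simp only [integral_id_gaussianReal, sub_zero] at h
  rw [← ofReal_integral_eq_lintegral_ofReal, h]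
  · simp
  · exact (memLp_id_gaussianReal 2).integrable_sq
  · exact ae_of_all _ fun x => sq_nonneg x

lemma measurable_series (b : HilbertBasis ℕ ℝ (L2 μ)) :
    Measurable fun θ : ℕ → ℝ => ∑' j, θ j • b j :=
  Measurable.tsum fun j => (measurable_pi_apply j).smul_const (b j)

variable (b : HilbertBasis ℕ ℝ (L2 μ)) (lam : ℕ → ℝ≥0)

instance isProbabilityMeasure_gpPrior : IsProbabilityMeasure (gpPrior b lam) :=
  Measure.isProbabilityMeasure_map (measurable_series b).aemeasurable

/-- By Tonelli the expectation of the sum of squares is ∑ λ_j, which is finite. -/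
lemma ae_summable_sq {lam : ℕ → ℝ≥0} (hs : Summable lam) :
    ∀ᵐ θ ∂(Measure.infinitePi fun j => gaussianReal 0 (lam j)), Summable fun j => θ j ^ 2 := by
  have h : ∫⁻ θ, ∑' j, ENNReal.ofReal (θ j ^ 2)
      ∂(Measure.infinitePi fun j => gaussianReal 0 (lam j)) ≠ ∞ := by
    rw [lintegral_tsum (fun j => Measurable.aemeasurable (by fun_prop))]
    have : ∀ j, ∫⁻ θ : ℕ → ℝ, ENNReal.ofReal (θ j ^ 2)
        ∂(Measure.infinitePi fun j => gaussianReal 0 (lam j)) = lam j := fun j => by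
      rw [← lintegral_sq_gaussianReal (lam j)]
      exact (measurePreserving_eval_infinitePi (fun j => gaussianReal 0 (lam j)) j).lintegral_comp
        (f := fun x => ENNReal.ofReal (x ^ 2)) (by fun_prop)
    simp_rw [this]
    exact ENNReal.tsum_coe_ne_top_iff_summable.2 hs
  filter_upwards [ae_lt_top' (Measurable.aemeasurable (by fun_prop)) h] with θ hθ
  have := ENNReal.summable_toReal hθ.ne
  simpa [ENNReal.toReal_ofReal (sq_nonneg _)] using this

/-- Square summability matters here: without it the series has no sum in L² and `tsum` takes its
default value 0. -/
lemma coord_series {θ : ℕ → ℝ} (h : Summable fun j => θ j ^ 2) (j : ℕ) :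
    coord b j (∑' k, θ k • b k) = θ j := by
  have hm : Memℓp θ 2 := memℓp_gen (by simpa using h)
  have := b.hasSum_repr_symm ⟨θ, hm⟩
  unfold coord
  rw [this.tsum_eq, ← b.repr_apply_apply]
  simp

lemma map_coord_gpPrior {lam : ℕ → ℝ≥0} (hs : Summable lam) :
    (gpPrior b lam).map (fun f j => coord b j f) =
      Measure.infinitePi fun j => gaussianReal 0 (lam j) := by
  unfold gpPrior
  rw [Measure.map_map (measurable_pi_lambda _ fun j => measurable_coord b j) (measurable_series b)]
  conv_rhs => rw [← Measure.map_id (μ := Measure.infinitePi fun j => gaussianReal 0 (lam j))]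
  refine Measure.map_congr ?_
  filter_upwards [ae_summable_sq hs] with θ hθ
  ext j
  exact coord_series b hθ j

lemma map_coord_gpPrior_apply {lam : ℕ → ℝ≥0} (hs : Summable lam) (j : ℕ) :
    (gpPrior b lam).map (coord b j) = gaussianReal 0 (lam j) := by
  rw [← Measure.infinitePi_map_eval (fun j => gaussianReal 0 (lam j)) j,
    ← map_coord_gpPrior b hs, Measure.map_map (measurable_pi_apply j)
    (measurable_pi_lambda _ fun j => measurable_coord b j)]
  rfl

lemma iIndepFun_coord {lam : ℕ → ℝ≥0} (hs : Summable lam) :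
    iIndepFun (coord b) (gpPrior b lam) := by
  rw [iIndepFun_iff_map_fun_eq_infinitePi_map (measurable_coord b), map_coord_gpPrior b hs]
  simp_rw [map_coord_gpPrior_apply b hs]

/-- The inducing variables are independent of every functional of the remaining coordinates. -/
lemma indepFun_inducing {lam : ℕ → ℝ≥0} (hs : Summable lam) (m : ℕ) {g : L2 μ → ℝ}
    (hg : Measurable[⨆ j ∈ Set.Ici m, (inferInstance : MeasurableSpace ℝ).comap (coord b j)] g) :
    IndepFun (inducing b m) g (gpPrior b lam) := by
  -- Working with σ-algebras generated by blocks of coordinates, rather than with finitely many of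
  -- them, allows g to be an infinite series such as `pathTail`.
  have h := indep_iSup_of_disjoint (fun j => (measurable_coord b j).comap_le)
    ((iIndepFun_iff_iIndep _ _ _).1 (iIndepFun_coord b hs))
    (S := Set.Iio m) (T := Set.Ici m) (Set.Iio_disjoint_Ici le_rfl)
  rw [IndepFun_iff_Indep]
  refine indep_of_indep_of_le_left (indep_of_indep_of_le_right h hg.comap_le) ?_
  have key : Measurable[⨆ j ∈ Set.Iio m, (inferInstance : MeasurableSpace ℝ).comap (coord b j)]
      (inducing b m) := by
    unfold inducing
    refine (WithLp.measurable_toLp 2 _).comp (@measurable_pi_lambda _ _ _ (_) _ _ fun i => ?_)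
    exact (comap_measurable (coord b i)).mono (le_iSup₂_of_le (f := fun j (_ : j ∈ Set.Iio m) =>
      (inferInstance : MeasurableSpace ℝ).comap (coord b j)) (i : ℕ) i.2 le_rfl) le_rfl
  exact key.comap_le

end PriorLaw

/-! ### Reweighting a measure by a function of u. -/

section Tilt

variable {Ω β : Type*} [MeasurableSpace Ω] [MeasurableSpace β]
  {P : Measure Ω} [IsFiniteMeasure P] {u : Ω → β}

/-- Averaging the conditional law given `u` over a law `ν` of `u` amounts to reweighting by the
density of `ν`. -/
lemma bind_condDistrib_id [StandardBorelSpace Ω] [Nonempty Ω] (hu : Measurable u) {ν : Measure β} [SigmaFinite ν]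
    (hν : ν ≪ P.map u) :
    ν.bind (condDistrib id u P) = P.withDensity fun ω => ν.rnDeriv (P.map u) (u ω) := by
  have hg := Measure.measurable_rnDeriv ν (P.map u)
  ext s hs
  rw [Measure.bind_apply hs (Kernel.aemeasurable _), withDensity_apply _ hs,
    ← lintegral_indicator hs]
  conv_lhs => rw [← Measure.withDensity_rnDeriv_eq ν _ hν]
  have hk : Measurable fun x => condDistrib id u P x s := Kernel.measurable_coe _ hs
  rw [lintegral_withDensity_eq_lintegral_mul _ hg hk]
  -- Disintegration: the joint law of (u, ω) is the law of u composed with the conditional law. It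
  -- is tested against 1_s(ω) times the density at u.
  have h := compProd_map_condDistrib (mβ := inferInstance) (X := u) (Y := id) (μ := P) aemeasurable_id
  have hF : Measurable fun p : β × Ω => s.indicator (fun _ => ν.rnDeriv (P.map u) p.1) p.2 := by
    have : (fun p : β × Ω => s.indicator (fun _ => ν.rnDeriv (P.map u) p.1) p.2) =
        (Prod.snd ⁻¹' s).indicator fun p => ν.rnDeriv (P.map u) p.1 := by
      rfl
    rw [this]
    exact (hg.comp measurable_fst).indicator (measurable_snd hs)
  have h2 := congrArg (fun M => ∫⁻ p, s.indicator (fun _ => ν.rnDeriv (P.map u) p.1) p.2 ∂M) h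
  rw [Measure.lintegral_compProd hF, lintegral_map hF (hu.prodMk measurable_id)] at h2
  simp only [id] at h2
  rw [show (∫⁻ ω, s.indicator (fun ω => ν.rnDeriv (P.map u) (u ω)) ω ∂P) =
    ∫⁻ a, s.indicator (fun _ => ν.rnDeriv (P.map u) (u a)) a ∂P from rfl, ← h2]
  refine lintegral_congr fun x => ?_
  rw [lintegral_indicator hs, lintegral_const, Measure.restrict_apply_univ]
  rfl

lemma lintegral_tilt (hu : Measurable u) {ν : Measure β} [SigmaFinite ν] (hν : ν ≪ P.map u)
    {F : β → ℝ≥0∞} (hF : Measurable F) :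
    ∫⁻ ω, F (u ω) ∂(P.withDensity fun ω => ν.rnDeriv (P.map u) (u ω)) = ∫⁻ x, F x ∂ν := by
  have hg := Measure.measurable_rnDeriv ν (P.map u)
  rw [lintegral_withDensity_eq_lintegral_mul P (f := fun ω => ν.rnDeriv (P.map u) (u ω))
    (hg.comp hu) (g := fun ω => F (u ω)) (hF.comp hu)]
  conv_rhs => rw [← Measure.withDensity_rnDeriv_eq ν _ hν]
  rw [lintegral_withDensity_eq_lintegral_mul _ hg hF, lintegral_map (hg.mul hF) hu]
  rfl

lemma map_tilt (hu : Measurable u) {ν : Measure β} [SigmaFinite ν] (hν : ν ≪ P.map u) :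
    (P.withDensity fun ω => ν.rnDeriv (P.map u) (u ω)).map u = ν := by
  ext s hs
  rw [Measure.map_apply hu hs]
  have := lintegral_tilt hu hν (F := s.indicator 1) (measurable_one.indicator hs)
  rw [lintegral_indicator_one hs] at this
  rw [← this, ← lintegral_indicator_one (hu hs)]
  rfl

/-- Reweighting by a function of `u` does not change the law of what is independent of `u`. -/
lemma lintegral_tilt_of_indepFun (hu : Measurable u) {ν : Measure β} [IsProbabilityMeasure ν]
    (hν : ν ≪ P.map u) {F : Ω → ℝ≥0∞} (hF : Measurable F) (hi : IndepFun u F P) :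
    ∫⁻ ω, F ω ∂(P.withDensity fun ω => ν.rnDeriv (P.map u) (u ω)) = ∫⁻ ω, F ω ∂P := by
  have hg := Measure.measurable_rnDeriv ν (P.map u)
  rw [lintegral_withDensity_eq_lintegral_mul P (f := fun ω => ν.rnDeriv (P.map u) (u ω))
    (hg.comp hu) hF, show (fun ω => ν.rnDeriv (P.map u) (u ω)) = ν.rnDeriv (P.map u) ∘ u from rfl,
    lintegral_mul_eq_lintegral_mul_lintegral_of_indepFun (hg.comp hu) hF
      (hi.comp hg measurable_id)]
  have : ∫⁻ ω, (ν.rnDeriv (P.map u) ∘ u) ω ∂P = 1 := by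
    have h := lintegral_tilt hu hν (F := 1) measurable_one
    rw [lintegral_withDensity_eq_lintegral_mul P (f := fun ω => ν.rnDeriv (P.map u) (u ω))
      (hg.comp hu) (by fun_prop)] at h
    simpa using h
  rw [this, one_mul]

end Tilt

/-! ### Densities of the form exp h and their Kullback-Leibler divergence. -/

section Density

variable {α : Type*} [MeasurableSpace α]

/-- The density `exp h`, with values in `[0, ∞]`. -/
def expDensity (h : α → ℝ) (x : α) : ℝ≥0∞ := ENNReal.ofReal (Real.exp (h x))

lemma measurable_expDensity {h : α → ℝ} (hh : Measurable h) : Measurable (expDensity h) := by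
  unfold expDensity; fun_prop

/-- Exponential densities are positive and finite everywhere, so the base measure can be changed by
subtracting real exponents, with no division in [0, ∞]. -/
lemma withDensity_expDensity_sub (ρ : Measure α) {p r : α → ℝ} (hp : Measurable p)
    (hr : Measurable r) :
    (ρ.withDensity (expDensity r)).withDensity (expDensity (p - r)) =
      ρ.withDensity (expDensity p) := by
  rw [← withDensity_mul _ (measurable_expDensity hr) (measurable_expDensity (hp.sub hr))]
  congr 1
  ext x
  simp only [expDensity, Pi.mul_apply, Pi.sub_apply]
  rw [← ENNReal.ofReal_mul (Real.exp_pos _).le, ← Real.exp_add]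
  congr 2
  ring

lemma withDensity_expDensity_add_const (ρ : Measure α) {p : α → ℝ} (hp : Measurable p) (c : ℝ) :
    ρ.withDensity (expDensity fun x => p x + c) =
      ENNReal.ofReal (Real.exp c) • ρ.withDensity (expDensity p) := by
  rw [← withDensity_smul _ (measurable_expDensity hp)]
  congr 1
  ext x
  simp only [expDensity, Pi.smul_apply, smul_eq_mul]
  rw [← ENNReal.ofReal_mul (Real.exp_pos _).le, ← Real.exp_add, add_comm]

lemma absolutelyContinuous_withDensity_expDensity (ρ : Measure α) {p : α → ℝ}
    (hp : Measurable p) : ρ ≪ ρ.withDensity (expDensity p) :=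
  withDensity_absolutelyContinuous' (measurable_expDensity hp).aemeasurable
    (ae_of_all _ fun x => by simp [expDensity, Real.exp_pos])

lemma llr_withDensity_expDensity {ρ ν : Measure α} [IsFiniteMeasure ρ] {p : α → ℝ}
    (hp : Measurable p) (hν : ν = ρ.withDensity (expDensity p)) : llr ν ρ =ᵐ[ν] p := by
  have h : llr ν ρ =ᵐ[ρ] p := by
    filter_upwards [Measure.rnDeriv_withDensity ρ (measurable_expDensity hp)] with x hx
    rw [hν]
    simp only [llr_def]
    rw [hx, expDensity, ENNReal.toReal_ofReal (Real.exp_pos _).le, Real.log_exp]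
  exact (hν ▸ withDensity_absolutelyContinuous _ _ : ν ≪ ρ).ae_le h

/-- The sign of the integral is recorded because `ENNReal.ofReal` truncates negative numbers: it is
what later allows the divergence to be split into a sum. -/
lemma klDiv_withDensity_expDensity {ρ ν : Measure α} [IsProbabilityMeasure ρ]
    [IsProbabilityMeasure ν] {p : α → ℝ} (hp : Measurable p)
    (hν : ν = ρ.withDensity (expDensity p)) (hi : Integrable p ν) :
    InformationTheory.klDiv ν ρ = ENNReal.ofReal (∫ x, p x ∂ν) ∧ 0 ≤ ∫ x, p x ∂ν := by
  have hl := llr_withDensity_expDensity hp hν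
  have hac : ν ≪ ρ := hν ▸ withDensity_absolutelyContinuous _ _
  have hli : Integrable (llr ν ρ) ν := hi.congr hl.symm
  have h1 := InformationTheory.klDiv_of_ac_of_integrable hac hli
  have h2 := InformationTheory.integral_llr_add_sub_measure_univ_nonneg hac hli
  simp only [probReal_univ, integral_congr_ae hl] at h1 h2
  exact ⟨by simpa using h1, by simpa using h2⟩

lemma map_withDensity_of_leftInverse {β : Type*} [MeasurableSpace β] (ρ : Measure α)
    {F : α → ℝ≥0∞} (hF : Measurable F) {f : α → β} {g : β → α} (hf : Measurable f)
    (hg : Measurable g) (hgf : Function.LeftInverse g f) :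
    (ρ.withDensity F).map f = (ρ.map f).withDensity (F ∘ g) := by
  ext s hs
  rw [Measure.map_apply hf hs, withDensity_apply _ (hf hs), withDensity_apply _ hs,
    setLIntegral_map hs (hF.comp hg) hf]
  simp [Function.comp_apply, hgf _]

end Density

/-! ### Product measures and product densities. -/

section Pi

variable {ι : Type*} [Fintype ι] {α : ι → Type*} [∀ i, MeasurableSpace (α i)]
  (ν : ∀ i, Measure (α i)) [∀ i, IsProbabilityMeasure (ν i)]

lemma lintegral_pi_prod {f : ∀ i, α i → ℝ≥0∞} (hf : ∀ i, Measurable (f i)) :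
    ∫⁻ x, ∏ i, f i (x i) ∂(Measure.pi ν) = ∏ i, ∫⁻ y, f i y ∂(ν i) := by
  refine (lintegral_prod_eq_prod_lintegral_of_indepFun Finset.univ
    (fun i (x : ∀ i, α i) => f i (x i))
    (iIndepFun_pi fun i => (hf i).aemeasurable)
    (fun i => (hf i).comp (measurable_pi_apply i))).trans ?_
  exact Finset.prod_congr rfl fun i _ =>
    (measurePreserving_eval ν i).lintegral_comp (hf i)

/-- It suffices to compare on boxes, where the indicator factorises along with the density. -/
lemma pi_withDensity {f : ∀ i, α i → ℝ≥0∞} (hf : ∀ i, Measurable (f i))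
    [∀ i, SigmaFinite ((ν i).withDensity (f i))] :
    Measure.pi (fun i => (ν i).withDensity (f i)) =
      (Measure.pi ν).withDensity fun x => ∏ i, f i (x i) := by
  refine Measure.pi_eq fun s hs => ?_
  rw [withDensity_apply _ (MeasurableSet.univ_pi hs), ← lintegral_indicator (.univ_pi hs)]
  simp_rw [withDensity_apply _ (hs _), ← lintegral_indicator (hs _)]
  rw [← lintegral_pi_prod ν fun i => (hf i).indicator (hs i)]
  refine lintegral_congr fun x => ?_
  by_cases hx : x ∈ Set.univ.pi s
  · rw [Set.indicator_of_mem hx]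
    exact Finset.prod_congr rfl fun i _ => (Set.indicator_of_mem (hx i trivial) _).symm
  · rw [Set.indicator_of_notMem hx]
    simp only [Set.mem_pi, Set.mem_univ, true_imp_iff, not_forall] at hx
    obtain ⟨i, hi⟩ := hx
    exact (Finset.prod_eq_zero (Finset.mem_univ i) (Set.indicator_of_notMem hi _)).symm

end Pi

/-! ### Lebesgue densities of multivariate Gaussian laws. -/

section Gaussian

open Matrix WithLp
open scoped RealInnerProductSpace MatrixOrder

variable {ι : Type*} [Fintype ι]

lemma gaussianPDF_eq_expDensity (a : ℝ) {v : ℝ≥0} (hv : v ≠ 0) (x : ℝ) :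
    gaussianPDF a v x =
      expDensity (fun x => -Real.log (√(2 * Real.pi * v)) - (x - a) ^ 2 / (2 * v)) x := by
  have hpos : 0 < √(2 * Real.pi * v) := by
    have : (0 : ℝ) < v := by positivity
    positivity
  rw [gaussianPDF, expDensity, gaussianPDFReal, sub_eq_add_neg (-_) (_ / _), Real.exp_add, Real.exp_neg,
    Real.exp_log hpos, neg_div, Real.exp_neg]

/-- Presents Lebesgue measure as a density over a probability measure, the setting of
`pi_withDensity`; the product formula obtained there is then inverted. -/
lemma volume_eq_withDensity_inv_gaussianPDF :
    (volume : Measure ℝ) = (gaussianReal 0 1).withDensity fun x => (gaussianPDF 0 1 x)⁻¹ := by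
  rw [gaussianReal_of_var_ne_zero 0 one_ne_zero]
  exact (withDensity_inv_same (measurable_gaussianPDF 0 1)
    (ae_of_all _ fun x => (gaussianPDF_pos 0 one_ne_zero x).ne')
    (ae_of_all _ fun x => gaussianPDF_ne_top)).symm

lemma pi_gaussianReal_eq_withDensity :
    Measure.pi (fun _ : ι => gaussianReal 0 1) =
      volume.withDensity fun x => ∏ i, gaussianPDF 0 1 (x i) := by
  have hm : Measurable fun x => (gaussianPDF 0 1 x)⁻¹ := (measurable_gaussianPDF 0 1).inv
  have : SigmaFinite ((gaussianReal 0 1).withDensity fun x => (gaussianPDF 0 1 x)⁻¹) := by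
    rw [← volume_eq_withDensity_inv_gaussianPDF]; infer_instance
  rw [volume_pi]
  conv_rhs => rw [volume_eq_withDensity_inv_gaussianPDF, pi_withDensity (fun _ : ι => gaussianReal 0 1)
    (f := fun _ x => (gaussianPDF 0 1 x)⁻¹) fun _ => hm]
  have h : (fun x : ι → ℝ => ∏ i, gaussianPDF 0 1 (x i)) =
      (fun x : ι → ℝ => ∏ i, (gaussianPDF 0 1 (x i))⁻¹)⁻¹ := by
    ext x
    rw [Pi.inv_apply, ENNReal.prod_inv_distrib]
    · simp
    · intro i _ j _ _
      exact Or.inl (ENNReal.inv_ne_zero.2 gaussianPDF_ne_top)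
  rw [h]
  refine (withDensity_inv_same ?_ ?_ ?_).symm
  · exact Finset.measurable_prod _ fun i _ => hm.comp (measurable_pi_apply i)
  · exact ae_of_all _ fun x => Finset.prod_ne_zero_iff.2 fun i _ =>
      ENNReal.inv_ne_zero.2 gaussianPDF_ne_top
  · exact ae_of_all _ fun x => ENNReal.prod_ne_top fun i _ =>
      ENNReal.inv_ne_top.2 (gaussianPDF_pos 0 one_ne_zero _).ne'

/-- Only the quadratic form in the exponent is ever used, so the normalising constant stays
unspecified here and below. -/
lemma stdGaussian_eq_withDensity : ∃ k : ℝ, stdGaussian (EuclideanSpace ℝ ι) =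
    volume.withDensity (expDensity fun x => k - ‖x‖ ^ 2 / 2) := by
  refine ⟨∑ _i : ι, -Real.log √(2 * Real.pi * (1 : ℝ≥0)), ?_⟩
  have hF : Measurable fun x : ι → ℝ => ∏ i, gaussianPDF 0 1 (x i) :=
    Finset.measurable_prod _ fun i _ => (measurable_gaussianPDF 0 1).comp (measurable_pi_apply i)
  rw [← map_pi_eq_stdGaussian, pi_gaussianReal_eq_withDensity,
    map_withDensity_of_leftInverse _ hF (WithLp.measurable_toLp 2 _)
      (WithLp.measurable_ofLp 2 _) (fun x => rfl),
    (PiLp.volume_preserving_toLp ι).map_eq]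
  congr 1
  ext x
  simp only [Function.comp_apply, gaussianPDF_eq_expDensity 0 one_ne_zero, expDensity]
  rw [← ENNReal.ofReal_prod_of_nonneg fun i _ => (Real.exp_pos _).le, ← Real.exp_sum,
    EuclideanSpace.real_norm_sq_eq, Finset.sum_sub_distrib, Finset.sum_div]
  simp

variable [DecidableEq ι]

/-- Change of variables along the map x ↦ a + √S x which defines the law. `B` = √(S⁻¹) inverts the
linear part and turns the squared norm into the form of S⁻¹; the Jacobian only shifts the constant.
-/
lemma multivariateGaussian_eq_withDensity (a : EuclideanSpace ℝ ι) {S : Matrix ι ι ℝ}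
    (hS : S.PosDef) : ∃ k : ℝ, multivariateGaussian a S = volume.withDensity
      (expDensity fun x => k - (x - a).ofLp ⬝ᵥ S⁻¹ *ᵥ (x - a).ofLp / 2) := by
  obtain ⟨k, hk⟩ := stdGaussian_eq_withDensity (ι := ι)
  set A := toEuclideanCLM (𝕜 := ℝ) (CFC.sqrt S)
  set B := toEuclideanCLM (𝕜 := ℝ) (CFC.sqrt S⁻¹)
  have hpd : S⁻¹.PosDef := hS.inv
  have hsq : CFC.sqrt S⁻¹ * CFC.sqrt S⁻¹ = S⁻¹ :=
    CFC.sqrt_mul_sqrt_self _ hpd.posSemidef.nonneg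
  have hinv : CFC.sqrt S⁻¹ * CFC.sqrt S = 1 := by
    rw [← hS.posSemidef.inv_sqrt]
    refine Matrix.nonsing_inv_mul _ ?_
    have := hS.posSemidef.det_sqrt
    rw [this]
    simpa using (Real.sqrt_pos.2 hS.det_pos).ne'
  have hBA : ∀ x, B (A x) = x := fun x => by
    have : B * A = 1 := by rw [← map_mul, hinv, map_one]
    exact congrArg (fun L => L x) this
  have hB : ∀ z, ‖B z‖ ^ 2 = z.ofLp ⬝ᵥ S⁻¹ *ᵥ z.ofLp := fun z => by
    have hsa : IsSelfAdjoint B := (CFC.sqrt_nonneg S⁻¹).isSelfAdjoint.map _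
    rw [← real_inner_self_eq_norm_sq, ← ContinuousLinearMap.adjoint_inner_right,
      hsa.adjoint_eq, ← inner_toEuclideanCLM, ← hsq, map_mul]
    rfl
  have hdet : LinearMap.det (A : EuclideanSpace ℝ ι →ₗ[ℝ] EuclideanSpace ℝ ι) ≠ 0 := by
    intro h0
    have h1 : ((B : EuclideanSpace ℝ ι →ₗ[ℝ] EuclideanSpace ℝ ι) ∘ₗ
        (A : EuclideanSpace ℝ ι →ₗ[ℝ] EuclideanSpace ℝ ι)) = LinearMap.id :=
      LinearMap.ext hBA
    have h2 := congrArg LinearMap.det h1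
    rw [LinearMap.det_comp, h0, mul_zero, LinearMap.det_id] at h2
    exact zero_ne_one h2
  set c := |(LinearMap.det (A : EuclideanSpace ℝ ι →ₗ[ℝ] EuclideanSpace ℝ ι))⁻¹|
  have hc : 0 < c := abs_pos.2 (inv_ne_zero hdet)
  have hvol : (volume : Measure (EuclideanSpace ℝ ι)).map (fun x => a + A x) =
      ENNReal.ofReal c • volume := by
    have h1 : (volume : Measure (EuclideanSpace ℝ ι)).map A = ENNReal.ofReal c • volume :=
      Measure.map_linearMap_addHaar_eq_smul_addHaar volume hdet
    have h2 : (fun x => a + A x) = (fun x => a + x) ∘ A := rfl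
    rw [h2, ← Measure.map_map (measurable_const_add a) (by fun_prop), h1, Measure.map_smul,
      map_add_left_eq_self]
  refine ⟨k + Real.log c, ?_⟩
  have hF : Measurable fun x : EuclideanSpace ℝ ι => k - ‖x‖ ^ 2 / 2 := by fun_prop
  have hl : Function.LeftInverse (fun y => B (y - a)) (fun x => a + A x) := fun x => by
    simp [hBA]
  rw [multivariateGaussian, hk, map_withDensity_of_leftInverse _ (measurable_expDensity hF)
    (by fun_prop) (by fun_prop) hl, hvol, withDensity_smul_measure]
  have : (fun x : EuclideanSpace ℝ ι =>
      k + Real.log c - (x - a).ofLp ⬝ᵥ S⁻¹ *ᵥ (x - a).ofLp / 2) =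
      fun x => (k - ‖B (x - a)‖ ^ 2 / 2) + Real.log c := by
    ext x; rw [hB]; ring
  rw [this, withDensity_expDensity_add_const _ (by fun_prop), Real.exp_log hc]
  rfl

end Gaussian

/-! ### Series converging absolutely in L² of a probability space. -/

section Series

variable {Ω : Type*} [MeasurableSpace Ω] {P : Measure Ω} [IsProbabilityMeasure P]

/-- A series of centred square-integrable functions that converges absolutely in `L²` converges
almost everywhere, to a centred square-integrable function. -/
lemma series_L2 {G : ℕ → Ω → ℝ} (hG : ∀ j, MemLp (G j) 2 P)
    (hs : ∑' j, eLpNorm (G j) 2 P ≠ ∞) (h0 : ∀ j, ∫ ω, G j ω ∂P = 0) :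
    (∀ᵐ ω ∂P, Summable fun j => G j ω) ∧ MemLp (fun ω => ∑' j, G j ω) 2 P ∧
      ∫ ω, ∑' j, G j ω ∂P = 0 := by
  refine ⟨?_, ?_, ?_⟩
  · filter_upwards [summable_norm_of_tsum_eLpNorm_ne_top one_le_two (fun j => (hG j).1) hs]
      with ω hω using hω.of_norm
  · have hs' : ∑' j, ‖(hG j).toLp‖ₑ ≠ ∞ := by simpa [Lp.enorm_toLp] using hs
    refine (Lp.memLp (∑' j, (hG j).toLp)).ae_eq ?_
    filter_upwards [Lp.coeFn_tsum hs', ae_all_iff.2 fun j => (hG j).coeFn_toLp] with ω h1 h2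
    rw [h1]
    exact tsum_congr h2
  · rw [integral_tsum (fun j => (hG j).1)]
    · simp [h0]
    · refine ne_top_of_le_ne_top hs (ENNReal.tsum_le_tsum fun j => ?_)
      rw [← eLpNorm_one_eq_lintegral_enorm]
      exact eLpNorm_le_eLpNorm_of_exponent_le one_le_two (hG j).1

end Series

/-! ### Reweighting by u preserves independence of u. -/

section TiltIndep

variable {Ω β : Type*} [MeasurableSpace Ω] [MeasurableSpace β]
  {P : Measure Ω} [IsFiniteMeasure P] {u : Ω → β}

lemma isProbabilityMeasure_tilt (hu : Measurable u) {ν : Measure β} [IsProbabilityMeasure ν]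
    (hν : ν ≪ P.map u) :
    IsProbabilityMeasure (P.withDensity fun ω => ν.rnDeriv (P.map u) (u ω)) := by
  constructor
  have := congrArg (fun M : Measure β => M Set.univ) (map_tilt hu hν)
  simpa [Measure.map_apply hu MeasurableSet.univ] using this

lemma map_tilt_of_indepFun (hu : Measurable u) {ν : Measure β} [IsProbabilityMeasure ν]
    (hν : ν ≪ P.map u) {t : Ω → ℝ} (ht : Measurable t) (hi : IndepFun u t P) :
    (P.withDensity fun ω => ν.rnDeriv (P.map u) (u ω)).map t = P.map t := by
  ext s hs
  rw [Measure.map_apply ht hs, Measure.map_apply ht hs, ← lintegral_indicator_one (ht hs),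
    ← lintegral_indicator_one (ht hs)]
  have h1 : Measurable (s.indicator (1 : ℝ → ℝ≥0∞)) := measurable_one.indicator hs
  exact lintegral_tilt_of_indepFun hu hν (h1.comp ht) (hi.comp measurable_id h1)

/-- The density depends on u alone, so it joins the factor in u when an expectation of a product is
split. -/
lemma indepFun_tilt (hu : Measurable u) {ν : Measure β} [IsProbabilityMeasure ν]
    (hν : ν ≪ P.map u) {t : Ω → ℝ} (ht : Measurable t) (hi : IndepFun u t P) :
    IndepFun u t (P.withDensity fun ω => ν.rnDeriv (P.map u) (u ω)) := by
  have hg := Measure.measurable_rnDeriv ν (P.map u)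
  have hm : ∀ s : Set Ω, MeasurableSet s →
      (P.withDensity fun ω => ν.rnDeriv (P.map u) (u ω)) s =
        ∫⁻ ω, ν.rnDeriv (P.map u) (u ω) * s.indicator 1 ω ∂P := fun s hs => by
    rw [withDensity_apply _ hs, ← lintegral_indicator hs]
    refine lintegral_congr fun ω => ?_
    by_cases h : ω ∈ s <;> simp [h]
  rw [indepFun_iff_measure_inter_preimage_eq_mul]
  intro s r hs hr
  have hB : (P.withDensity fun ω => ν.rnDeriv (P.map u) (u ω)) (t ⁻¹' r) = P (t ⁻¹' r) := by
    rw [← Measure.map_apply ht hr, map_tilt_of_indepFun hu hν ht hi, Measure.map_apply ht hr]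
  have hs1 : Measurable (s.indicator (1 : β → ℝ≥0∞)) := measurable_one.indicator hs
  have hr1 : Measurable (r.indicator (1 : ℝ → ℝ≥0∞)) := measurable_one.indicator hr
  rw [hB, hm _ ((hu hs).inter (ht hr)), hm _ (hu hs), ← lintegral_indicator_one (ht hr)]
  have hsplit := lintegral_mul_eq_lintegral_mul_lintegral_of_indepFun
    (f := fun ω => ν.rnDeriv (P.map u) (u ω) * s.indicator 1 (u ω))
    (g := fun ω => r.indicator 1 (t ω)) ((hg.mul hs1).comp hu) (hr1.comp ht)
    (hi.comp (hg.mul hs1) hr1)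
  refine Eq.trans (lintegral_congr fun ω => ?_) hsplit
  simp only [Pi.mul_apply]
  by_cases h1 : u ω ∈ s <;> by_cases h2 : t ω ∈ r <;> simp [h1, h2]

end TiltIndep

/-! ### The tail of a sample path under the prior. -/

section PriorTail

variable {𝒳 : Type*} [MeasurableSpace 𝒳] [MeasurableSpace.CountablyGenerated 𝒳]
  {μ : Measure 𝒳} [IsProbabilityMeasure μ] (b : HilbertBasis ℕ ℝ (L2 μ)) {lam : ℕ → ℝ≥0}

lemma eLpNorm_coord (hs : Summable lam) (j : ℕ) :
    eLpNorm (coord b j) 2 (gpPrior b lam) = ENNReal.ofReal √(lam j) := by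
  have h := eLpNorm_map_measure (p := 2) (g := (id : ℝ → ℝ)) (μ := gpPrior b lam) (f := coord b j)
    (by fun_prop) (measurable_coord b j).aemeasurable
  rw [Function.id_comp] at h
  rw [← h, map_coord_gpPrior_apply b hs,
    eLpNorm_eq_lintegral_rpow_enorm_toReal (by norm_num) (by norm_num)]
  have h2 : ∀ x : ℝ, ‖id x‖ₑ ^ (2 : ℝ≥0∞).toReal = ENNReal.ofReal (x ^ 2) := fun x => by
    rw [ENNReal.toReal_ofNat, ENNReal.rpow_ofNat, id, ← ofReal_norm,
      ← ENNReal.ofReal_pow (norm_nonneg _), Real.norm_eq_abs, sq_abs]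
  simp_rw [h2]
  rw [lintegral_sq_gaussianReal, Real.sqrt_eq_rpow, ← ENNReal.ofReal_rpow_of_nonneg
    (NNReal.coe_nonneg _) (by norm_num), ENNReal.ofReal_coe_nnreal]
  norm_num

lemma memLp_coord (hs : Summable lam) (j : ℕ) : MemLp (coord b j) 2 (gpPrior b lam) :=
  ⟨(measurable_coord b j).aestronglyMeasurable, by rw [eLpNorm_coord b hs]; simp⟩

lemma integral_coord (hs : Summable lam) (j : ℕ) : ∫ f, coord b j f ∂(gpPrior b lam) = 0 := by
  have := integral_map (μ := gpPrior b lam) (measurable_coord b j).aemeasurable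
    (f := fun x : ℝ => x) (by fun_prop)
  rw [← this, map_coord_gpPrior_apply b hs, integral_id_gaussianReal]

/-- The contribution of the coordinates from `m` on to the value of the path at `x`. -/
def pathTail (φ : ℕ → 𝒳 → ℝ) (m : ℕ) (x : 𝒳) (f : L2 μ) : ℝ :=
  ∑' j, coord b (j + m) f * φ (j + m) x

variable {φ : ℕ → 𝒳 → ℝ} {K : ℝ}

/-- Measurability is relative to the σ-algebra of the coordinates from m on, the form which
`indepFun_inducing` requires. -/
lemma measurable_pathTail (m : ℕ) (x : 𝒳) :
    Measurable[⨆ j ∈ Set.Ici m, (inferInstance : MeasurableSpace ℝ).comap (coord b j)]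
      (pathTail b φ m x) := by
  unfold pathTail
  refine @Measurable.tsum _ _ _ (_) _ _ _ _ _ _ _ _ _ _ _ _ fun j => ?_
  refine @Measurable.mul_const _ _ _ _ _ (_) _ ?_ _
  exact (comap_measurable (coord b (j + m))).mono (le_iSup₂_of_le
    (f := fun j (_ : j ∈ Set.Ici m) => (inferInstance : MeasurableSpace ℝ).comap (coord b j))
    (j + m) (Nat.le_add_left m j) le_rfl) le_rfl

lemma measurable_pathTail' (m : ℕ) (x : 𝒳) : Measurable (pathTail b φ m x) := by
  unfold pathTail
  exact Measurable.tsum fun j => (measurable_coord b _).mul_const _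

lemma indepFun_inducing_pathTail (hs : Summable lam) (m : ℕ) (x : 𝒳) :
    IndepFun (inducing b m) (pathTail b φ m x) (gpPrior b lam) :=
  indepFun_inducing b hs m (measurable_pathTail b m x)

/-- The j-th term has L² norm at most K √λ_j, so summability of the √λ_j is what makes `series_L2`
apply. -/
lemma pathTail_prior (hs : Summable lam) (hsq : Summable fun j => √(lam j : ℝ))
    (hK : ∀ j x, |φ j x| ≤ K) (m : ℕ) (x : 𝒳) :
    (∀ᵐ f ∂(gpPrior b lam), Summable fun j => coord b (j + m) f * φ (j + m) x) ∧
      MemLp (pathTail b φ m x) 2 (gpPrior b lam) ∧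
      ∫ f, pathTail b φ m x f ∂(gpPrior b lam) = 0 := by
  have hK0 : 0 ≤ K := (abs_nonneg _).trans (hK 0 x)
  refine series_L2 (fun j => (memLp_coord b hs _).mul_const _) ?_ fun j => by
    rw [integral_mul_const, integral_coord b hs, zero_mul]
  have hle : ∀ j, eLpNorm (fun f => coord b (j + m) f * φ (j + m) x) 2 (gpPrior b lam) ≤
      ENNReal.ofReal (K * √(lam (j + m) : ℝ)) := fun j => by
    rw [ENNReal.ofReal_mul hK0, ← eLpNorm_coord b hs]
    refine eLpNorm_le_mul_eLpNorm_of_ae_le_mul (ae_of_all _ fun f => ?_) 2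
    rw [norm_mul, mul_comm, Real.norm_eq_abs]
    exact mul_le_mul_of_nonneg_right (hK _ _) (norm_nonneg _)
  refine ne_top_of_le_ne_top ?_ (ENNReal.tsum_le_tsum hle)
  exact (((summable_nat_add_iff m).2 hsq).mul_left K).tsum_ofReal_ne_top

lemma pathValue_eq_add_pathTail {f : L2 μ} {x : 𝒳} (m : ℕ)
    (h : Summable fun j => coord b (j + m) f * φ (j + m) x) :
    pathValue φ b f x = ∑ j : Fin m, inducing b m f j * φ j x + pathTail b φ m x f := by
  have h' : Summable fun j => coord b j f * φ j x :=
    (summable_nat_add_iff (f := fun j => coord b j f * φ j x) m).1 h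
  have := h'.sum_add_tsum_nat_add m
  rw [pathValue, pathTail]
  refine this.symm.trans ?_
  rw [← Fin.sum_univ_eq_sum_range (fun j => coord b j f * φ j x)]
  rfl

end PriorTail

/-! ### Algebra of Bayesian linear regression. -/

section Regression

open Matrix WithLp
open scoped MatrixOrder

variable {𝒳 : Type*}

/-- The design matrix of the first `m` basis functions. -/
def design (φ : ℕ → 𝒳 → ℝ) (m : ℕ) {n : ℕ} (x : Fin n → 𝒳) : Matrix (Fin n) (Fin m) ℝ :=
  Matrix.of fun i j => φ j (x i)

/-- The precision matrix `Λ⁻¹ + σ⁻² Φᵀ Φ` of the optimal law of the inducing variables. -/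
def precision (lam : ℕ → ℝ≥0) (σ : ℝ≥0) {n m : ℕ} (Φ : Matrix (Fin n) (Fin m) ℝ) :
    Matrix (Fin m) (Fin m) ℝ :=
  diagonal (fun j : Fin m => ((lam j : ℝ))⁻¹) + ((σ : ℝ) ^ 2)⁻¹ • (Φᵀ * Φ)

/-- The mean of the optimal law of the inducing variables. -/
def optMean (lam : ℕ → ℝ≥0) (σ : ℝ≥0) {n m : ℕ} (Φ : Matrix (Fin n) (Fin m) ℝ) (y : Fin n → ℝ) :
    EuclideanSpace ℝ (Fin m) :=
  toLp 2 ((precision lam σ Φ)⁻¹ *ᵥ (((σ : ℝ) ^ 2)⁻¹ • (Φᵀ *ᵥ y)))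

variable {lam : ℕ → ℝ≥0} {σ : ℝ≥0} {n m : ℕ}

lemma posDef_precision (hlam : ∀ j, 0 < lam j) (Φ : Matrix (Fin n) (Fin m) ℝ) :
    (precision lam σ Φ).PosDef := by
  refine Matrix.PosDef.add_posSemidef (Matrix.PosDef.diagonal fun j => ?_) ?_
  · have : (0 : ℝ) < lam j := hlam j
    positivity
  · have h := Matrix.posSemidef_conjTranspose_mul_self Φ
    rw [Matrix.conjTranspose_eq_transpose_of_trivial] at h
    exact h.smul (by positivity)

lemma precision_mulVec_optMean (hlam : ∀ j, 0 < lam j) (Φ : Matrix (Fin n) (Fin m) ℝ)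
    (y : Fin n → ℝ) :
    precision lam σ Φ *ᵥ (optMean lam σ Φ y).ofLp = ((σ : ℝ) ^ 2)⁻¹ • (Φᵀ *ᵥ y) := by
  have hu : IsUnit (precision lam σ Φ).det := (posDef_precision hlam Φ).det_pos.ne'.isUnit
  simp only [optMean, mulVec_mulVec, mul_nonsing_inv _ hu, one_mulVec]

lemma dotProduct_precision (Φ : Matrix (Fin n) (Fin m) ℝ) (v w : Fin m → ℝ) :
    v ⬝ᵥ precision lam σ Φ *ᵥ w =
      ∑ j : Fin m, ((lam j : ℝ))⁻¹ * (v j * w j) + ((σ : ℝ) ^ 2)⁻¹ * ((Φ *ᵥ v) ⬝ᵥ (Φ *ᵥ w)) := by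
  have h1 : v ⬝ᵥ (Φᵀ * Φ) *ᵥ w = (Φ *ᵥ v) ⬝ᵥ (Φ *ᵥ w) := by
    rw [← mulVec_mulVec, dotProduct_mulVec, vecMul_transpose]
  rw [precision, add_mulVec, dotProduct_add, smul_mulVec, dotProduct_smul, h1, smul_eq_mul]
  congr 1
  simp only [dotProduct, mulVec_diagonal]
  exact Finset.sum_congr rfl fun j _ => by ring

/-- Completing the square. -/
lemma quadratic_optMean (hlam : ∀ j, 0 < lam j) (Φ : Matrix (Fin n) (Fin m) ℝ) (y : Fin n → ℝ) :
    ∃ c : ℝ, ∀ x : EuclideanSpace ℝ (Fin m),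
      (x - optMean lam σ Φ y).ofLp ⬝ᵥ precision lam σ Φ *ᵥ (x - optMean lam σ Φ y).ofLp =
        ∑ j : Fin m, ((lam j : ℝ))⁻¹ * (x j * x j) +
          ((σ : ℝ) ^ 2)⁻¹ * ∑ i, (y i - (Φ *ᵥ x.ofLp) i) ^ 2 + c := by
  set a := optMean lam σ Φ y with ha
  -- The remainder after completing the square depends on the data only, not on x, so it can be
  -- absorbed in a normalising constant.
  refine ⟨a.ofLp ⬝ᵥ precision lam σ Φ *ᵥ a.ofLp - ((σ : ℝ) ^ 2)⁻¹ * (y ⬝ᵥ y), fun x => ?_⟩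
  have hPa := precision_mulVec_optMean (σ := σ) hlam Φ y
  have hxa : x.ofLp ⬝ᵥ precision lam σ Φ *ᵥ a.ofLp =
      ((σ : ℝ) ^ 2)⁻¹ * ((Φ *ᵥ x.ofLp) ⬝ᵥ y) := by
    rw [ha, hPa, dotProduct_smul, smul_eq_mul, dotProduct_mulVec, vecMul_transpose]
  have hax : a.ofLp ⬝ᵥ precision lam σ Φ *ᵥ x.ofLp =
      x.ofLp ⬝ᵥ precision lam σ Φ *ᵥ a.ofLp := by
    rw [dotProduct_precision, dotProduct_precision, dotProduct_comm (Φ *ᵥ a.ofLp)]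
    congr 1
    exact Finset.sum_congr rfl fun j _ => by ring
  have hsq : ∑ i, (y i - (Φ *ᵥ x.ofLp) i) ^ 2 =
      y ⬝ᵥ y - 2 * ((Φ *ᵥ x.ofLp) ⬝ᵥ y) + (Φ *ᵥ x.ofLp) ⬝ᵥ (Φ *ᵥ x.ofLp) := by
    simp only [dotProduct, Finset.mul_sum]
    rw [← Finset.sum_sub_distrib, ← Finset.sum_add_distrib]
    exact Finset.sum_congr rfl fun i _ => by ring
  rw [ofLp_sub, mulVec_sub, sub_dotProduct, dotProduct_sub, dotProduct_sub, hax, hxa,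
    dotProduct_precision Φ x.ofLp x.ofLp, hsq]
  ring

end Regression

/-! ### Integrability of quadratic forms under Gaussian laws. -/

section GaussianIntegrability

open Matrix WithLp

variable {ι : Type*} [Fintype ι] [DecidableEq ι]

lemma memLp_eval_multivariateGaussian (a : EuclideanSpace ℝ ι) (S : Matrix ι ι ℝ) (i : ι) :
    MemLp (fun x => x i) 2 (multivariateGaussian a S) :=
  (EuclideanSpace.proj (𝕜 := ℝ) i : EuclideanSpace ℝ ι →L[ℝ] ℝ).comp_memLp'
    IsGaussian.memLp_two_id

lemma integrable_quadratic_multivariateGaussian (a a' : EuclideanSpace ℝ ι) (S M : Matrix ι ι ℝ) :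
    Integrable (fun x => (x - a').ofLp ⬝ᵥ M *ᵥ (x - a').ofLp) (multivariateGaussian a S) := by
  simp only [dotProduct, mulVec, Finset.mul_sum]
  refine integrable_finsetSum _ fun i _ => integrable_finsetSum _ fun j _ => ?_
  have h : ∀ i, MemLp (fun x : EuclideanSpace ℝ ι => (x - a').ofLp i) 2
      (multivariateGaussian a S) := fun i =>
    (memLp_eval_multivariateGaussian a S i).sub (memLp_const (a' i))
  have := ((h i).integrable_mul (h j)).const_mul (M i j)
  refine this.congr (ae_of_all _ fun x => ?_)
  simp only [Pi.mul_apply]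
  ring

lemma measurable_quadratic (a : EuclideanSpace ℝ ι) (M : Matrix ι ι ℝ) (k : ℝ) :
    Measurable fun x : EuclideanSpace ℝ ι => k - (x - a).ofLp ⬝ᵥ M *ᵥ (x - a).ofLp / 2 := by
  simp only [dotProduct, mulVec]
  fun_prop

end GaussianIntegrability

/-! ### The prior law of the inducing variables. -/

section Marginal

open Matrix WithLp

variable {𝒳 : Type*} [MeasurableSpace 𝒳] [MeasurableSpace.CountablyGenerated 𝒳]
  {μ : Measure 𝒳} [IsProbabilityMeasure μ] (b : HilbertBasis ℕ ℝ (L2 μ)) {lam : ℕ → ℝ≥0}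

/-- The coordinates are independent, so both characteristic functions equal exp(-∑ λ_j t_j² / 2). -/
lemma map_inducing_gpPrior (hs : Summable lam) (m : ℕ) :
    (gpPrior b lam).map (inducing b m) =
      multivariateGaussian 0 (diagonal fun j : Fin m => (lam j : ℝ)) := by
  have h1 : (gpPrior b lam).map (fun f (i : Fin m) => coord b i f) =
      Measure.pi fun i : Fin m => gaussianReal 0 (lam i) := by
    have h := (iIndepFun_coord b hs).precomp (g := fun i : Fin m => (i : ℕ)) Fin.val_injective
    rw [(iIndepFun_iff_map_fun_eq_pi_map fun i => (measurable_coord b _).aemeasurable).1 h]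
    simp_rw [map_coord_gpPrior_apply b hs]
  have h2 : (gpPrior b lam).map (inducing b m) =
      (Measure.pi fun i : Fin m => gaussianReal 0 (lam i)).map (toLp 2) := by
    rw [← h1, Measure.map_map (WithLp.measurable_toLp 2 _)
      (measurable_pi_lambda _ fun i => measurable_coord b _)]
    rfl
  have hps : (diagonal fun j : Fin m => (lam j : ℝ)).PosSemidef :=
    Matrix.PosSemidef.diagonal fun j => NNReal.coe_nonneg _
  have : IsProbabilityMeasure ((gpPrior b lam).map (inducing b m)) :=
    Measure.isProbabilityMeasure_map (measurable_inducing b m).aemeasurable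
  refine Measure.ext_of_charFun ?_
  ext t
  rw [h2, charFun_pi, charFun_multivariateGaussian hps]
  simp_rw [charFun_gaussianReal]
  rw [← Complex.exp_sum]
  simp only [Complex.ofReal_zero, mul_zero, zero_mul, zero_sub, inner_zero_right, dotProduct,
    mulVec_diagonal, Complex.ofReal_sum, Finset.sum_div, Finset.sum_neg_distrib]
  congr 2
  refine Finset.sum_congr rfl fun i _ => ?_
  push_cast
  ring

lemma exists_density_inducing (hs : Summable lam) (hlam : ∀ j, 0 < lam j) (m : ℕ) :
    ∃ k : ℝ, (gpPrior b lam).map (inducing b m) = volume.withDensity (expDensity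
      fun x : EuclideanSpace ℝ (Fin m) => k - (∑ j : Fin m, ((lam j : ℝ))⁻¹ * (x j * x j)) / 2) := by
  have hpd : (diagonal fun j : Fin m => (lam j : ℝ)).PosDef :=
    Matrix.PosDef.diagonal fun j => hlam j
  obtain ⟨k, hk⟩ := multivariateGaussian_eq_withDensity 0 hpd
  refine ⟨k, ?_⟩
  rw [map_inducing_gpPrior b hs m, hk]
  congr 2
  ext x
  have hinv : (diagonal fun j : Fin m => (lam j : ℝ))⁻¹ =
      diagonal fun j : Fin m => (lam j : ℝ)⁻¹ := by
    refine Matrix.inv_eq_left_inv ?_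
    rw [diagonal_mul_diagonal, ← diagonal_one]
    congr 1
    ext j
    exact inv_mul_cancel₀ (NNReal.coe_ne_zero.2 (hlam j).ne')
  rw [hinv]
  simp only [sub_zero, dotProduct, mulVec_diagonal]
  congr 2
  exact Finset.sum_congr rfl fun j _ => by ring

/-- Non-degenerate Gaussian laws are absolutely continuous with respect to the law of the inducing
variables. -/
lemma multivariateGaussian_absolutelyContinuous (hs : Summable lam) (hlam : ∀ j, 0 < lam j)
    {m : ℕ} (a : EuclideanSpace ℝ (Fin m)) {S : Matrix (Fin m) (Fin m) ℝ} (hS : S.PosDef) :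
    multivariateGaussian a S ≪ (gpPrior b lam).map (inducing b m) := by
  obtain ⟨k, hk⟩ := multivariateGaussian_eq_withDensity a hS
  obtain ⟨k', hk'⟩ := exists_density_inducing b hs hlam m
  rw [hk, hk']
  exact (withDensity_absolutelyContinuous _ _).trans
    (absolutelyContinuous_withDensity_expDensity _ (by fun_prop))

end Marginal

/-! ### The posterior as an exponential density over the prior. -/

section Posterior

variable {𝒳 : Type*} [MeasurableSpace 𝒳] [MeasurableSpace.CountablyGenerated 𝒳]
  {μ : Measure 𝒳} [IsProbabilityMeasure μ] (b : HilbertBasis ℕ ℝ (L2 μ)) {lam : ℕ → ℝ≥0}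
  (φ : ℕ → 𝒳 → ℝ) {σ : ℝ≥0} {n : ℕ}

/-- The logarithm of the likelihood. -/
def logLikelihood (σ : ℝ≥0) (z : Fin n → 𝒳 × ℝ) (f : L2 μ) : ℝ :=
  ∑ i, (-Real.log √(2 * Real.pi * (σ ^ 2 : ℝ≥0)) -
    ((z i).2 - pathValue φ b f (z i).1) ^ 2 / (2 * (σ ^ 2 : ℝ≥0)))

lemma measurable_pathValue (x : 𝒳) : Measurable fun f : L2 μ => pathValue φ b f x :=
  Measurable.tsum fun j => (measurable_coord b j).mul_const _

lemma measurable_logLikelihood (z : Fin n → 𝒳 × ℝ) :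
    Measurable (logLikelihood b φ σ z) := by
  have := measurable_pathValue b φ
  unfold logLikelihood
  fun_prop

lemma likelihood_eq_expDensity (hσ : 0 < σ) (z : Fin n → 𝒳 × ℝ) :
    likelihood φ b σ z = expDensity (logLikelihood b φ σ z) := by
  ext f
  have hv : σ ^ 2 ≠ 0 := by positivity
  rw [likelihood, expDensity, logLikelihood, Real.exp_sum,
    ENNReal.ofReal_prod_of_nonneg fun i _ => (Real.exp_pos _).le]
  exact Finset.prod_congr rfl fun i _ => gaussianPDF_eq_expDensity _ hv _

/-- The posterior has an everywhere positive density with respect to the prior. -/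
lemma posterior_eq_withDensity (lam : ℕ → ℝ≥0) (hσ : 0 < σ) (z : Fin n → 𝒳 × ℝ) :
    IsProbabilityMeasure (posterior φ b lam σ z) ∧ ∃ c : ℝ, posterior φ b lam σ z =
      (gpPrior b lam).withDensity (expDensity fun f => logLikelihood b φ σ z f + c) := by
  have hm := measurable_logLikelihood b φ (σ := σ) z
  have hv : (0 : ℝ) < (σ ^ 2 : ℝ≥0) := by positivity
  set Z := ∫⁻ f, likelihood φ b σ z f ∂(gpPrior b lam) with hZ
  -- The likelihood is positive everywhere, so the prior is absolutely continuous with respect to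
  -- the unnormalised posterior; zero total mass would make the prior vanish.
  have hZ0 : Z ≠ 0 := by
    rw [hZ, likelihood_eq_expDensity b φ hσ, ← setLIntegral_univ, ← withDensity_apply _ .univ]
    intro h
    have := absolutelyContinuous_withDensity_expDensity (gpPrior b lam) hm h
    simp at this
  -- The likelihood is bounded by its value at zero residuals.
  have hZt : Z ≠ ∞ := by
    rw [hZ, likelihood_eq_expDensity b φ hσ]
    refine ne_top_of_le_ne_top (b := ∫⁻ _, ENNReal.ofReal (Real.exp
      (∑ _i : Fin n, -Real.log √(2 * Real.pi * (σ ^ 2 : ℝ≥0)))) ∂(gpPrior b lam)) (by simp) ?_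
    refine lintegral_mono fun f => ENNReal.ofReal_le_ofReal (Real.exp_le_exp.2 ?_)
    refine Finset.sum_le_sum fun i _ => ?_
    have : 0 ≤ ((z i).2 - pathValue φ b f (z i).1) ^ 2 / (2 * (σ ^ 2 : ℝ≥0)) := by positivity
    linarith
  have hpost : posterior φ b lam σ z =
      (gpPrior b lam).withDensity
        (expDensity fun f => logLikelihood b φ σ z f + -Real.log Z.toReal) := by
    rw [withDensity_expDensity_add_const _ hm, posterior, likelihood_eq_expDensity b φ hσ]
    congr 1
    rw [Real.exp_neg, Real.exp_log (ENNReal.toReal_pos hZ0 hZt),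
      ENNReal.ofReal_inv_of_pos (ENNReal.toReal_pos hZ0 hZt), ENNReal.ofReal_toReal hZt, hZ,
      likelihood_eq_expDensity b φ hσ]
  refine ⟨⟨?_⟩, _, hpost⟩
  rw [posterior, Measure.smul_apply, withDensity_apply _ .univ, setLIntegral_univ, smul_eq_mul]
  exact ENNReal.inv_mul_cancel hZ0 hZt

end Posterior

/-! ### Solution of the variational problem. -/

section Variational

open Matrix

variable {𝒳 : Type*} [MeasurableSpace 𝒳] [MeasurableSpace.CountablyGenerated 𝒳]
  {μ : Measure 𝒳} [IsProbabilityMeasure μ] (b : HilbertBasis ℕ ℝ (L2 μ)) {lam : ℕ → ℝ≥0}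
  {φ : ℕ → 𝒳 → ℝ} {σ : ℝ≥0} {n m : ℕ} {K : ℝ}

/-- The element of the variational class with law `N(a, S)` of the inducing variables. -/
def variationalLaw (lam : ℕ → ℝ≥0) (a : EuclideanSpace ℝ (Fin m)) (S : Matrix (Fin m) (Fin m) ℝ) :
    Measure (L2 μ) :=
  (multivariateGaussian a S).bind (condDistrib id (inducing b m) (gpPrior b lam))

lemma variationalLaw_eq_tilt (hs : Summable lam) (hlam : ∀ j, 0 < lam j)
    (a : EuclideanSpace ℝ (Fin m)) {S : Matrix (Fin m) (Fin m) ℝ} (hS : S.PosDef) :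
    variationalLaw b lam a S = (gpPrior b lam).withDensity fun f =>
      (multivariateGaussian a S).rnDeriv ((gpPrior b lam).map (inducing b m)) (inducing b m f) :=
  bind_condDistrib_id (measurable_inducing b m)
    (multivariateGaussian_absolutelyContinuous b hs hlam a hS)

lemma isProbabilityMeasure_variationalLaw (hs : Summable lam) (hlam : ∀ j, 0 < lam j)
    (a : EuclideanSpace ℝ (Fin m)) {S : Matrix (Fin m) (Fin m) ℝ} (hS : S.PosDef) :
    IsProbabilityMeasure (variationalLaw b lam a S) := by
  rw [variationalLaw_eq_tilt b hs hlam a hS]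
  exact isProbabilityMeasure_tilt (measurable_inducing b m)
    (multivariateGaussian_absolutelyContinuous b hs hlam a hS)

lemma map_inducing_variationalLaw (hs : Summable lam) (hlam : ∀ j, 0 < lam j)
    (a : EuclideanSpace ℝ (Fin m)) {S : Matrix (Fin m) (Fin m) ℝ} (hS : S.PosDef) :
    (variationalLaw b lam a S).map (inducing b m) = multivariateGaussian a S := by
  rw [variationalLaw_eq_tilt b hs hlam a hS]
  exact map_tilt (measurable_inducing b m)
    (multivariateGaussian_absolutelyContinuous b hs hlam a hS)

/-- The coordinates beyond the inducing variables keep their prior law. -/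
lemma map_coord_variationalLaw (hs : Summable lam) (hlam : ∀ j, 0 < lam j)
    (a : EuclideanSpace ℝ (Fin m)) {S : Matrix (Fin m) (Fin m) ℝ} (hS : S.PosDef) {j : ℕ}
    (hj : m ≤ j) : (variationalLaw b lam a S).map (coord b j) = gaussianReal 0 (lam j) := by
  rw [variationalLaw_eq_tilt b hs hlam a hS, ← map_coord_gpPrior_apply b hs]
  refine map_tilt_of_indepFun (measurable_inducing b m)
    (multivariateGaussian_absolutelyContinuous b hs hlam a hS) (measurable_coord b j)
    (indepFun_inducing b hs m ?_)
  exact (comap_measurable (coord b j)).mono (le_iSup₂_of_le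
    (f := fun j (_ : j ∈ Set.Ici m) => (inferInstance : MeasurableSpace ℝ).comap (coord b j))
    j hj le_rfl) le_rfl

lemma map_coord_variationalLaw_of_lt (hs : Summable lam) (hlam : ∀ j, 0 < lam j)
    (a : EuclideanSpace ℝ (Fin m)) {S : Matrix (Fin m) (Fin m) ℝ} (hS : S.PosDef) (j : Fin m) :
    (variationalLaw b lam a S).map (coord b j) = gaussianReal (a j) (S j j).toNNReal := by
  rw [← (measurePreserving_eval_multivariateGaussian (μ := a) hS.posSemidef (i := j)).map_eq,
    ← map_inducing_variationalLaw b hs hlam a hS,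
    Measure.map_map (by fun_prop) (measurable_inducing b m)]
  rfl

/-- The part of the log-density of a variational law with respect to the posterior that does not
come from the law of the inducing variables. -/
def crossTerm (φ : ℕ → 𝒳 → ℝ) (σ : ℝ≥0) (m : ℕ) (z : Fin n → 𝒳 × ℝ) (f : L2 μ) : ℝ :=
  ∑ i, ((2 * (σ : ℝ) ^ 2)⁻¹ * pathTail b φ m (z i).1 f ^ 2 -
    ((σ : ℝ) ^ 2)⁻¹ * (((z i).2 - ∑ j : Fin m, inducing b m f j * φ j (z i).1) *
      pathTail b φ m (z i).1 f))

/-- The expectation of the cross term is the same for all elements of the variational class. -/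
lemma integral_crossTerm (hs : Summable lam) (hsq : Summable fun j => √(lam j : ℝ))
    (hlam : ∀ j, 0 < lam j) (hK : ∀ j x, |φ j x| ≤ K) (z : Fin n → 𝒳 × ℝ)
    (a : EuclideanSpace ℝ (Fin m)) {S : Matrix (Fin m) (Fin m) ℝ} (hS : S.PosDef) :
    Integrable (crossTerm b φ σ m z) (variationalLaw b lam a S) ∧
      ∫ f, crossTerm b φ σ m z f ∂(variationalLaw b lam a S) =
        ∑ i, (2 * (σ : ℝ) ^ 2)⁻¹ * ∫ f, pathTail b φ m (z i).1 f ^ 2 ∂(gpPrior b lam) := by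
  have hac := multivariateGaussian_absolutelyContinuous b hs hlam a hS
  have hu := measurable_inducing b m
  set Ψ := variationalLaw b lam a S with hΨ
  have hprob : IsProbabilityMeasure Ψ := isProbabilityMeasure_variationalLaw b hs hlam a hS
  have hmt := fun x => measurable_pathTail' b (φ := φ) m x
  -- Under every element of the class the tail at a point has its prior law and is independent of u;
  -- both facts come from the tilt representation.
  have hmap : ∀ x, Ψ.map (pathTail b φ m x) = (gpPrior b lam).map (pathTail b φ m x) := fun x => by
    rw [hΨ, variationalLaw_eq_tilt b hs hlam a hS]
    exact map_tilt_of_indepFun hu hac (hmt x) (indepFun_inducing_pathTail b hs m x)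
  have hind : ∀ x, IndepFun (inducing b m) (pathTail b φ m x) Ψ := fun x => by
    rw [hΨ, variationalLaw_eq_tilt b hs hlam a hS]
    exact indepFun_tilt hu hac (hmt x) (indepFun_inducing_pathTail b hs m x)
  have hL2 : ∀ x, MemLp (pathTail b φ m x) 2 Ψ := fun x => by
    have h := (pathTail_prior b hs hsq hK m x).2.1
    have h1 := (memLp_map_measure_iff (p := 2) (g := (id : ℝ → ℝ)) (μ := gpPrior b lam)
      (by fun_prop) (hmt x).aemeasurable).2 h
    rw [← hmap x] at h1
    exact (memLp_map_measure_iff (by fun_prop) (hmt x).aemeasurable).1 h1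
  have h0 : ∀ x, ∫ f, pathTail b φ m x f ∂Ψ = 0 := fun x => by
    rw [← (pathTail_prior b hs hsq hK m x).2.2,
      ← integral_map (hmt x).aemeasurable (f := fun t : ℝ => t) (by fun_prop), hmap x,
      integral_map (hmt x).aemeasurable (by fun_prop)]
  have hsq' : ∀ x, ∫ f, pathTail b φ m x f ^ 2 ∂Ψ =
      ∫ f, pathTail b φ m x f ^ 2 ∂(gpPrior b lam) := fun x => by
    rw [← integral_map (hmt x).aemeasurable (f := fun t : ℝ => t ^ 2) (by fun_prop), hmap x,
      integral_map (hmt x).aemeasurable (by fun_prop)]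
  have hw : ∀ (x : 𝒳) (y : ℝ),
      Integrable (fun f => y - ∑ j : Fin m, inducing b m f j * φ j x) Ψ := fun x y => by
    refine (integrable_const y).sub (integrable_finsetSum _ fun j _ => Integrable.mul_const ?_ _)
    have h := (memLp_eval_multivariateGaussian a S j).integrable one_le_two
    rw [← map_inducing_variationalLaw b hs hlam a hS] at h
    exact h.comp_measurable hu
  -- The product of tail and residual integrates to zero: the factors are independent and the tail
  -- is centred. Only the squared tail survives, and its mean does not depend on a or S.
  have hcross : ∀ (x : 𝒳) (y : ℝ),
      Integrable (fun f => (y - ∑ j : Fin m, inducing b m f j * φ j x) *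
        pathTail b φ m x f) Ψ ∧
      ∫ f, (y - ∑ j : Fin m, inducing b m f j * φ j x) * pathTail b φ m x f ∂Ψ = 0 := fun x y => by
    have hmw : Measurable fun v : EuclideanSpace ℝ (Fin m) =>
        y - ∑ j : Fin m, v j * φ j x := by fun_prop
    have hi := (hind x).comp hmw measurable_id
    have hii := (hL2 x).integrable one_le_two
    refine ⟨hi.integrable_mul (hw x y) hii, ?_⟩
    have := hi.integral_fun_mul_eq_mul_integral (hw x y).1 hii.1
    simp only [Function.comp_apply, id] at this
    rw [this, h0, mul_zero]
  have hint : ∀ i, Integrable (fun f => (2 * (σ : ℝ) ^ 2)⁻¹ * pathTail b φ m (z i).1 f ^ 2 -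
      ((σ : ℝ) ^ 2)⁻¹ * (((z i).2 - ∑ j : Fin m, inducing b m f j * φ j (z i).1) *
        pathTail b φ m (z i).1 f)) Ψ := fun i =>
    ((hL2 _).integrable_sq.const_mul _).sub ((hcross _ _).1.const_mul _)
  refine ⟨integrable_finsetSum _ fun i _ => hint i, ?_⟩
  unfold crossTerm
  rw [integral_finsetSum _ fun i _ => hint i]
  refine Finset.sum_congr rfl fun i _ => ?_
  rw [integral_sub ((hL2 _).integrable_sq.const_mul _) ((hcross _ _).1.const_mul _),
    integral_const_mul, integral_const_mul, hsq', (hcross _ _).2, mul_zero, sub_zero]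

/-- The optimal law of the inducing variables. -/
def optLaw (lam : ℕ → ℝ≥0) (φ : ℕ → 𝒳 → ℝ) (σ : ℝ≥0) (m : ℕ) (z : Fin n → 𝒳 × ℝ) :
    Measure (EuclideanSpace ℝ (Fin m)) :=
  multivariateGaussian
    (optMean lam σ (design φ m fun i => (z i).1) fun i => (z i).2)
    (precision lam σ (design φ m fun i => (z i).1))⁻¹

/-- The explicit form of the variational posterior. -/
def optPosterior (lam : ℕ → ℝ≥0) (φ : ℕ → 𝒳 → ℝ) (σ : ℝ≥0) (m : ℕ) (z : Fin n → 𝒳 × ℝ) :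
    Measure (L2 μ) :=
  variationalLaw b lam
    (optMean lam σ (design φ m fun i => (z i).1) fun i => (z i).2)
    (precision lam σ (design φ m fun i => (z i).1))⁻¹

/-- The divergence of an element of the variational class from the posterior is, up to a constant,
the divergence of its law of the inducing variables from the optimal one. -/
lemma exists_klDiv_variationalLaw (hs : Summable lam) (hsq : Summable fun j => √(lam j : ℝ))
    (hlam : ∀ j, 0 < lam j) (hK : ∀ j x, |φ j x| ≤ K) (hσ : 0 < σ) (m : ℕ)
    (z : Fin n → 𝒳 × ℝ) :
    ∃ C : ℝ≥0∞, C ≠ ∞ ∧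
      ∀ (a : EuclideanSpace ℝ (Fin m)) (S : Matrix (Fin m) (Fin m) ℝ), S.PosDef →
        InformationTheory.klDiv (variationalLaw b lam a S) (posterior φ b lam σ z) =
          InformationTheory.klDiv (multivariateGaussian a S) (optLaw lam φ σ m z) + C := by
  have hu := measurable_inducing b m
  set Φ := design φ m fun i => (z i).1 with hΦ
  set y : Fin n → ℝ := fun i => (z i).2 with hy
  have hP := posDef_precision (σ := σ) hlam Φ
  obtain ⟨k0, hk0⟩ := exists_density_inducing b hs hlam m
  set p0 : EuclideanSpace ℝ (Fin m) → ℝ :=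
    fun x => k0 - (∑ j : Fin m, ((lam j : ℝ))⁻¹ * (x j * x j)) / 2 with hp0
  have hp0m : Measurable p0 := by fun_prop
  obtain ⟨kq, hkq⟩ := multivariateGaussian_eq_withDensity (optMean lam σ Φ y) hP.inv
  rw [nonsing_inv_nonsing_inv _ hP.det_pos.ne'.isUnit] at hkq
  set pq : EuclideanSpace ℝ (Fin m) → ℝ := fun x => kq - (x - optMean lam σ Φ y).ofLp ⬝ᵥ
    precision lam σ Φ *ᵥ (x - optMean lam σ Φ y).ofLp / 2 with hpq
  have hpqm : Measurable pq := measurable_quadratic _ _ _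
  obtain ⟨c1, hc1⟩ := quadratic_optMean (σ := σ) hlam Φ y
  obtain ⟨hprob, c2, hpost⟩ := posterior_eq_withDensity b φ lam hσ z
  have hLm := measurable_logLikelihood b φ (σ := σ) z
  have hs2 : (0 : ℝ) < (σ : ℝ) ^ 2 := by positivity
  have hpqv : ∀ x, pq x = kq - (∑ j : Fin m, ((lam j : ℝ))⁻¹ * (x j * x j) +
      ((σ : ℝ) ^ 2)⁻¹ * ∑ i, ((z i).2 - (Φ *ᵥ x.ofLp) i) ^ 2 + c1) / 2 := fun x => by
    rw [← hc1 x]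
  -- Collects every normalising constant: those of the optimal and prior laws of u, of the Gaussian
  -- noise and of the posterior.
  set c3 : ℝ := kq - c1 / 2 - k0 + n * Real.log √(2 * Real.pi * (σ ^ 2 : ℝ≥0)) - c2 with hc3
  -- The optimal density `pq` is, up to a constant, the prior density of u times the likelihood with
  -- the tail set to zero. Expanding the square in the true likelihood therefore leaves exactly the
  -- terms containing the tail.
  have hident : ∀ f : L2 μ, (∀ i, pathValue φ b f (z i).1 =
      ∑ j : Fin m, inducing b m f j * φ j (z i).1 + pathTail b φ m (z i).1 f) →
      pq (inducing b m f) - p0 (inducing b m f) - (logLikelihood b φ σ z f + c2) =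
        crossTerm b φ σ m z f + c3 := by
    intro f hf
    have hrow : ∀ i, (Φ *ᵥ (inducing b m f).ofLp) i =
        ∑ j : Fin m, inducing b m f j * φ j (z i).1 := fun i => by
      simp only [mulVec, dotProduct]
      exact Finset.sum_congr rfl fun j _ => mul_comm _ _
    rw [hpqv]
    simp only [hp0, logLikelihood, crossTerm, Finset.sum_sub_distrib, hf, hrow, hc3,
      Finset.sum_const, Finset.card_univ, Fintype.card_fin, nsmul_eq_mul, NNReal.coe_pow]
    have hexp : ∑ i, ((z i).2 - (∑ j : Fin m, inducing b m f j * φ j (z i).1 +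
        pathTail b φ m (z i).1 f)) ^ 2 / (2 * (σ : ℝ) ^ 2) =
        (2 * (σ : ℝ) ^ 2)⁻¹ *
          ∑ i, ((z i).2 - ∑ j : Fin m, inducing b m f j * φ j (z i).1) ^ 2 +
        ∑ i, (2 * (σ : ℝ) ^ 2)⁻¹ * pathTail b φ m (z i).1 f ^ 2 -
        ∑ i, ((σ : ℝ) ^ 2)⁻¹ * (((z i).2 - ∑ j : Fin m, inducing b m f j * φ j (z i).1) *
          pathTail b φ m (z i).1 f) := by
      rw [Finset.mul_sum, ← Finset.sum_add_distrib, ← Finset.sum_sub_distrib]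
      refine Finset.sum_congr rfl fun i _ => ?_
      field_simp
      ring
    rw [hexp, mul_inv]
    ring
  have hae : ∀ᵐ f ∂(gpPrior b lam), ∀ i, pathValue φ b f (z i).1 =
      ∑ j : Fin m, inducing b m f j * φ j (z i).1 + pathTail b φ m (z i).1 f := by
    refine ae_all_iff.2 fun i => ?_
    filter_upwards [(pathTail_prior b hs hsq hK m (z i).1).1] with f hf
    exact pathValue_eq_add_pathTail b m hf
  set C := (∑ i, (2 * (σ : ℝ) ^ 2)⁻¹ * ∫ f, pathTail b φ m (z i).1 f ^ 2 ∂(gpPrior b lam)) + c3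
    with hC
  -- Stated for any log-density p of the law of u, so that it can also be applied with p = `pq`,
  -- which yields C ≥ 0.
  have main : ∀ (a : EuclideanSpace ℝ (Fin m)) (S : Matrix (Fin m) (Fin m) ℝ), S.PosDef →
      ∀ p : EuclideanSpace ℝ (Fin m) → ℝ, Measurable p →
      multivariateGaussian a S = volume.withDensity (expDensity p) →
      Integrable p (multivariateGaussian a S) →
      InformationTheory.klDiv (variationalLaw b lam a S) (posterior φ b lam σ z) =
        ENNReal.ofReal (∫ x, (p - pq) x ∂(multivariateGaussian a S) + C) ∧
      0 ≤ ∫ x, (p - pq) x ∂(multivariateGaussian a S) + C := by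
    intro a S hS p hpm hp hpi
    have hΨp := isProbabilityMeasure_variationalLaw b hs hlam a hS
    have hΨ : variationalLaw b lam a S =
        (gpPrior b lam).withDensity (expDensity ((p - p0) ∘ inducing b m)) := by
      rw [variationalLaw_eq_tilt b hs hlam a hS]
      refine withDensity_congr_ae ?_
      have h1 : multivariateGaussian a S =
          ((gpPrior b lam).map (inducing b m)).withDensity (expDensity (p - p0)) := by
        rw [hk0, withDensity_expDensity_sub _ hpm hp0m, hp]
      have : IsProbabilityMeasure ((gpPrior b lam).map (inducing b m)) :=
        Measure.isProbabilityMeasure_map hu.aemeasurable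
      have h2 := Measure.rnDeriv_withDensity ((gpPrior b lam).map (inducing b m))
        (measurable_expDensity (hpm.sub hp0m))
      rw [← h1] at h2
      exact ae_of_ae_map hu.aemeasurable h2
    have hΨ' : variationalLaw b lam a S = (posterior φ b lam σ z).withDensity
        (expDensity ((p - p0) ∘ inducing b m - fun f => logLikelihood b φ σ z f + c2)) := by
      rw [hpost, withDensity_expDensity_sub _ ((hpm.sub hp0m).comp hu) (hLm.add_const c2), hΨ]
    have hacΨ : variationalLaw b lam a S ≪ gpPrior b lam := by
      rw [hΨ]; exact withDensity_absolutelyContinuous _ _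
    have hpqi : Integrable pq (multivariateGaussian a S) :=
      (integrable_const kq).sub ((integrable_quadratic_multivariateGaussian _ _ _ _).div_const 2)
    have heq : ((p - p0) ∘ inducing b m - fun f => logLikelihood b φ σ z f + c2)
        =ᵐ[variationalLaw b lam a S]
        fun f => (p - pq) (inducing b m f) + (crossTerm b φ σ m z f + c3) := by
      filter_upwards [hacΨ.ae_le hae] with f hf
      rw [← hident f hf]
      simp only [Pi.sub_apply, Function.comp_apply]
      ring
    obtain ⟨hci, hce⟩ := integral_crossTerm b hs hsq hlam hK (σ := σ) z a hS
    have hui : Integrable (fun f => (p - pq) (inducing b m f)) (variationalLaw b lam a S) := by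
      have h := hpi.sub hpqi
      rw [← map_inducing_variationalLaw b hs hlam a hS] at h
      exact h.comp_measurable hu
    have huint : ∫ f, (p - pq) (inducing b m f) ∂(variationalLaw b lam a S) =
        ∫ x, (p - pq) x ∂(multivariateGaussian a S) := by
      rw [← integral_map hu.aemeasurable (hpm.sub hpqm).aestronglyMeasurable,
        map_inducing_variationalLaw b hs hlam a hS]
    have hci' : Integrable (fun f => crossTerm b φ σ m z f + c3) (variationalLaw b lam a S) :=
      hci.add (integrable_const c3)
    have hi2 := hui.add hci'
    have hkl := klDiv_withDensity_expDensity
      (((hpm.sub hp0m).comp hu).sub (hLm.add_const c2)) hΨ' (hi2.congr heq.symm)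
    rw [integral_congr_ae heq, integral_add hui hci',
      integral_add hci (integrable_const c3), huint, hce] at hkl
    simpa [hC] using hkl
  -- For the optimal law the first integral vanishes and C itself is a divergence, hence
  -- nonnegative.
  have hC0 : 0 ≤ C := by
    have := (main _ _ hP.inv pq hpqm hkq ((integrable_const kq).sub
      ((integrable_quadratic_multivariateGaussian _ _ _ _).div_const 2))).2
    simpa using this
  refine ⟨ENNReal.ofReal C, ENNReal.ofReal_ne_top, fun a S hS => ?_⟩
  obtain ⟨k, hk⟩ := multivariateGaussian_eq_withDensity a hS
  have hpi : Integrable (fun x => k - (x - a).ofLp ⬝ᵥ S⁻¹ *ᵥ (x - a).ofLp / 2)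
      (multivariateGaussian a S) :=
    (integrable_const k).sub ((integrable_quadratic_multivariateGaussian _ _ _ _).div_const 2)
  have hpqi : Integrable pq (multivariateGaussian a S) :=
    (integrable_const kq).sub ((integrable_quadratic_multivariateGaussian _ _ _ _).div_const 2)
  have hpm := measurable_quadratic a S⁻¹ k
  have h1 := (main a S hS _ hpm hk hpi).1
  have hq : multivariateGaussian a S = (optLaw lam φ σ m z).withDensity (expDensity
      ((fun x => k - (x - a).ofLp ⬝ᵥ S⁻¹ *ᵥ (x - a).ofLp / 2) - pq)) := by
    rw [optLaw, hkq, withDensity_expDensity_sub _ hpm hpqm, hk]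
  have : IsProbabilityMeasure (optLaw lam φ σ m z) := by unfold optLaw; infer_instance
  obtain ⟨h2, h3⟩ := klDiv_withDensity_expDensity (hpm.sub hpqm) hq (hpi.sub hpqi)
  rw [h1, h2, ENNReal.ofReal_add h3 hC0]

/-- The variational posterior exists, is unique, and is explicit. -/
theorem isVariationalPosterior_iff (hs : Summable lam) (hsq : Summable fun j => √(lam j : ℝ))
    (hlam : ∀ j, 0 < lam j) (hK : ∀ j x, |φ j x| ≤ K) (hσ : 0 < σ) (m : ℕ)
    (z : Fin n → 𝒳 × ℝ) (Ψ : Measure (L2 μ)) :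
    IsVariationalPosterior φ b lam σ m z Ψ ↔ Ψ = optPosterior b lam φ σ m z := by
  obtain ⟨C, hC, h⟩ := exists_klDiv_variationalLaw b hs hsq hlam hK hσ m z
  have hP := (posDef_precision (σ := σ) hlam (design φ m fun i => (z i).1)).inv
  have : IsProbabilityMeasure (optLaw lam φ σ m z) := by unfold optLaw; infer_instance
  have hopt : InformationTheory.klDiv (optPosterior b lam φ σ m z) (posterior φ b lam σ z) = C := by
    rw [optPosterior, h _ _ hP]
    change InformationTheory.klDiv (optLaw lam φ σ m z) (optLaw lam φ σ m z) + C = C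
    rw [InformationTheory.klDiv_self, zero_add]
  have hmem : optPosterior b lam φ σ m z ∈ variationalClass b lam m := ⟨_, _, hP, rfl⟩
  constructor
  · rintro ⟨⟨a, S, hS, rfl⟩, hmin⟩
    have h1 := hmin _ hmem
    change InformationTheory.klDiv (variationalLaw b lam a S) _ ≤ _ at h1
    rw [hopt, h a S hS] at h1
    -- Because C is finite it can be cancelled: a positive divergence of the laws of u would
    -- strictly exceed the minimum C.
    have h2 : InformationTheory.klDiv (multivariateGaussian a S) (optLaw lam φ σ m z) = 0 := by
      by_contra h0
      exact absurd h1 (not_le.2 (by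
        rw [add_comm]; exact ENNReal.lt_add_right hC h0))
    rw [InformationTheory.klDiv_eq_zero_iff] at h2
    rw [h2]
    rfl
  · rintro rfl
    refine ⟨hmem, ?_⟩
    rintro _ ⟨a, S, hS, rfl⟩
    rw [hopt]
    change C ≤ InformationTheory.klDiv (variationalLaw b lam a S) _
    rw [h a S hS]
    exact le_add_self

end Variational

/-! ### Summability of the eigenvalues. -/

section Scale

/-- A single term of the exponential series. The exponent k = 2d will turn powers of j^{1/d} into
j², which is summable. -/
lemma exp_neg_le_factorial_div {x : ℝ} (hx : 0 < x) (k : ℕ) :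
    Real.exp (-x) ≤ k.factorial / x ^ k := by
  have h := Real.pow_div_factorial_le_exp x hx.le k
  have hf : (0 : ℝ) < k.factorial := by positivity
  rw [Real.exp_neg, inv_eq_one_div, div_le_div_iff₀ (Real.exp_pos _) (by positivity)]
  rw [div_le_iff₀ hf] at h
  linarith

lemma rpow_one_div_pow_two_mul {d : ℕ} (hd : 0 < d) {x : ℝ} (hx : 0 ≤ x) :
    (x ^ (1 / (d : ℝ))) ^ (2 * d) = x ^ 2 := by
  rw [mul_comm 2 d, pow_mul, one_div, Real.rpow_inv_natCast_pow hx hd.ne']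

lemma summable_exp_neg_mul_rpow {d : ℕ} (hd : 0 < d) {c : ℝ} (hc : 0 < c) :
    Summable fun j : ℕ => Real.exp (-(c * ((j : ℝ) + 1) ^ (1 / (d : ℝ)))) := by
  have h1 : Summable fun j : ℕ => ((2 * d).factorial / c ^ (2 * d) : ℝ) *
      (1 / ((j + 1 : ℕ) : ℝ) ^ 2) :=
    ((summable_nat_add_iff 1).2 (Real.summable_one_div_nat_pow.2 one_lt_two)).mul_left _
  refine Summable.of_nonneg_of_le (fun j => (Real.exp_pos _).le) (fun j => ?_) h1
  refine (exp_neg_le_factorial_div (by positivity) (2 * d)).trans_eq ?_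
  rw [mul_pow, rpow_one_div_pow_two_mul hd (by positivity)]
  push_cast
  field_simp

lemma rescaling_pos {d : ℕ} {α : ℝ} {n : ℕ} (hn : 2 ≤ n) : 0 < rescaling d α n := by
  have h1 : (1 : ℝ) < n := by exact_mod_cast (show 1 < n by omega)
  exact mul_pos (Real.rpow_pos_of_pos (by linarith) _) (Real.log_pos h1)

variable {d : ℕ} {α c C : ℝ} {n : ℕ} {lam : ℕ → ℝ≥0}

lemma eigenvalue_pos (hc : 0 < c)
    (h : ∀ j : ℕ, c * Real.exp (-(rescaling d α n * ((j : ℝ) + 1) ^ (1 / (d : ℝ)))) ≤ lam j)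
    (j : ℕ) : 0 < lam j :=
  NNReal.coe_pos.1 ((mul_pos hc (Real.exp_pos _)).trans_le (h j))

lemma summable_eigenvalue (hd : 0 < d) (hn : 2 ≤ n)
    (h : ∀ j : ℕ, (lam j : ℝ) ≤
      C * Real.exp (-(rescaling d α n * ((j : ℝ) + 1) ^ (1 / (d : ℝ))))) : Summable lam := by
  rw [← NNReal.summable_coe]
  exact Summable.of_nonneg_of_le (fun j => NNReal.coe_nonneg _) h
    ((summable_exp_neg_mul_rpow hd (rescaling_pos hn)).mul_left C)

/-- The square root halves the rescaling in the exponent, which leaves a series of the same type. -/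
lemma summable_sqrt_eigenvalue (hd : 0 < d) (hn : 2 ≤ n)
    (h : ∀ j : ℕ, (lam j : ℝ) ≤
      C * Real.exp (-(rescaling d α n * ((j : ℝ) + 1) ^ (1 / (d : ℝ))))) :
    Summable fun j => √(lam j : ℝ) := by
  have hr := rescaling_pos (d := d) (α := α) hn
  refine Summable.of_nonneg_of_le (fun j => Real.sqrt_nonneg _) (fun j => ?_)
    ((summable_exp_neg_mul_rpow hd (half_pos hr)).mul_left √|C|)
  have h2 : Real.exp (-(rescaling d α n * ((j : ℝ) + 1) ^ (1 / (d : ℝ)))) =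
      Real.exp (-(rescaling d α n / 2 * ((j : ℝ) + 1) ^ (1 / (d : ℝ)))) ^ 2 := by
    rw [← Real.exp_nat_mul]
    congr 1
    push_cast
    ring
  refine (Real.sqrt_le_sqrt (h j)).trans ?_
  rw [h2, ← Real.sqrt_sq (Real.exp_pos (-(rescaling d α n / 2 * ((j : ℝ) + 1) ^
    (1 / (d : ℝ))))).le, ← Real.sqrt_mul (abs_nonneg C), Real.sqrt_sq (Real.exp_pos _).le]
  exact Real.sqrt_le_sqrt (mul_le_mul_of_nonneg_right (le_abs_self C) (by positivity))

end Scale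

/-! ### Failure of contraction with too few inducing variables. -/

section Suboptimality

lemma gaussianReal_Icc_le {v : ℝ≥0} {w : ℝ} (hw : 0 < w) (hv : w ≤ v) {a r : ℝ} :
    gaussianReal 0 v (Set.Icc (a - r) (a + r)) ≤
      ENNReal.ofReal ((√(2 * Real.pi * w))⁻¹ * (2 * r)) := by
  have hv0 : v ≠ 0 := by
    rintro rfl
    exact absurd hv (not_le.2 (by simpa using hw))
  rw [gaussianReal_apply 0 hv0]
  have hpos : 0 < √(2 * Real.pi * w) := by positivity
  have hle : ∀ x, gaussianPDF 0 v x ≤ ENNReal.ofReal (√(2 * Real.pi * w))⁻¹ := fun x => by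
    refine ENNReal.ofReal_le_ofReal ?_
    rw [gaussianPDFReal]
    have h1 : (√(2 * Real.pi * v))⁻¹ ≤ (√(2 * Real.pi * w))⁻¹ := by gcongr
    have h2 : Real.exp (-(x - 0) ^ 2 / (2 * v)) ≤ 1 := by
      rw [Real.exp_le_one_iff, neg_div]
      exact neg_nonpos.2 (by positivity)
    calc _ ≤ (√(2 * Real.pi * v))⁻¹ * 1 := by gcongr
      _ ≤ _ := by rwa [mul_one]
  refine (lintegral_mono hle).trans ?_
  rw [setLIntegral_const, Real.volume_Icc, ← ENNReal.ofReal_mul (by positivity)]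
  refine ENNReal.ofReal_le_ofReal (le_of_eq ?_)
  ring

variable {𝒳 : Type*} [MeasurableSpace 𝒳] {μ : Measure 𝒳} [IsProbabilityMeasure μ]

lemma measurable_L2 (f : L2 μ) : Measurable (f : 𝒳 → ℝ) := (Lp.stronglyMeasurable f).measurable

lemma measurable_observation (f₀ : L2 μ) :
    Measurable fun p : 𝒳 × ℝ => (p.1, f₀ p.1 + p.2) :=
  measurable_fst.prodMk (((measurable_L2 f₀).comp measurable_fst).add measurable_snd)

instance isProbabilityMeasure_obsLaw (σ : ℝ≥0) (f₀ : L2 μ) :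
    IsProbabilityMeasure (obsLaw σ f₀) :=
  Measure.isProbabilityMeasure_map (measurable_observation f₀).aemeasurable

instance isProbabilityMeasure_dataLaw (σ : ℝ≥0) (f₀ : L2 μ) (n : ℕ) :
    IsProbabilityMeasure (dataLaw σ f₀ n) := by
  unfold dataLaw; infer_instance

variable [MeasurableSpace.CountablyGenerated 𝒳] (b : HilbertBasis ℕ ℝ (L2 μ)) {lam : ℕ → ℝ≥0}

lemma abs_coord_le (j : ℕ) (f : L2 μ) : |coord b j f| ≤ ‖f‖ := by
  have := abs_real_inner_le_norm (b j) f
  rwa [b.orthonormal.1 j, one_mul] at this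

/-- With indices starting at 0, coordinate m is the first one outside u and keeps its law N(0, λ_m).
A ball in L² confines it to an interval of length 2r, and its density is at most (2πw)^{-1/2}. -/
lemma variationalLaw_ball_le (hs : Summable lam) (hlam : ∀ j, 0 < lam j) {m : ℕ}
    (a : EuclideanSpace ℝ (Fin m)) {S : Matrix (Fin m) (Fin m) ℝ} (hS : S.PosDef) {w : ℝ}
    (hw : 0 < w) (hwl : w ≤ lam m) (f₀ : L2 μ) (r : ℝ) :
    variationalLaw b lam a S {f | ‖f - f₀‖ ≤ r} ≤
      ENNReal.ofReal ((√(2 * Real.pi * w))⁻¹ * (2 * r)) := by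
  refine le_trans ?_ (gaussianReal_Icc_le (a := coord b m f₀) hw hwl)
  rw [← map_coord_variationalLaw b hs hlam a hS le_rfl,
    Measure.map_apply (measurable_coord b m) measurableSet_Icc]
  refine measure_mono fun f hf => ?_
  have h := abs_le.1 ((abs_coord_le b m (f - f₀)).trans hf)
  rw [coord, inner_sub_right] at h
  rw [Set.mem_preimage, coord, coord, Set.mem_Icc]
  constructor <;> linarith [h.1, h.2]

/-- The polynomial gap between (m + 1)^{1/d} and n^{1/(d+2α)} beats the logarithm in the rescaling.
-/
lemma tendsto_rescaling_mul {d : ℕ} (hd : 0 < d) {α r : ℝ} (hα : 0 < α)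
    (hr : r < d / (d + 2 * α)) {m : ℕ → ℕ} {C : ℝ}
    (hm : ∀ n : ℕ, 2 ≤ n → (m n : ℝ) ≤ C * (n : ℝ) ^ r) :
    ∀ᶠ n : ℕ in atTop, rescaling d α n * ((m n : ℝ) + 1) ^ (1 / (d : ℝ)) ≤ 1 := by
  have hd' : (0 : ℝ) < d := by exact_mod_cast hd
  have hD : 0 < (d : ℝ) + 2 * α := by positivity
  -- r may be negative; with a nonnegative exponent the summand 1 in m + 1 is also at most n^s.
  set s := max r 0
  have hs : s / d < 1 / (d + 2 * α) := by
    rw [div_lt_iff₀ hd', div_mul_eq_mul_div, one_mul]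
    exact max_lt hr (by positivity)
  set e := 1 / ((d : ℝ) + 2 * α) - s / d with he
  have he0 : 0 < e := by linarith
  have hlog : Tendsto (fun x : ℝ => (|C| + 1) ^ (1 / (d : ℝ)) * (Real.log x / x ^ e)) atTop
      (𝓝 0) := by
    have := ((isLittleO_log_rpow_atTop he0).tendsto_div_nhds_zero).const_mul
      ((|C| + 1) ^ (1 / (d : ℝ)))
    rwa [mul_zero] at this
  have hev := (hlog.comp tendsto_natCast_atTop_atTop).eventually (gt_mem_nhds one_pos)
  filter_upwards [hev, eventually_ge_atTop 2] with n hn hn2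
  refine le_trans ?_ hn.le
  have hn1 : (1 : ℝ) ≤ n := by exact_mod_cast (show 1 ≤ n by omega)
  have hn0 : (0 : ℝ) < n := by linarith
  have hb : (m n : ℝ) + 1 ≤ (|C| + 1) * (n : ℝ) ^ s := by
    have h1 : (n : ℝ) ^ r ≤ (n : ℝ) ^ s := Real.rpow_le_rpow_of_exponent_le hn1 (le_max_left _ _)
    have h2 : (1 : ℝ) ≤ (n : ℝ) ^ s := Real.one_le_rpow hn1 (le_max_right _ _)
    have h3 : C * (n : ℝ) ^ r ≤ |C| * (n : ℝ) ^ s :=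
      mul_le_mul (le_abs_self C) h1 (by positivity) (abs_nonneg C)
    linarith [hm n hn2]
  have h4 : ((m n : ℝ) + 1) ^ (1 / (d : ℝ)) ≤
      (|C| + 1) ^ (1 / (d : ℝ)) * (n : ℝ) ^ (s / d) := by
    refine (Real.rpow_le_rpow (by positivity) hb (by positivity)).trans_eq ?_
    rw [Real.mul_rpow (by positivity) (by positivity), ← Real.rpow_mul hn0.le, mul_one_div]
  have hl : 0 ≤ Real.log n := Real.log_nonneg hn1
  calc rescaling d α n * ((m n : ℝ) + 1) ^ (1 / (d : ℝ))
      ≤ ((n : ℝ) ^ (-(1 : ℝ) / (d + 2 * α)) * Real.log n) *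
          ((|C| + 1) ^ (1 / (d : ℝ)) * (n : ℝ) ^ (s / d)) := by
        unfold rescaling; gcongr
    _ = (|C| + 1) ^ (1 / (d : ℝ)) *
          (Real.log n * ((n : ℝ) ^ (-(1 : ℝ) / (d + 2 * α)) * (n : ℝ) ^ (s / d))) := by ring
    _ = _ := by
        rw [← Real.rpow_add hn0, Function.comp_apply, div_eq_mul_inv (Real.log _),
          ← Real.rpow_neg hn0.le]
        congr 3
        rw [he]; ring

/-- With too few inducing variables the variational posterior does not contract at any polynomial
rate, whatever the true function. -/
theorem contractsAtBestAtRate_of_few_inducing {d : ℕ} (hd : 0 < d) {α r c C' p : ℝ} (hα : 0 < α) (hp : 0 < p)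
    (hc : 0 < c) {lam : ℕ → ℕ → ℝ≥0}
    (hlam : ∀ n : ℕ, 2 ≤ n → ∀ j : ℕ,
      c * Real.exp (-(rescaling d α n * ((j : ℝ) + 1) ^ (1 / (d : ℝ)))) ≤ lam n j)
    (hsum : ∀ n : ℕ, 2 ≤ n → Summable (lam n))
    (hr : r < d / (d + 2 * α)) {m : ℕ → ℕ}
    (hm : ∀ n : ℕ, 2 ≤ n → (m n : ℝ) ≤ C' * (n : ℝ) ^ r) {σ : ℝ≥0}
    {Ψ : ∀ n : ℕ, (Fin n → 𝒳 × ℝ) → Measure (L2 μ)}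
    (hΨ : ∀ n : ℕ, 2 ≤ n → ∀ z, Ψ n z ∈ variationalClass b (lam n) (m n))
    (f₀ : L2 μ) : ContractsAtBestAtRate σ f₀ Ψ fun n => (n : ℝ) ^ (-p) := by
  intro M hM
  -- Once the exponent is at most 1, the eigenvalue at index m is at least c/e, so a ball of radius
  -- M n^{-p} has mass O(n^{-p}) uniformly in the data.
  set w := c * Real.exp (-1)
  have hw : 0 < w := by positivity
  have hlim : Tendsto (fun n : ℕ => ENNReal.ofReal ((√(2 * Real.pi * w))⁻¹ *
      (2 * (M * (n : ℝ) ^ (-p))))) atTop (𝓝 0) := by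
    have h1 := (tendsto_rpow_neg_atTop hp).comp tendsto_natCast_atTop_atTop
    have h2 := ((h1.const_mul M).const_mul 2).const_mul (√(2 * Real.pi * w))⁻¹
    have h3 := ENNReal.tendsto_ofReal h2
    simpa using h3
  refine tendsto_of_tendsto_of_tendsto_of_le_of_le' tendsto_const_nhds hlim
    (Eventually.of_forall fun _ => zero_le) ?_
  filter_upwards [tendsto_rescaling_mul hd hα hr hm, eventually_ge_atTop 2] with n hn hn2
  have hwl : w ≤ lam n (m n) := by
    refine le_trans ?_ (hlam n hn2 (m n))
    exact mul_le_mul_of_nonneg_left (Real.exp_le_exp.2 (by linarith)) hc.le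
  refine (lintegral_mono (g := fun _ => ENNReal.ofReal ((√(2 * Real.pi * w))⁻¹ *
    (2 * (M * (n : ℝ) ^ (-p))))) fun z => ?_).trans (by simp)
  obtain ⟨a, S, hS, h⟩ := hΨ n hn2 z
  rw [h]
  exact variationalLaw_ball_le b (hsum n hn2) (eigenvalue_pos hc (hlam n hn2)) a hS hw hwl f₀ _

end Suboptimality

/-! ### Parseval's identity and Sobolev tails. -/

section Parseval

variable {𝒳 : Type*} [MeasurableSpace 𝒳] {μ : Measure 𝒳} [IsProbabilityMeasure μ]
  [MeasurableSpace.CountablyGenerated 𝒳] (b : HilbertBasis ℕ ℝ (L2 μ))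

lemma ofReal_norm_sq_eq_tsum (f : L2 μ) :
    ENNReal.ofReal (‖f‖ ^ 2) = ∑' j, ENNReal.ofReal (coord b j f ^ 2) := by
  have h := b.hasSum_inner_mul_inner f f
  have h2 : HasSum (fun j => coord b j f ^ 2) (‖f‖ ^ 2) := by
    rw [← real_inner_self_eq_norm_sq]
    rw [show (fun j => coord b j f ^ 2) = fun j => inner ℝ f (b j) * inner ℝ (b j) f from
      funext fun j => by rw [real_inner_comm (b j) f, coord, sq]]
    exact h
  rw [← h2.tsum_eq, ENNReal.ofReal_tsum_of_nonneg (fun j => sq_nonneg _) h2.summable]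

lemma coord_sub (j : ℕ) (f g : L2 μ) : coord b j (f - g) = coord b j f - coord b j g :=
  inner_sub_right _ _ _

lemma coord_sum_smul (J : ℕ) (a : ℕ → ℝ) (j : ℕ) :
    coord b j (∑ k ∈ Finset.range J, a k • b k) = if j < J then a j else 0 := by
  have h : ∀ k, inner ℝ (b j) (b k) = if j = k then (1 : ℝ) else 0 := fun k =>
    orthonormal_iff_ite.1 b.orthonormal j k
  simp only [coord, inner_sum, inner_smul_right, h, mul_ite, mul_one, mul_zero,
    Finset.sum_ite_eq, Finset.mem_range]

variable {b} {d : ℕ} {β : ℝ}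

/-- The energy of the high frequencies is controlled by the Sobolev norm. -/
lemma tsum_tail_le_sobolevNormSq (hβ : 0 ≤ β) (f : L2 μ) {J : ℕ} {N : ℝ} (hN : 0 < N)
    (hJ : N ≤ J + 1) :
    ∑' j, ENNReal.ofReal (coord b (j + J) f ^ 2) ≤
      ENNReal.ofReal (N ^ (-(2 * β / d))) * sobolevNormSq b d β f := by
  have hr : 0 ≤ 2 * β / d := by positivity
  rw [sobolevNormSq, ← ENNReal.tsum_mul_left]
  refine le_trans (ENNReal.tsum_le_tsum fun j => ?_)
    (ENNReal.tsum_comp_le_tsum_of_injective (add_left_injective J)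
      (fun j => ENNReal.ofReal (N ^ (-(2 * β / d))) *
        ENNReal.ofReal (((j : ℝ) + 1) ^ (2 * β / d) * inner ℝ (b j) f ^ 2)))
  rw [← ENNReal.ofReal_mul (by positivity)]
  refine ENNReal.ofReal_le_ofReal ?_
  -- The weight at index j + J is the power of j + J + 1, the index being shifted by one; hence N ≤
  -- J + 1 suffices.
  have h1 : (1 : ℝ) ≤ N ^ (-(2 * β / d)) * (((j + J : ℕ) : ℝ) + 1) ^ (2 * β / d) := by
    rw [Real.rpow_neg hN.le, ← div_eq_inv_mul, one_le_div (by positivity)]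
    refine Real.rpow_le_rpow hN.le (hJ.trans ?_) hr
    push_cast
    linarith [(Nat.cast_nonneg j : (0 : ℝ) ≤ j)]
  calc coord b (j + J) f ^ 2 = 1 * coord b (j + J) f ^ 2 := (one_mul _).symm
    _ ≤ _ * coord b (j + J) f ^ 2 := mul_le_mul_of_nonneg_right h1 (sq_nonneg _)
    _ = _ := by rw [mul_assoc]; rfl

lemma ofReal_norm_sq_le_sobolevNormSq (hβ : 0 ≤ β) (f : L2 μ) :
    ENNReal.ofReal (‖f‖ ^ 2) ≤ sobolevNormSq b d β f := by
  have h := tsum_tail_le_sobolevNormSq (b := b) (d := d) hβ f (J := 0) one_pos (by simp)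
  simpa [ofReal_norm_sq_eq_tsum b] using h

lemma tsum_eq_sum_add_tsum_tail (g : ℕ → ℝ≥0∞) (J : ℕ) :
    ∑' j, g j = ∑ j ∈ Finset.range J, g j + ∑' j, g (j + J) :=
  (Summable.sum_add_tsum_nat_add' ENNReal.summable).symm

end Parseval

/-! ### Variance of empirical averages. -/

section Average

variable {Z : Type*} [MeasurableSpace Z] {ν : Measure Z} [IsProbabilityMeasure ν]

/-- The mean squared error of an empirical average. -/
lemma lintegral_sq_average_le {n : ℕ} (hn : 0 < n) {g : Z → ℝ} (hg : MemLp g 2 ν) :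
    ∫⁻ z, ENNReal.ofReal (((n : ℝ)⁻¹ * ∑ i, g (z i) - ∫ x, g x ∂ν) ^ 2)
      ∂(Measure.pi fun _ : Fin n => ν) ≤ ENNReal.ofReal ((n : ℝ)⁻¹ * ∫ x, g x ^ 2 ∂ν) := by
  have hn' : (n : ℝ) ≠ 0 := by exact_mod_cast hn.ne'
  have hgi : ∀ i : Fin n, MemLp (fun z : Fin n → Z => g (z i)) 2 (Measure.pi fun _ => ν) :=
    fun i => hg.comp_measurePreserving (measurePreserving_eval (fun _ => ν) i)
  have hmean : ∫ z, (n : ℝ)⁻¹ * ∑ i, g (z i) ∂(Measure.pi fun _ : Fin n => ν) = ∫ x, g x ∂ν := by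
    rw [integral_const_mul, integral_finsetSum _ fun i _ => (hgi i).integrable one_le_two]
    have : ∀ i : Fin n, ∫ z, g (z i) ∂(Measure.pi fun _ : Fin n => ν) = ∫ x, g x ∂ν := fun i => by
      have hm := (measurePreserving_eval (fun _ : Fin n => ν) i).map_eq
      have h := integral_map (μ := Measure.pi fun _ : Fin n => ν) (f := g)
        (measurable_pi_apply i).aemeasurable (by rw [hm]; exact hg.1)
      rw [← h, hm]
    simp [this, hn']
  have hL : MemLp (fun z : Fin n → Z => (n : ℝ)⁻¹ * ∑ i, g (z i)) 2 (Measure.pi fun _ => ν) :=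
    (memLp_finsetSum _ fun i _ => hgi i).const_mul _
  have hvar : Var[fun z : Fin n → Z => (n : ℝ)⁻¹ * ∑ i, g (z i); Measure.pi fun _ => ν] =
      (n : ℝ)⁻¹ * Var[g; ν] := by
    rw [variance_const_mul]
    have := variance_sum_pi (μ := fun _ : Fin n => ν) (X := fun _ => g) fun _ => hg
    rw [show (fun z : Fin n → Z => ∑ i, g (z i)) = ∑ i, fun ω : Fin n → Z => g (ω i) by
      ext z; simp, this]
    simp
    field_simp
  rw [← hmean, ← ofReal_integral_eq_lintegral_ofReal, ← variance_eq_integral hL.1.aemeasurable,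
    hvar]
  · refine ENNReal.ofReal_le_ofReal (mul_le_mul_of_nonneg_left ?_ (by positivity))
    exact variance_le_expectation_sq hg.1
  · exact (hL.sub (memLp_const _)).integrable_sq
  · exact ae_of_all _ fun z => sq_nonneg _

end Average

/-! ### The projection estimator and its risk. -/

section Projection

variable {𝒳 : Type*} [MeasurableSpace 𝒳] {μ : Measure 𝒳} [IsProbabilityMeasure μ]
  [MeasurableSpace.CountablyGenerated 𝒳] {b : HilbertBasis ℕ ℝ (L2 μ)} {φ : ℕ → 𝒳 → ℝ} {K : ℝ}
  {σ : ℝ≥0}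

lemma coord_eq_integral (hφb : ∀ j, b j =ᵐ[μ] φ j) (j : ℕ) (f : L2 μ) :
    coord b j f = ∫ x, f x * φ j x ∂μ := by
  rw [coord, L2.inner_def]
  refine integral_congr_ae ?_
  filter_upwards [hφb j] with x hx
  rw [hx]
  rfl

lemma norm_sq_eq_integral (f : L2 μ) : ‖f‖ ^ 2 = ∫ x, f x ^ 2 ∂μ := by
  rw [← real_inner_self_eq_norm_sq, L2.inner_def]
  refine integral_congr_ae (ae_of_all _ fun x => ?_)
  simp [sq]

lemma memLp_gaussian_id (v : ℝ≥0) : MemLp (fun e : ℝ => e) 2 (gaussianReal 0 v) :=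
  memLp_id_gaussianReal 2

lemma integral_sq_gaussianReal (v : ℝ≥0) : ∫ e, e ^ 2 ∂(gaussianReal 0 v) = v := by
  have h := variance_fun_id_gaussianReal (μ := 0) (v := v)
  rw [variance_eq_integral (by fun_prop)] at h
  simpa using h

lemma memLp_response (f : L2 μ) :
    MemLp (fun p : 𝒳 × ℝ => f p.1 + p.2) 2 (μ.prod (gaussianReal 0 (σ ^ 2))) :=
  ((Lp.memLp f).comp_fst _).add ((memLp_gaussian_id (σ ^ 2)).comp_snd _)

lemma memLp_score (hφmeas : ∀ j, Measurable (φ j)) (hK : ∀ j x, |φ j x| ≤ K) (f : L2 μ) (j : ℕ) :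
    MemLp (fun p : 𝒳 × ℝ => p.2 * φ j p.1) 2 (obsLaw σ f) := by
  rw [obsLaw, memLp_map_measure_iff (by fun_prop) (measurable_observation f).aemeasurable]
  refine ((memLp_response (σ := σ) f).const_mul K).of_le ?_ (ae_of_all _ fun p => ?_)
  · have := measurable_observation f
    have h : Measurable fun p : 𝒳 × ℝ => p.2 * φ j p.1 := by fun_prop
    exact (h.comp this).aestronglyMeasurable
  · have hK0 : 0 ≤ K := (abs_nonneg _).trans (hK j p.1)
    simp only [Function.comp_apply, norm_mul, Real.norm_eq_abs, abs_of_nonneg hK0]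
    rw [mul_comm]
    exact mul_le_mul_of_nonneg_right (hK _ _) (abs_nonneg _)

/-- Unbiasedness of the empirical Fourier coefficients: the noise is centred and independent of the
design point. -/
lemma integral_score (hφmeas : ∀ j, Measurable (φ j)) (hφb : ∀ j, b j =ᵐ[μ] φ j)
    (hK : ∀ j x, |φ j x| ≤ K) (f : L2 μ) (j : ℕ) :
    ∫ p, p.2 * φ j p.1 ∂(obsLaw σ f) = coord b j f := by
  have hφL : MemLp (φ j) 2 μ := MemLp.of_bound (hφmeas j).aestronglyMeasurable K
    (ae_of_all _ fun x => hK j x)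
  have h1 : Integrable (fun p : 𝒳 × ℝ => f p.1 * φ j p.1) (μ.prod (gaussianReal 0 (σ ^ 2))) :=
    ((Lp.memLp f).integrable_mul hφL).comp_fst _
  have h2 : Integrable (fun p : 𝒳 × ℝ => φ j p.1 * p.2) (μ.prod (gaussianReal 0 (σ ^ 2))) :=
    (hφL.integrable one_le_two).mul_prod ((memLp_gaussian_id (σ ^ 2)).integrable one_le_two)
  rw [obsLaw, integral_map (measurable_observation f).aemeasurable
    (by fun_prop : Measurable fun p : 𝒳 × ℝ => p.2 * φ j p.1).aestronglyMeasurable,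
    coord_eq_integral hφb]
  have : ∀ p : 𝒳 × ℝ, (f p.1 + p.2) * φ j p.1 = f p.1 * φ j p.1 + φ j p.1 * p.2 := fun p => by
    ring
  simp_rw [this]
  rw [integral_add h1 h2, integral_prod_mul (φ j) (fun e : ℝ => e), integral_id_gaussianReal,
    mul_zero, add_zero, integral_fun_fst (fun x => f x * φ j x)]
  simp

lemma integral_sq_score_le (hφmeas : ∀ j, Measurable (φ j)) (hK : ∀ j x, |φ j x| ≤ K) (f : L2 μ)
    (j : ℕ) : ∫ p, (p.2 * φ j p.1) ^ 2 ∂(obsLaw σ f) ≤ K ^ 2 * (‖f‖ ^ 2 + σ ^ 2) := by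
  have hf := Lp.memLp f
  have he := memLp_gaussian_id (σ ^ 2)
  have h1 : Integrable (fun p : 𝒳 × ℝ => f p.1 ^ 2) (μ.prod (gaussianReal 0 (σ ^ 2))) :=
    hf.integrable_sq.comp_fst _
  have h2 : Integrable (fun p : 𝒳 × ℝ => f p.1 * p.2) (μ.prod (gaussianReal 0 (σ ^ 2))) :=
    (hf.integrable one_le_two).mul_prod (he.integrable one_le_two)
  have h3 : Integrable (fun p : 𝒳 × ℝ => p.2 ^ 2) (μ.prod (gaussianReal 0 (σ ^ 2))) :=
    he.integrable_sq.comp_snd _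
  have hY : ∫ p : 𝒳 × ℝ, (f p.1 + p.2) ^ 2 ∂(μ.prod (gaussianReal 0 (σ ^ 2))) =
      ‖f‖ ^ 2 + σ ^ 2 := by
    have : ∀ p : 𝒳 × ℝ, (f p.1 + p.2) ^ 2 = f p.1 ^ 2 + (2 * (f p.1 * p.2) + p.2 ^ 2) := fun p => by
      ring
    have h23 : Integrable (fun p : 𝒳 × ℝ => 2 * (f p.1 * p.2) + p.2 ^ 2)
        (μ.prod (gaussianReal 0 (σ ^ 2))) := (h2.const_mul 2).add h3
    simp_rw [this]
    rw [integral_add h1 h23, integral_add (h2.const_mul 2) h3,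
      integral_const_mul, integral_prod_mul (fun x => f x) (fun e : ℝ => e),
      integral_id_gaussianReal, integral_fun_fst (fun x => f x ^ 2),
      integral_fun_snd (fun e : ℝ => e ^ 2), integral_sq_gaussianReal, norm_sq_eq_integral]
    simp
  rw [obsLaw, integral_map (measurable_observation f).aemeasurable
    (by fun_prop : Measurable fun p : 𝒳 × ℝ => (p.2 * φ j p.1) ^ 2).aestronglyMeasurable, ← hY,
    ← integral_const_mul]
  refine integral_mono_of_nonneg (ae_of_all _ fun p => sq_nonneg _)
    ((memLp_response (σ := σ) f).integrable_sq.const_mul _) (ae_of_all _ fun p => ?_)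
  have h : φ j p.1 ^ 2 ≤ K ^ 2 := sq_le_sq' (abs_le.1 (hK j p.1)).1 (abs_le.1 (hK j p.1)).2
  calc ((f p.1 + p.2) * φ j p.1) ^ 2 = φ j p.1 ^ 2 * (f p.1 + p.2) ^ 2 := by ring
    _ ≤ _ := mul_le_mul_of_nonneg_right h (sq_nonneg _)

/-- The projection estimator with `J` empirical Fourier coefficients. -/
def projectionEstimator (b : HilbertBasis ℕ ℝ (L2 μ)) (φ : ℕ → 𝒳 → ℝ) (J : ℕ) {n : ℕ}
    (z : Fin n → 𝒳 × ℝ) : L2 μ :=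
  ∑ j ∈ Finset.range J, ((n : ℝ)⁻¹ * ∑ i, (z i).2 * φ j (z i).1) • b j

lemma measurable_projectionEstimator (hφmeas : ∀ j, Measurable (φ j)) (J n : ℕ) :
    Measurable (projectionEstimator b φ J (n := n)) := by
  unfold projectionEstimator
  refine Finset.measurable_sum _ fun j _ => Measurable.smul_const ?_ _
  have := hφmeas j
  fun_prop

/-- Bias and variance through Parseval: each of the J estimated coefficients contributes a variance
of order 1/n, and the omitted ones are the bias. -/
lemma risk_projectionEstimator_le (hφmeas : ∀ j, Measurable (φ j)) (hφb : ∀ j, b j =ᵐ[μ] φ j)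
    (hK : ∀ j x, |φ j x| ≤ K) (f : L2 μ) (J : ℕ) {n : ℕ} (hn : 0 < n) :
    ∫⁻ z, ENNReal.ofReal (‖projectionEstimator b φ J z - f‖ ^ 2) ∂(dataLaw σ f n) ≤
      ENNReal.ofReal (J * ((n : ℝ)⁻¹ * (K ^ 2 * (‖f‖ ^ 2 + σ ^ 2)))) +
        ∑' j, ENNReal.ofReal (coord b (j + J) f ^ 2) := by
  have hm := measurable_projectionEstimator (b := b) hφmeas J n
  have hsplit : ∀ z : Fin n → 𝒳 × ℝ, ENNReal.ofReal (‖projectionEstimator b φ J z - f‖ ^ 2) =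
      ∑ j ∈ Finset.range J, ENNReal.ofReal
        (((n : ℝ)⁻¹ * ∑ i, (z i).2 * φ j (z i).1 - coord b j f) ^ 2) +
      ∑' j, ENNReal.ofReal (coord b (j + J) f ^ 2) := fun z => by
    rw [ofReal_norm_sq_eq_tsum b, tsum_eq_sum_add_tsum_tail _ J]
    congr 1
    · refine Finset.sum_congr rfl fun j hj => ?_
      rw [coord_sub, projectionEstimator, coord_sum_smul, if_pos (Finset.mem_range.1 hj)]
    · refine tsum_congr fun j => ?_
      rw [coord_sub, projectionEstimator, coord_sum_smul, if_neg (by omega), zero_sub, neg_sq]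
  simp_rw [hsplit]
  rw [lintegral_add_right _ measurable_const, lintegral_const, measure_univ, mul_one,
    lintegral_finsetSum]
  · refine add_le_add_left ?_ _
    have hterm : ∀ j ∈ Finset.range J, ∫⁻ z, ENNReal.ofReal
        (((n : ℝ)⁻¹ * ∑ i, (z i).2 * φ j (z i).1 - coord b j f) ^ 2) ∂(dataLaw σ f n) ≤
        ENNReal.ofReal ((n : ℝ)⁻¹ * (K ^ 2 * (‖f‖ ^ 2 + σ ^ 2))) := fun j _ => by
      rw [← integral_score (σ := σ) hφmeas hφb hK f j]
      refine (lintegral_sq_average_le hn (memLp_score (σ := σ) hφmeas hK f j)).trans ?_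
      exact ENNReal.ofReal_le_ofReal (mul_le_mul_of_nonneg_left
        (integral_sq_score_le hφmeas hK f j) (by positivity))
    refine (Finset.sum_le_sum hterm).trans_eq ?_
    rw [Finset.sum_const, Finset.card_range, nsmul_eq_mul, ENNReal.ofReal_mul (Nat.cast_nonneg J),
      ENNReal.ofReal_natCast]
  · intro j _
    have := hφmeas j
    fun_prop

end Projection

/-! ### Le Cam's two-point method. -/

section TwoPoint

variable {𝒳 : Type*} [MeasurableSpace 𝒳] {μ : Measure 𝒳} [IsProbabilityMeasure μ] {σ : ℝ≥0}

/-- The log-density of one observation with respect to `μ ⊗ dy`. -/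
def logDensity (σ : ℝ≥0) (f : L2 μ) (p : 𝒳 × ℝ) : ℝ :=
  -Real.log √(2 * Real.pi * (σ ^ 2 : ℝ≥0)) - (p.2 - f p.1) ^ 2 / (2 * (σ ^ 2 : ℝ≥0))

lemma measurable_logDensity (f : L2 μ) : Measurable (logDensity σ f) := by
  have := measurable_L2 f
  unfold logDensity
  fun_prop

/-- By Fubini it is enough to compare sections: given x, the response is N(f(x), σ²). -/
lemma obsLaw_eq_withDensity (hσ : 0 < σ) (f : L2 μ) :
    obsLaw σ f = (μ.prod volume).withDensity (expDensity (logDensity σ f)) := by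
  have hv : σ ^ 2 ≠ 0 := by positivity
  have hT := measurable_observation f
  have hd := measurable_expDensity (measurable_logDensity (σ := σ) f)
  ext s hs
  rw [obsLaw, Measure.map_apply hT hs, Measure.prod_apply (hT hs), withDensity_apply _ hs,
    ← lintegral_indicator hs, lintegral_prod _ (hd.indicator hs).aemeasurable]
  refine lintegral_congr fun x => ?_
  have h1 : Prod.mk x ⁻¹' ((fun p : 𝒳 × ℝ => (p.1, f p.1 + p.2)) ⁻¹' s) =
      (fun e => f x + e) ⁻¹' (Prod.mk x ⁻¹' s) := rfl
  have hsx : MeasurableSet (Prod.mk x ⁻¹' s) := measurable_prodMk_left hs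
  rw [h1, ← Measure.map_apply (by fun_prop) hsx, gaussianReal_map_const_add, zero_add,
    gaussianReal_apply _ hv, ← lintegral_indicator hsx]
  refine lintegral_congr fun y => ?_
  by_cases h : (x, y) ∈ s
  · rw [Set.indicator_of_mem h, Set.indicator_of_mem (show y ∈ Prod.mk x ⁻¹' s from h),
      gaussianPDF_eq_expDensity _ hv]
    rfl
  · rw [Set.indicator_of_notMem h, Set.indicator_of_notMem (show y ∉ Prod.mk x ⁻¹' s from h)]

/-- The log-likelihood ratio of a sample. -/
def logRatio (σ : ℝ≥0) (f g : L2 μ) {n : ℕ} (z : Fin n → 𝒳 × ℝ) : ℝ :=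
  ∑ i, (logDensity σ g - logDensity σ f) (z i)

lemma measurable_logRatio (f g : L2 μ) (n : ℕ) : Measurable (logRatio σ f g (n := n)) :=
  Finset.measurable_sum _ fun i _ =>
    ((measurable_logDensity g).sub (measurable_logDensity f)).comp (measurable_pi_apply i)

lemma dataLaw_eq_withDensity (hσ : 0 < σ) (f g : L2 μ) (n : ℕ) :
    dataLaw σ g n = (dataLaw σ f n).withDensity (expDensity (logRatio σ f g)) := by
  have hm := (measurable_logDensity (σ := σ) g).sub (measurable_logDensity (σ := σ) f)
  have h1 : obsLaw σ g =
      (obsLaw σ f).withDensity (expDensity (logDensity σ g - logDensity σ f)) := by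
    rw [obsLaw_eq_withDensity hσ f, withDensity_expDensity_sub _ (measurable_logDensity g)
      (measurable_logDensity f), obsLaw_eq_withDensity hσ g]
  have : SigmaFinite
      ((obsLaw σ f).withDensity (expDensity (logDensity σ g - logDensity σ f))) := by
    rw [← h1]; infer_instance
  rw [dataLaw, dataLaw, h1, pi_withDensity (fun _ : Fin n => obsLaw σ f)
    (f := fun _ => expDensity (logDensity σ g - logDensity σ f))
    fun _ => measurable_expDensity hm]
  congr 1
  ext z
  rw [expDensity, logRatio, Real.exp_sum,
    ENNReal.ofReal_prod_of_nonneg fun i _ => (Real.exp_pos _).le]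
  rfl

/-- The Hellinger affinity of two sample laws. -/
lemma affinity_ge (hσ : 0 < σ) {f g : L2 μ} {η : ℝ} (hfg : ∀ᵐ x ∂μ, |f x - g x| ≤ η) (n : ℕ) :
    ENNReal.ofReal (Real.exp (-(n * η ^ 2 / (8 * (σ : ℝ) ^ 2)))) ≤
      ∫⁻ z, expDensity (fun z => logRatio σ f g z / 2) z ∂(dataLaw σ f n) := by
  have hv : σ ^ 2 ≠ 0 := by positivity
  have hs2 : (0 : ℝ) < (σ : ℝ) ^ 2 := by positivity
  have hf := measurable_logDensity (σ := σ) f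
  have hg := measurable_logDensity (σ := σ) g
  set h : 𝒳 × ℝ → ℝ := fun p => (logDensity σ g p - logDensity σ f p) / 2 with hh
  have hm : Measurable h := (hg.sub hf).div_const 2
  have hone : ENNReal.ofReal (Real.exp (-(η ^ 2 / (8 * (σ : ℝ) ^ 2)))) ≤
      ∫⁻ p, expDensity h p ∂(obsLaw σ f) := by
    rw [obsLaw_eq_withDensity hσ f, lintegral_withDensity_eq_lintegral_mul _
      (measurable_expDensity hf) (measurable_expDensity hm),
      lintegral_prod _ ((measurable_expDensity hf).mul (measurable_expDensity hm)).aemeasurable]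
    -- The geometric mean of two Gaussian densities of equal variance is the density centred at the
    -- midpoint, times exp(-(f - g)² / (8σ²)).
    have hpt : ∀ x y, (expDensity (logDensity σ f) * expDensity h) (x, y) =
        ENNReal.ofReal (Real.exp (-((f x - g x) ^ 2 / (8 * (σ : ℝ) ^ 2)))) *
          gaussianPDF ((f x + g x) / 2) (σ ^ 2) y := fun x y => by
      rw [gaussianPDF_eq_expDensity _ hv]
      simp only [Pi.mul_apply, expDensity, hh, logDensity]
      rw [← ENNReal.ofReal_mul (Real.exp_pos _).le, ← ENNReal.ofReal_mul (Real.exp_pos _).le,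
        ← Real.exp_add, ← Real.exp_add]
      congr 2
      rw [NNReal.coe_pow]
      field_simp
      ring
    simp_rw [hpt]
    have : ∀ x, ∫⁻ y, ENNReal.ofReal (Real.exp (-((f x - g x) ^ 2 / (8 * (σ : ℝ) ^ 2)))) *
        gaussianPDF ((f x + g x) / 2) (σ ^ 2) y =
        ENNReal.ofReal (Real.exp (-((f x - g x) ^ 2 / (8 * (σ : ℝ) ^ 2)))) := fun x => by
      rw [lintegral_const_mul _ (measurable_gaussianPDF _ _), lintegral_gaussianPDF_eq_one _ hv,
        mul_one]
    simp_rw [this]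
    calc ENNReal.ofReal (Real.exp (-(η ^ 2 / (8 * (σ : ℝ) ^ 2))))
        = ∫⁻ _, ENNReal.ofReal (Real.exp (-(η ^ 2 / (8 * (σ : ℝ) ^ 2)))) ∂μ := by simp
      _ ≤ _ := by
        refine lintegral_mono_ae ?_
        filter_upwards [hfg] with x hx
        refine ENNReal.ofReal_le_ofReal (Real.exp_le_exp.2 (neg_le_neg ?_))
        have : (f x - g x) ^ 2 ≤ η ^ 2 := sq_le_sq' (abs_le.1 hx).1 (abs_le.1 hx).2
        gcongr
  have hprod : ∀ z : Fin n → 𝒳 × ℝ, expDensity (fun z => logRatio σ f g z / 2) z =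
      ∏ i, expDensity h (z i) := fun z => by
    simp only [expDensity, logRatio]
    rw [Finset.sum_div, Real.exp_sum,
      ENNReal.ofReal_prod_of_nonneg fun i _ => (Real.exp_pos _).le]
    rfl
  simp_rw [hprod]
  rw [dataLaw, lintegral_pi_prod _ fun _ => measurable_expDensity hm, Finset.prod_const,
    Finset.card_univ, Fintype.card_fin]
  refine le_trans (le_of_eq ?_) (pow_le_pow_left₀ zero_le hone n)
  rw [← ENNReal.ofReal_pow (Real.exp_pos _).le, ← Real.exp_nat_mul]
  congr 2
  ring

/-- Here l is the square root of the likelihood ratio and A a lower bound for the affinity. The two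
ingredients are A l ≤ min(1, l²) + (A²/4) max(1, l²) and the triangle inequality (b - a)² ≤ 2(t -
a)² + 2(t - b)², whose terms carry the weight min(1, l²). -/
lemma two_point_pointwise (t a b l A : ℝ) (hl : 0 ≤ l) :
    (b - a) ^ 2 * A * l ≤ 2 * (t - a) ^ 2 + 2 * (l ^ 2 * (t - b) ^ 2) +
      (b - a) ^ 2 * A ^ 2 / 4 * (1 + l ^ 2) := by
  have h1 : (b - a) ^ 2 ≤ 2 * (t - a) ^ 2 + 2 * (t - b) ^ 2 := by
    nlinarith [sq_nonneg ((t - a) + (t - b))]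
  have hD := sq_nonneg (b - a)
  rcases le_total l 1 with h | h
  · have h2 : A * l ≤ l ^ 2 + A ^ 2 / 4 := by nlinarith [sq_nonneg (l - A / 2)]
    have h3 : l ^ 2 ≤ 1 := by nlinarith
    calc (b - a) ^ 2 * A * l = (b - a) ^ 2 * (A * l) := by ring
      _ ≤ (b - a) ^ 2 * (l ^ 2 + A ^ 2 / 4) := mul_le_mul_of_nonneg_left h2 hD
      _ = l ^ 2 * (b - a) ^ 2 + (b - a) ^ 2 * A ^ 2 / 4 := by ring
      _ ≤ l ^ 2 * (2 * (t - a) ^ 2 + 2 * (t - b) ^ 2) + (b - a) ^ 2 * A ^ 2 / 4 := by gcongr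
      _ ≤ _ := by
        have h4 : l ^ 2 * (2 * (t - a) ^ 2) ≤ 2 * (t - a) ^ 2 :=
          mul_le_of_le_one_left (by positivity) h3
        have h5 : 0 ≤ (b - a) ^ 2 * A ^ 2 / 4 * l ^ 2 := by positivity
        linarith
  · have h2 : A * l ≤ 1 + A ^ 2 / 4 * l ^ 2 := by nlinarith [sq_nonneg (A * l / 2 - 1)]
    have h3 : 1 ≤ l ^ 2 := by nlinarith
    calc (b - a) ^ 2 * A * l = (b - a) ^ 2 * (A * l) := by ring
      _ ≤ (b - a) ^ 2 * (1 + A ^ 2 / 4 * l ^ 2) := mul_le_mul_of_nonneg_left h2 hD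
      _ = (b - a) ^ 2 + (b - a) ^ 2 * A ^ 2 / 4 * l ^ 2 := by ring
      _ ≤ (2 * (t - a) ^ 2 + 2 * (t - b) ^ 2) + (b - a) ^ 2 * A ^ 2 / 4 * l ^ 2 := by gcongr
      _ ≤ _ := by
        have h4 : (t - b) ^ 2 ≤ l ^ 2 * (t - b) ^ 2 := le_mul_of_one_le_left (sq_nonneg _) h3
        have h5 : 0 ≤ (b - a) ^ 2 * A ^ 2 / 4 := by positivity
        linarith

/-- Le Cam's two-point bound. -/
lemma two_point_bound (hσ : 0 < σ) {f g : L2 μ} {η : ℝ} (hfg : ∀ᵐ x ∂μ, |f x - g x| ≤ η) {n : ℕ}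
    {t : (Fin n → 𝒳 × ℝ) → ℝ} (ht : Measurable t) (a b : ℝ) :
    ENNReal.ofReal ((b - a) ^ 2 * Real.exp (-(n * η ^ 2 / (4 * (σ : ℝ) ^ 2))) / 4) ≤
      ∫⁻ z, ENNReal.ofReal ((t z - a) ^ 2) ∂(dataLaw σ f n) +
        ∫⁻ z, ENNReal.ofReal ((t z - b) ^ 2) ∂(dataLaw σ g n) := by
  set A := Real.exp (-(n * η ^ 2 / (8 * (σ : ℝ) ^ 2))) with hA
  have hA0 : 0 < A := Real.exp_pos _
  have hA2 : Real.exp (-(n * η ^ 2 / (4 * (σ : ℝ) ^ 2))) = A ^ 2 := by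
    rw [hA, ← Real.exp_nat_mul]
    congr 1
    push_cast
    ring
  have hm := measurable_logRatio (σ := σ) f g n
  have hE := measurable_expDensity hm
  set D := (b - a) ^ 2 with hD
  set RP := ∫⁻ z, ENNReal.ofReal ((t z - a) ^ 2) ∂(dataLaw σ f n) with hRP
  set RQ := ∫⁻ z, ENNReal.ofReal ((t z - b) ^ 2) ∂(dataLaw σ g n) with hRQ
  have hQ : RQ = ∫⁻ z, expDensity (logRatio σ f g) z * ENNReal.ofReal ((t z - b) ^ 2)
      ∂(dataLaw σ f n) := by
    rw [hRQ, dataLaw_eq_withDensity hσ f g n,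
      lintegral_withDensity_eq_lintegral_mul _ hE (by fun_prop)]
    rfl
  have hL : ∫⁻ z, expDensity (logRatio σ f g) z ∂(dataLaw σ f n) = 1 := by
    rw [← setLIntegral_univ, ← withDensity_apply _ .univ, ← dataLaw_eq_withDensity hσ f g n,
      measure_univ]
  have hpt : ∀ z, ENNReal.ofReal (D * A) * expDensity (fun z => logRatio σ f g z / 2) z ≤
      2 * ENNReal.ofReal ((t z - a) ^ 2) +
        2 * (expDensity (logRatio σ f g) z * ENNReal.ofReal ((t z - b) ^ 2)) +
        ENNReal.ofReal (D * A ^ 2 / 4) * (1 + expDensity (logRatio σ f g) z) := fun z => by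
    have hl : Real.exp (logRatio σ f g z) = Real.exp (logRatio σ f g z / 2) ^ 2 := by
      rw [← Real.exp_nat_mul]
      congr 1
      push_cast
      ring
    have h := two_point_pointwise (t z) a b (Real.exp (logRatio σ f g z / 2)) A
      (Real.exp_pos _).le
    rw [← hl, ← hD] at h
    simp only [expDensity]
    rw [← ENNReal.ofReal_mul (by positivity), ← ENNReal.ofReal_mul (Real.exp_pos _).le,
      ← ENNReal.ofReal_one, ← ENNReal.ofReal_add zero_le_one (Real.exp_pos _).le,
      ← ENNReal.ofReal_mul (by positivity), show (2 : ℝ≥0∞) = ENNReal.ofReal 2 by simp,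
      ← ENNReal.ofReal_mul (by positivity), ← ENNReal.ofReal_mul (by positivity),
      ← ENNReal.ofReal_add (by positivity) (by positivity),
      ← ENNReal.ofReal_add (by positivity) (by positivity)]
    exact ENNReal.ofReal_le_ofReal h
  have hint := lintegral_mono (μ := dataLaw σ f n) hpt
  have hmE2 : Measurable (expDensity fun z : Fin n → 𝒳 × ℝ => logRatio σ f g z / 2) :=
    measurable_expDensity (hm.div_const 2)
  rw [lintegral_const_mul _ hmE2, lintegral_add_right _ (by fun_prop),
    lintegral_add_left (by fun_prop), lintegral_const_mul _ (by fun_prop),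
    lintegral_const_mul _ (by fun_prop), lintegral_const_mul _ (by fun_prop), ← hQ, ← hRP,
    lintegral_add_right _ hE, hL, lintegral_const, measure_univ, one_mul] at hint
  -- Since the likelihood ratio integrates to 1, the last term contributes D A²/2, half of the left
  -- side, which is then subtracted.
  have hlow : ENNReal.ofReal (D * A ^ 2) ≤ 2 * RP + 2 * RQ + ENNReal.ofReal (D * A ^ 2 / 2) := by
    calc ENNReal.ofReal (D * A ^ 2) = ENNReal.ofReal (D * A) * ENNReal.ofReal A := by
          rw [← ENNReal.ofReal_mul (by positivity)]; congr 1; ring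
      _ ≤ _ := mul_le_mul_right (affinity_ge hσ hfg n) _
      _ ≤ _ := hint
      _ = _ := by
          rw [one_add_one_eq_two, show (2 : ℝ≥0∞) = ENNReal.ofReal 2 by simp,
            ← ENNReal.ofReal_mul (by positivity)]
          congr 2
          ring
  have hhalf : ENNReal.ofReal (D * A ^ 2) =
      ENNReal.ofReal (D * A ^ 2 / 2) + ENNReal.ofReal (D * A ^ 2 / 2) := by
    rw [← ENNReal.ofReal_add (by positivity) (by positivity), add_halves]
  rw [hhalf] at hlow
  have h2 := (ENNReal.add_le_add_iff_right ENNReal.ofReal_ne_top).1 hlow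
  rw [hA2, ← ENNReal.mul_le_mul_iff_right two_ne_zero ENNReal.ofNat_ne_top, mul_add]
  refine le_trans (le_of_eq ?_) h2
  rw [show (2 : ℝ≥0∞) = ENNReal.ofReal 2 by simp, ← ENNReal.ofReal_mul (by positivity)]
  congr 1
  ring

end TwoPoint

/-! ### Arithmetic of the rate exponents. -/

section Exponents

variable {D : ℝ} {n : ℕ}

lemma one_le_rpow_natCast (hn : 0 < n) {r : ℝ} (hr : 0 ≤ r) : (1 : ℝ) ≤ (n : ℝ) ^ r :=
  Real.one_le_rpow (by exact_mod_cast hn) hr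

lemma rpow_div_self (hn : 0 < n) {a c : ℝ} (hD : D ≠ 0) (h : a + c = D) :
    (n : ℝ) ^ (a / D) / n = (n : ℝ) ^ (-c / D) := by
  have hn' : (0 : ℝ) < n := by exact_mod_cast hn
  nth_rw 2 [← Real.rpow_one (n : ℝ)]
  rw [← Real.rpow_sub hn']
  congr 1
  field_simp
  linarith

lemma rpow_div_rpow_neg {d : ℝ} (hd : d ≠ 0) (c : ℝ) :
    ((n : ℝ) ^ (d / D)) ^ (-(c / d)) = (n : ℝ) ^ (-c / D) := by
  rw [← Real.rpow_mul (Nat.cast_nonneg n)]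
  congr 1
  field_simp

lemma rpow_neg_div_sq (c : ℝ) : ((n : ℝ) ^ (-c / D)) ^ 2 = (n : ℝ) ^ (-(2 * c) / D) := by
  rw [← Real.rpow_mul_natCast (Nat.cast_nonneg n)]
  congr 1
  push_cast
  ring

end Exponents

/-! ### Assouad's lemma and the minimax rate. -/

section Hypercube

variable {𝒳 : Type*} [MeasurableSpace 𝒳] {μ : Measure 𝒳} [IsProbabilityMeasure μ]
  [MeasurableSpace.CountablyGenerated 𝒳] (b : HilbertBasis ℕ ℝ (L2 μ)) {φ : ℕ → 𝒳 → ℝ} {K : ℝ}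
  {σ : ℝ≥0} {J : ℕ}

/-- The coordinates of a vertex of the hypercube. -/
def cubeCoord (δ : ℝ) (v : Fin J → Bool) (k : ℕ) : ℝ :=
  if h : k < J then (if v ⟨k, h⟩ then δ else -δ) else 0

/-- A vertex of a hypercube in the span of the first `J` basis functions. -/
def cubePoint (δ : ℝ) (v : Fin J → Bool) : L2 μ :=
  ∑ k ∈ Finset.range J, cubeCoord δ v k • b k

/-- The neighbour of a vertex across a face. -/
def flip (j : Fin J) (v : Fin J → Bool) : Fin J → Bool := Function.update v j (!v j)

lemma flip_involutive (j : Fin J) : Function.Involutive (flip j) := fun v => by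
  ext k
  by_cases h : k = j
  · subst h; simp [flip]
  · simp [flip, h]

lemma cubeCoord_flip_self (δ : ℝ) (v : Fin J → Bool) (j : Fin J) :
    cubeCoord δ (flip j v) j = -cubeCoord δ v j := by
  simp only [cubeCoord, j.2, dif_pos, flip, Fin.eta, Function.update_self]
  cases v j <;> simp

lemma cubeCoord_flip_of_ne (δ : ℝ) (v : Fin J → Bool) {j : Fin J} {k : ℕ} (h : k ≠ j) :
    cubeCoord δ (flip j v) k = cubeCoord δ v k := by
  unfold cubeCoord
  by_cases hk : k < J
  · have : (⟨k, hk⟩ : Fin J) ≠ j := fun e => h (by rw [← e])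
    simp [hk, flip, this]
  · simp [hk]

lemma sq_cubeCoord (δ : ℝ) (v : Fin J → Bool) (j : Fin J) : cubeCoord δ v j ^ 2 = δ ^ 2 := by
  simp only [cubeCoord, j.2, dif_pos]
  cases v ⟨j, j.2⟩ <;> simp

lemma coord_cubePoint (δ : ℝ) (v : Fin J → Bool) (k : ℕ) :
    coord b k (cubePoint b δ v) = cubeCoord δ v k := by
  rw [cubePoint, coord_sum_smul]
  split_ifs with h
  · rfl
  · simp [cubeCoord, h]

/-- Neighbouring vertices differ by ± 2δ φ_j. Boundedness of the basis turns this into the uniform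
distance which `affinity_ge` requires. -/
lemma abs_cubePoint_sub_flip_le (hφb : ∀ j, b j =ᵐ[μ] φ j) (hK : ∀ j x, |φ j x| ≤ K) {δ : ℝ}
    (hδ : 0 ≤ δ) (v : Fin J → Bool) (j : Fin J) :
    ∀ᵐ x ∂μ, |cubePoint b δ v x - cubePoint b δ (flip j v) x| ≤ 2 * δ * K := by
  have hdiff : cubePoint b δ v - cubePoint b δ (flip j v) = (2 * cubeCoord δ v j) • b j := by
    rw [cubePoint, cubePoint, ← Finset.sum_sub_distrib,
      Finset.sum_eq_single_of_mem (j : ℕ) (Finset.mem_range.2 j.2)]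
    · rw [cubeCoord_flip_self, ← sub_smul]
      congr 1
      ring
    · intro k _ hk
      rw [cubeCoord_flip_of_ne δ v hk, sub_self]
  have habs : |cubeCoord δ v j| = δ := by
    have h := (sq_eq_sq_iff_abs_eq_abs _ _).1 (sq_cubeCoord δ v j)
    rwa [abs_of_nonneg hδ] at h
  filter_upwards [hφb j, Lp.coeFn_sub (cubePoint b δ v) (cubePoint b δ (flip j v)),
    Lp.coeFn_smul (2 * cubeCoord δ v j) (b j)] with x h1 h2 h3
  rw [hdiff, h3] at h2
  rw [← Pi.sub_apply, ← h2, Pi.smul_apply, smul_eq_mul, h1, abs_mul, abs_mul, habs, abs_two]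
  exact mul_le_mul_of_nonneg_left (hK _ _) (by positivity)

lemma cubePoint_mem_sobolevBall {d : ℕ} {β R δ : ℝ} (hβ : 0 ≤ β)
    (h : (J : ℝ) * ((J : ℝ) ^ (2 * β / d) * δ ^ 2) ≤ R ^ 2) (v : Fin J → Bool) :
    cubePoint b δ v ∈ sobolevBall b d β R := by
  rw [sobolevBall, Set.mem_ofPred_eq, sobolevNormSq, tsum_eq_sum_add_tsum_tail _ J]
  have hz : ∀ k, inner ℝ (b k) (cubePoint b δ v) = cubeCoord δ v k := coord_cubePoint b δ v
  have htail : ∀ k, cubeCoord δ v (k + J) = 0 := fun k => by simp [cubeCoord]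
  simp only [hz, htail, ne_eq, OfNat.ofNat_ne_zero, not_false_eq_true, zero_pow, mul_zero,
    ENNReal.ofReal_zero, tsum_zero, add_zero]
  refine le_trans (Finset.sum_le_card_nsmul _ _
    (ENNReal.ofReal ((J : ℝ) ^ (2 * β / d) * δ ^ 2)) fun k hk => ?_) ?_
  · rw [Finset.mem_range] at hk
    rw [sq_cubeCoord δ v ⟨k, hk⟩]
    refine ENNReal.ofReal_le_ofReal (mul_le_mul_of_nonneg_right ?_ (sq_nonneg _))
    exact Real.rpow_le_rpow (by positivity) (by exact_mod_cast hk) (by positivity)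
  · rw [Finset.card_range, nsmul_eq_mul, ← ENNReal.ofReal_natCast,
      ← ENNReal.ofReal_mul (Nat.cast_nonneg J)]
    exact ENNReal.ofReal_le_ofReal h

/-- Assouad's lemma. -/
lemma assouad (hφb : ∀ j, b j =ᵐ[μ] φ j) (hK : ∀ j x, |φ j x| ≤ K) (hσ : 0 < σ) {δ : ℝ}
    (hδ : 0 ≤ δ) {n : ℕ} {T : (Fin n → 𝒳 × ℝ) → L2 μ} (hT : Measurable T) {B : ℝ≥0∞}
    (hB : ∀ v : Fin J → Bool, ∫⁻ z, ENNReal.ofReal (‖T z - cubePoint b δ v‖ ^ 2)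
      ∂(dataLaw σ (cubePoint b δ v) n) ≤ B) :
    J * ENNReal.ofReal (δ ^ 2 * Real.exp (-(n * δ ^ 2 * K ^ 2 / (σ : ℝ) ^ 2))) ≤ 2 * B := by
  set q := ENNReal.ofReal (δ ^ 2 * Real.exp (-(n * δ ^ 2 * K ^ 2 / (σ : ℝ) ^ 2))) with hq
  set e : (Fin J → Bool) → Fin J → ℝ≥0∞ := fun v j =>
    ∫⁻ z, ENNReal.ofReal ((coord b j (T z) - cubeCoord δ v j) ^ 2)
      ∂(dataLaw σ (cubePoint b δ v) n) with he
  have hTm : ∀ j, Measurable fun z => coord b j (T z) := fun j => (measurable_coord b j).comp hT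
  -- The two-point bound for the j-th coordinate along an edge of the cube, with η = 2δK and |b - a|
  -- = 2δ.
  have hpair : ∀ v j, q ≤ e v j + e (flip j v) j := fun v j => by
    refine le_trans (le_of_eq ?_) (two_point_bound hσ
      (abs_cubePoint_sub_flip_le b hφb hK hδ v j) (hTm j)
      (cubeCoord δ v j) (cubeCoord δ (flip j v) j))
    rw [hq, cubeCoord_flip_self]
    congr 1
    have h1 : (-cubeCoord δ v j - cubeCoord δ v j) ^ 2 = 4 * δ ^ 2 := by
      rw [← sq_cubeCoord δ v j]; ring
    have h2 : (n : ℝ) * (2 * δ * K) ^ 2 / (4 * (σ : ℝ) ^ 2) = n * δ ^ 2 * K ^ 2 / (σ : ℝ) ^ 2 := by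
      field_simp
      ring
    rw [h1, h2]
    ring
  -- Sum over all vertices; the flip permutes them, so both errors of an edge give the same total.
  have hcol : ∀ j, (Fintype.card (Fin J → Bool)) * q ≤ 2 * ∑ v, e v j := fun j => by
    calc (Fintype.card (Fin J → Bool)) * q = ∑ _v : Fin J → Bool, q := by simp
      _ ≤ ∑ v, (e v j + e (flip j v) j) := Finset.sum_le_sum fun v _ => hpair v j
      _ = ∑ v, e v j + ∑ v, e v j := by
        rw [Finset.sum_add_distrib]
        congr 1
        exact Equiv.sum_comp (flip_involutive j).toPerm fun v => e v j
      _ = _ := (two_mul _).symm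
  have hrow : ∀ v, ∑ j, e v j ≤ B := fun v => by
    refine le_trans ?_ (hB v)
    rw [he]
    simp only
    rw [← lintegral_finsetSum]
    · refine lintegral_mono fun z => ?_
      simp only
      rw [ofReal_norm_sq_eq_tsum b]
      have : ∀ j : ℕ, ENNReal.ofReal (coord b j (T z - cubePoint b δ v) ^ 2) =
          ENNReal.ofReal ((coord b j (T z) - cubeCoord δ v j) ^ 2) := fun j => by
        rw [coord_sub, coord_cubePoint]
      simp_rw [this]
      rw [Fin.sum_univ_eq_sum_range
        (fun j => ENNReal.ofReal ((coord b j (T z) - cubeCoord δ v j) ^ 2))]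
      exact ENNReal.sum_le_tsum _
    · intro j _
      have := hTm j
      fun_prop
  have hcard : (Fintype.card (Fin J → Bool) : ℝ≥0∞) ≠ 0 := by
    exact_mod_cast Fintype.card_ne_zero
  rw [← ENNReal.mul_le_mul_iff_right hcard (ENNReal.natCast_ne_top _)]
  calc (Fintype.card (Fin J → Bool)) * (J * q)
      = ∑ _j : Fin J, (Fintype.card (Fin J → Bool)) * q := by
        simp only [Finset.sum_const, Finset.card_univ, Fintype.card_fin, nsmul_eq_mul]
        ring
    _ ≤ ∑ j, 2 * ∑ v, e v j := Finset.sum_le_sum fun j _ => hcol j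
    _ = 2 * ∑ v, ∑ j, e v j := by rw [← Finset.mul_sum, Finset.sum_comm]
    _ ≤ 2 * ∑ _v : Fin J → Bool, B := by
        gcongr with v
        exact hrow v
    _ = _ := by
        simp only [Finset.sum_const, Finset.card_univ, nsmul_eq_mul]
        ring

/-- The minimax rate over Sobolev balls in regression with random design. -/
theorem isMinimaxRate {d : ℕ} (hd : 0 < d) {β : ℝ} (hβ : 0 < β)
    (hφmeas : ∀ j, Measurable (φ j)) (hφb : ∀ j, b j =ᵐ[μ] φ j) (hK : ∀ j x, |φ j x| ≤ K)
    (hσ : 0 < σ) : IsMinimaxRate b d β σ fun n => (n : ℝ) ^ (-β / (d + 2 * β)) := by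
  intro R hR
  have hd' : (0 : ℝ) < d := by exact_mod_cast hd
  set D : ℝ := d + 2 * β with hD
  have hD0 : 0 < D := by positivity
  have hs2 : (0 : ℝ) < (σ : ℝ) ^ 2 := by positivity
  set E := Real.exp (-(R ^ 2 * K ^ 2 / (σ : ℝ) ^ 2)) with hE
  refine ⟨R ^ 2 * E / 4, K ^ 2 * (R ^ 2 + (σ : ℝ) ^ 2) + R ^ 2, by positivity, ?_⟩
  filter_upwards [eventually_gt_atTop 0] with n hn
  have hn' : (0 : ℝ) < n := by exact_mod_cast hn
  set N : ℝ := (n : ℝ) ^ (d / D) with hN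
  have hN1 : 1 ≤ N := one_le_rpow_natCast hn (by positivity)
  set J := ⌊N⌋₊ with hJ
  have hJN : (J : ℝ) ≤ N := Nat.floor_le (by positivity)
  have hNJ : N ≤ J + 1 := (Nat.lt_floor_add_one N).le
  have hJ1 : (1 : ℝ) ≤ J := by exact_mod_cast Nat.le_floor (by simpa using hN1)
  have hNn : N / n = (n : ℝ) ^ (-(2 * β) / D) := rpow_div_self hn hD0.ne' (by rw [hD])
  have hNβ : N ^ (-(2 * β / d)) = (n : ℝ) ^ (-(2 * β) / D) := rpow_div_rpow_neg hd'.ne' _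
  -- The balance defining the rate: with J ≤ N and δ² = R²/n, this identity places the cube inside
  -- the Sobolev ball.
  have hNN : N * N ^ (2 * β / (d : ℝ)) = n := by
    have h1 : N ^ (2 * β / (d : ℝ)) = n / N := by
      rw [← inv_inj, ← Real.rpow_neg (by positivity), hNβ, ← hNn, inv_div]
    rw [h1]
    field_simp
  rw [rpow_neg_div_sq]
  constructor
  · refine le_iInf₂ fun T hT => ?_
    -- At this scale n δ² = R² is constant, so the affinities of neighbours, and with them the
    -- factor `E`, do not degenerate as n grows.
    set δ := √(R ^ 2 / n) with hδ
    have hδ2 : δ ^ 2 = R ^ 2 / n := Real.sq_sqrt (by positivity)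
    have hball : (J : ℝ) * ((J : ℝ) ^ (2 * β / d) * δ ^ 2) ≤ R ^ 2 := by
      rw [hδ2]
      calc (J : ℝ) * ((J : ℝ) ^ (2 * β / d) * (R ^ 2 / n))
          ≤ N * (N ^ (2 * β / (d : ℝ)) * (R ^ 2 / n)) := by gcongr
        _ = (N * N ^ (2 * β / (d : ℝ))) * (R ^ 2 / n) := by ring
        _ = R ^ 2 := by rw [hNN]; field_simp
    have h := assouad (J := J) b hφb hK hσ (Real.sqrt_nonneg (R ^ 2 / n)) hT
      (B := ⨆ f₀ ∈ sobolevBall b d β R, ∫⁻ z, ENNReal.ofReal (‖T z - f₀‖ ^ 2) ∂(dataLaw σ f₀ n))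
      fun v => le_iSup₂ (f := fun f₀ (_ : f₀ ∈ sobolevBall b d β R) =>
        ∫⁻ z, ENNReal.ofReal (‖T z - f₀‖ ^ 2) ∂(dataLaw σ f₀ n)) _
        (cubePoint_mem_sobolevBall b hβ.le hball v)
    rw [← hδ, hδ2] at h
    rw [← ENNReal.mul_le_mul_iff_right two_ne_zero ENNReal.ofNat_ne_top]
    refine le_trans ?_ h
    rw [← ENNReal.ofReal_natCast, ← ENNReal.ofReal_mul (Nat.cast_nonneg J),
      show (2 : ℝ≥0∞) = ENNReal.ofReal 2 by simp, ← ENNReal.ofReal_mul zero_le_two]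
    refine ENNReal.ofReal_le_ofReal ?_
    rw [show (n : ℝ) * (R ^ 2 / n) * K ^ 2 / (σ : ℝ) ^ 2 = R ^ 2 * K ^ 2 / (σ : ℝ) ^ 2 by
      field_simp, ← hE, ← hNn]
    have h2 : N ≤ 2 * J := by linarith
    calc 2 * (R ^ 2 * E / 4 * (N / n)) = N * (R ^ 2 * E / (2 * n)) := by field_simp; ring
      _ ≤ (2 * J) * (R ^ 2 * E / (2 * n)) := by gcongr
      _ = _ := by field_simp
  -- At the same cutoff J the variance J/n and the squared bias N^{-2β/d} have the same order.
  · refine (iInf₂_le (projectionEstimator b φ J)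
      (measurable_projectionEstimator hφmeas J n)).trans ?_
    refine iSup₂_le fun f hf => ?_
    have hfn : ‖f‖ ^ 2 ≤ R ^ 2 := by
      rw [← ENNReal.ofReal_le_ofReal_iff (sq_nonneg R)]
      exact (ofReal_norm_sq_le_sobolevNormSq hβ.le f).trans hf
    refine (risk_projectionEstimator_le hφmeas hφb hK f J hn).trans ?_
    refine (add_le_add_right ((tsum_tail_le_sobolevNormSq (b := b) (d := d) hβ.le f
      (by positivity) hNJ).trans (mul_le_mul_right hf _)) _).trans ?_
    rw [← ENNReal.ofReal_mul (by positivity), ← ENNReal.ofReal_add (by positivity) (by positivity)]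
    refine ENNReal.ofReal_le_ofReal ?_
    rw [hNβ, add_mul, ← hNn]
    refine add_le_add ?_ (by rw [mul_comm])
    calc (J : ℝ) * ((n : ℝ)⁻¹ * (K ^ 2 * (‖f‖ ^ 2 + (σ : ℝ) ^ 2)))
        ≤ N * ((n : ℝ)⁻¹ * (K ^ 2 * (R ^ 2 + (σ : ℝ) ^ 2))) := by gcongr
      _ = _ := by rw [div_eq_mul_inv]; ring

end Hypercube

/-! ### Deterministic bounds for ridge regression. -/

section Ridge

open Matrix WithLp

variable {lam : ℕ → ℝ≥0} {σ : ℝ≥0} {n m : ℕ}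

/-- The posterior variance of the `j`-th coefficient for a design with Gram matrix `(n / 2) I`. -/
def shrinkage (lam : ℕ → ℝ≥0) (σ : ℝ≥0) (n j : ℕ) : ℝ :=
  ((lam j : ℝ)⁻¹ + n / (2 * (σ : ℝ) ^ 2))⁻¹

lemma shrinkage_pos (hlam : ∀ j, 0 < lam j) (j : ℕ) : 0 < shrinkage lam σ n j := by
  have : (0 : ℝ) < lam j := hlam j
  unfold shrinkage
  positivity

lemma shrinkage_le_eigenvalue (hlam : ∀ j, 0 < lam j) (j : ℕ) :
    shrinkage lam σ n j ≤ lam j := by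
  have h : (0 : ℝ) < lam j := hlam j
  refine inv_le_of_inv_le₀ h ?_
  have : 0 ≤ (n : ℝ) / (2 * (σ : ℝ) ^ 2) := by positivity
  linarith

lemma shrinkage_le_div (hσ : 0 < σ) (hn : 0 < n) (j : ℕ) :
    shrinkage lam σ n j ≤ 2 * (σ : ℝ) ^ 2 / n := by
  have hσ' : (0 : ℝ) < σ := hσ
  have hn' : (0 : ℝ) < n := by exact_mod_cast hn
  rw [← inv_div]
  refine inv_anti₀ (by positivity) ?_
  have : (0 : ℝ) ≤ (lam j : ℝ)⁻¹ := by positivity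
  linarith

variable {Φ : Matrix (Fin n) (Fin m) ℝ}

/-- The Gram lower bound makes the precision matrix dominate the diagonal matrix of the inverse
shrinkages in the order of quadratic forms. -/
lemma sum_sq_div_shrinkage_le
    (hG : ∀ v : Fin m → ℝ, (n : ℝ) / 2 * (v ⬝ᵥ v) ≤ (Φ *ᵥ v) ⬝ᵥ (Φ *ᵥ v)) (v : Fin m → ℝ) :
    ∑ j : Fin m, (shrinkage lam σ n j)⁻¹ * v j ^ 2 ≤ v ⬝ᵥ precision lam σ Φ *ᵥ v := by
  have h := mul_le_mul_of_nonneg_left (hG v) (by positivity : (0 : ℝ) ≤ ((σ : ℝ) ^ 2)⁻¹)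
  rw [dotProduct_precision]
  refine le_trans (le_of_eq ?_) (add_le_add_right h _)
  rw [dotProduct, Finset.mul_sum, Finset.mul_sum, ← Finset.sum_add_distrib]
  refine Finset.sum_congr rfl fun j _ => ?_
  rw [shrinkage, inv_inv]
  ring

/-- The diagonal of the inverse precision matrix. -/
lemma precision_inv_apply_le (hlam : ∀ j, 0 < lam j)
    (hG : ∀ v : Fin m → ℝ, (n : ℝ) / 2 * (v ⬝ᵥ v) ≤ (Φ *ᵥ v) ⬝ᵥ (Φ *ᵥ v)) (j : Fin m) :
    (precision lam σ Φ)⁻¹ j j ≤ shrinkage lam σ n j := by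
  have hP := posDef_precision (σ := σ) hlam Φ
  have hu : IsUnit (precision lam σ Φ).det := hP.det_pos.ne'.isUnit
  -- Testing the domination on s = P⁻¹ e_j gives s_j² / q_j ≤ sᵀ P s = s_j, where s_j is the
  -- diagonal entry; hence s_j ≤ q_j.
  set s : Fin m → ℝ := (precision lam σ Φ)⁻¹ *ᵥ Pi.single j 1 with hs
  have hPs : precision lam σ Φ *ᵥ s = Pi.single j 1 := by
    rw [hs, mulVec_mulVec, mul_nonsing_inv _ hu, one_mulVec]
  have hsj : (precision lam σ Φ)⁻¹ j j = s j := by simp [hs]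
  have h1 := sum_sq_div_shrinkage_le (lam := lam) (σ := σ) hG s
  rw [hPs, dotProduct_single, mul_one] at h1
  have hq := shrinkage_pos (σ := σ) (n := n) hlam j
  have h2 := (Finset.single_le_sum (f := fun j : Fin m => (shrinkage lam σ n j)⁻¹ * s j ^ 2)
    (fun i _ => mul_nonneg (inv_nonneg.2 (shrinkage_pos hlam i).le) (sq_nonneg _))
    (Finset.mem_univ j)).trans h1
  rw [hsj]
  by_contra! hlt
  have hs0 := hq.trans hlt
  have h3 : s j * s j ≤ shrinkage lam σ n j * s j := by
    rw [inv_mul_le_iff₀ hq, sq] at h2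
    exact h2
  exact absurd (le_of_mul_le_mul_right h3 hs0) (not_le.2 hlt)

/-- The deviation of the optimal mean from a coefficient vector `a`, for responses which deviate
from the regression function of `a` by a noise `e` and a bias `r`. -/
lemma sq_dist_optMean_le (hlam : ∀ j, 0 < lam j) (hσ : 0 < σ) (hn : 0 < n)
    (hG : ∀ v : Fin m → ℝ, (n : ℝ) / 2 * (v ⬝ᵥ v) ≤ (Φ *ᵥ v) ⬝ᵥ (Φ *ᵥ v))
    {y e r : Fin n → ℝ} {a : Fin m → ℝ} (hy : y = Φ *ᵥ a + e + r) :
    ∑ j : Fin m, (optMean lam σ Φ y j - a j) ^ 2 ≤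
      8 * (σ : ℝ) ^ 2 / n * (∑ j : Fin m, shrinkage lam σ n j * (((σ : ℝ) ^ 2)⁻¹ * (Φᵀ *ᵥ e) j) ^ 2 +
        ((σ : ℝ) ^ 2)⁻¹ * ∑ i, r i ^ 2 + ∑ j : Fin m, (lam j : ℝ)⁻¹ * a j ^ 2) := by
  have hσ' : (0 : ℝ) < σ := hσ
  have hn' : (0 : ℝ) < n := by exact_mod_cast hn
  set h : Fin m → ℝ := (optMean lam σ Φ y).ofLp - a with hh
  set Q := h ⬝ᵥ precision lam σ Φ *ᵥ h with hQ
  have hQ1 := dotProduct_precision (lam := lam) (σ := σ) Φ h h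
  have hQ2 := sum_sq_div_shrinkage_le (lam := lam) (σ := σ) hG h
  have hsq : h ⬝ᵥ h = ∑ j, h j ^ 2 := Finset.sum_congr rfl fun j _ => (sq _).symm
  have hlsum : 0 ≤ ∑ j : Fin m, (lam j : ℝ)⁻¹ * (h j * h j) :=
    Finset.sum_nonneg fun j _ => mul_nonneg (by positivity) (mul_self_nonneg _)
  have hΦ0 : 0 ≤ (Φ *ᵥ h) ⬝ᵥ (Φ *ᵥ h) := Finset.sum_nonneg fun _ _ => mul_self_nonneg _
  -- The normal equation for the optimal mean, paired with the error h: noise, bias and prior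
  -- penalty enter linearly in h.
  have hident : Q = ∑ j : Fin m, h j * (((σ : ℝ) ^ 2)⁻¹ * (Φᵀ *ᵥ e) j) +
      ((σ : ℝ) ^ 2)⁻¹ * ((Φ *ᵥ h) ⬝ᵥ r) - ∑ j : Fin m, (lam j : ℝ)⁻¹ * (h j * a j) := by
    have h1 : Q = h ⬝ᵥ precision lam σ Φ *ᵥ (optMean lam σ Φ y).ofLp -
        h ⬝ᵥ precision lam σ Φ *ᵥ a := by
      rw [hQ, ← dotProduct_sub, ← mulVec_sub]
    have h2 : ∀ v : Fin n → ℝ, h ⬝ᵥ Φᵀ *ᵥ v = (Φ *ᵥ h) ⬝ᵥ v := fun v => by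
      rw [dotProduct_mulVec, vecMul_transpose]
    have h3 : ∑ j : Fin m, h j * (((σ : ℝ) ^ 2)⁻¹ * (Φᵀ *ᵥ e) j) =
        ((σ : ℝ) ^ 2)⁻¹ * ((Φ *ᵥ h) ⬝ᵥ e) := by
      rw [← h2, dotProduct, Finset.mul_sum]
      exact Finset.sum_congr rfl fun j _ => by ring
    rw [h1, precision_mulVec_optMean hlam, dotProduct_smul, h2, dotProduct_precision, h3, hy,
      dotProduct_add, dotProduct_add, smul_eq_mul]
    ring
  -- Young's inequality. This term costs a quarter of Q; the next two together cost another quarter,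
  -- since Q is the sum of the prior part and the design part. Half of Q is left to absorb them.
  have hw : ∑ j : Fin m, h j * (((σ : ℝ) ^ 2)⁻¹ * (Φᵀ *ᵥ e) j) ≤ 1 / 4 * Q +
      ∑ j : Fin m, shrinkage lam σ n j * (((σ : ℝ) ^ 2)⁻¹ * (Φᵀ *ᵥ e) j) ^ 2 := by
    refine le_trans ?_ (add_le_add_left (mul_le_mul_of_nonneg_left hQ2 (by norm_num)) _)
    rw [Finset.mul_sum, ← Finset.sum_add_distrib]
    refine Finset.sum_le_sum fun j _ => ?_
    have hq := shrinkage_pos (σ := σ) (n := n) hlam j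
    set q := shrinkage lam σ n j
    set w := ((σ : ℝ) ^ 2)⁻¹ * (Φᵀ *ᵥ e) j
    have : 1 / 4 * (q⁻¹ * h j ^ 2) + q * w ^ 2 - h j * w = q⁻¹ * (h j / 2 - q * w) ^ 2 := by
      field_simp
      ring
    have h0 : 0 ≤ q⁻¹ * (h j / 2 - q * w) ^ 2 := by positivity
    linarith
  have hr : (Φ *ᵥ h) ⬝ᵥ r ≤ 1 / 4 * ((Φ *ᵥ h) ⬝ᵥ (Φ *ᵥ h)) + ∑ i, r i ^ 2 := by
    rw [dotProduct, dotProduct, Finset.mul_sum, ← Finset.sum_add_distrib]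
    refine Finset.sum_le_sum fun i _ => ?_
    nlinarith [sq_nonneg ((Φ *ᵥ h) i / 2 - r i)]
  have ha : -∑ j : Fin m, (lam j : ℝ)⁻¹ * (h j * a j) ≤
      1 / 4 * ∑ j : Fin m, (lam j : ℝ)⁻¹ * (h j * h j) + ∑ j : Fin m, (lam j : ℝ)⁻¹ * a j ^ 2 := by
    rw [← Finset.sum_neg_distrib, Finset.mul_sum, ← Finset.sum_add_distrib]
    refine Finset.sum_le_sum fun j _ => ?_
    have hl : (0 : ℝ) ≤ (lam j : ℝ)⁻¹ := by positivity
    have := mul_nonneg hl (sq_nonneg (h j / 2 + a j))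
    nlinarith
  have hr' := mul_le_mul_of_nonneg_left hr (by positivity : (0 : ℝ) ≤ ((σ : ℝ) ^ 2)⁻¹)
  have hΦ0' := mul_nonneg (by positivity : (0 : ℝ) ≤ ((σ : ℝ) ^ 2)⁻¹) hΦ0
  have hG' := mul_le_mul_of_nonneg_left (hG h) (by positivity : (0 : ℝ) ≤ ((σ : ℝ) ^ 2)⁻¹)
  have hfin : ((σ : ℝ) ^ 2)⁻¹ * ((n : ℝ) / 2 * (h ⬝ᵥ h)) ≤
      4 * (∑ j : Fin m, shrinkage lam σ n j * (((σ : ℝ) ^ 2)⁻¹ * (Φᵀ *ᵥ e) j) ^ 2 +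
        ((σ : ℝ) ^ 2)⁻¹ * ∑ i, r i ^ 2 + ∑ j : Fin m, (lam j : ℝ)⁻¹ * a j ^ 2) := by
    rw [mul_add] at hr'
    nlinarith
  calc ∑ j : Fin m, (optMean lam σ Φ y j - a j) ^ 2 = h ⬝ᵥ h := hsq.symm
    _ = 2 * (σ : ℝ) ^ 2 / n * (((σ : ℝ) ^ 2)⁻¹ * ((n : ℝ) / 2 * (h ⬝ᵥ h))) := by field_simp
    _ ≤ 2 * (σ : ℝ) ^ 2 / n * _ := mul_le_mul_of_nonneg_left hfin (by positivity)
    _ = _ := by ring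

/-- A Gram matrix close to the identity in Frobenius norm is well conditioned. -/
lemma gram_lower_bound (hn : 0 < n)
    (h : ∑ j : Fin m, ∑ k : Fin m,
      ((n : ℝ)⁻¹ * ∑ i, Φ i j * Φ i k - if j = k then 1 else 0) ^ 2 ≤ 1 / 4) (v : Fin m → ℝ) :
    (n : ℝ) / 2 * (v ⬝ᵥ v) ≤ (Φ *ᵥ v) ⬝ᵥ (Φ *ᵥ v) := by
  have hn' : (0 : ℝ) < n := by exact_mod_cast hn
  set E : Fin m → Fin m → ℝ := fun j k => (n : ℝ)⁻¹ * ∑ i, Φ i j * Φ i k - if j = k then 1 else 0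
    with hE
  have hvv : v ⬝ᵥ v = ∑ j, v j ^ 2 := Finset.sum_congr rfl fun j _ => (sq _).symm
  have hident : ∑ p : Fin m × Fin m, E p.1 p.2 * (v p.1 * v p.2) =
      (n : ℝ)⁻¹ * ((Φ *ᵥ v) ⬝ᵥ (Φ *ᵥ v)) - v ⬝ᵥ v := by
    have h1 : (Φ *ᵥ v) ⬝ᵥ (Φ *ᵥ v) = ∑ j, ∑ k, (∑ i, Φ i j * Φ i k) * (v j * v k) := by
      simp only [dotProduct, mulVec, Finset.sum_mul]
      rw [Finset.sum_comm]
      refine Finset.sum_congr rfl fun j _ => ?_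
      rw [Finset.sum_comm]
      refine Finset.sum_congr rfl fun i _ => ?_
      rw [Finset.mul_sum]
      exact Finset.sum_congr rfl fun k _ => by ring
    rw [Fintype.sum_prod_type, h1, Finset.mul_sum, dotProduct, ← Finset.sum_sub_distrib]
    refine Finset.sum_congr rfl fun j _ => ?_
    rw [Finset.mul_sum]
    simp only [hE, sub_mul, Finset.sum_sub_distrib, ite_mul, one_mul, zero_mul,
      Finset.sum_ite_eq, Finset.mem_univ, if_true, mul_assoc]
  -- Cauchy-Schwarz over pairs of indices: the form of E at v is at most the Frobenius norm of E,
  -- here at most 1/2, times |v|².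
  have hcs := Finset.sum_mul_sq_le_sq_mul_sq Finset.univ (fun p : Fin m × Fin m => E p.1 p.2)
    (fun p => v p.1 * v p.2)
  have h2 : ∑ p : Fin m × Fin m, (v p.1 * v p.2) ^ 2 = (v ⬝ᵥ v) ^ 2 := by
    rw [Fintype.sum_prod_type, hvv, sq, Finset.sum_mul_sum]
    exact Finset.sum_congr rfl fun j _ => Finset.sum_congr rfl fun k _ => by ring
  rw [hident, h2, Fintype.sum_prod_type] at hcs
  have hv0 : 0 ≤ v ⬝ᵥ v := by rw [hvv]; positivity
  have hcs' : ((n : ℝ)⁻¹ * ((Φ *ᵥ v) ⬝ᵥ (Φ *ᵥ v)) - v ⬝ᵥ v) ^ 2 ≤ (1 / 2 * (v ⬝ᵥ v)) ^ 2 := by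
    refine hcs.trans ((mul_le_mul_of_nonneg_right h (sq_nonneg _)).trans_eq ?_)
    ring
  have h3 := (abs_le.1 (abs_le_of_sq_le_sq hcs' (by positivity))).1
  have h4 : 1 / 2 * (v ⬝ᵥ v) ≤ (n : ℝ)⁻¹ * ((Φ *ᵥ v) ⬝ᵥ (Φ *ᵥ v)) := by linarith
  rw [inv_mul_eq_div, le_div_iff₀ hn'] at h4
  linarith

end Ridge

lemma lintegral_sq_sub_gaussianReal (a c : ℝ) (v : ℝ≥0) :
    ∫⁻ x, ENNReal.ofReal ((x - c) ^ 2) ∂(gaussianReal a v) = ENNReal.ofReal ((a - c) ^ 2 + v) := by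
  have hL : MemLp (fun x : ℝ => x - c) 2 (gaussianReal a v) :=
    (memLp_id_gaussianReal 2).sub (memLp_const c)
  rw [← ofReal_integral_eq_lintegral_ofReal hL.integrable_sq (ae_of_all _ fun x => sq_nonneg _)]
  have h1 := variance_eq_sub hL
  have h2 : Var[fun x : ℝ => x - c; gaussianReal a v] = v := by
    rw [variance_sub_const (by fun_prop)]
    exact variance_fun_id_gaussianReal
  have h3 : ∫ x, (x - c) ∂(gaussianReal a v) = a - c := by
    have hi : Integrable (fun x : ℝ => x) (gaussianReal a v) :=
      (memLp_id_gaussianReal 1).integrable le_rfl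
    rw [integral_sub hi (integrable_const c), integral_id_gaussianReal]
    simp
  rw [h2, h3] at h1
  congr 1
  have h4 : ∫ x, ((fun x : ℝ => x - c) ^ 2) x ∂(gaussianReal a v) =
    ∫ x, (x - c) ^ 2 ∂(gaussianReal a v) := rfl
  linarith

/-! ### Moments of noise, remainder and Gram matrix under the data law. -/

section Moments

variable {𝒳 : Type*} [MeasurableSpace 𝒳] [MeasurableSpace.CountablyGenerated 𝒳]
  {μ : Measure 𝒳} [IsProbabilityMeasure μ] (b : HilbertBasis ℕ ℝ (L2 μ)) {lam : ℕ → ℝ≥0} {m : ℕ}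

/-- The mean squared distance to `f₀` under a variational law. -/
lemma lintegral_sq_dist_variationalLaw (hs : Summable lam) (hlam : ∀ j, 0 < lam j)
    (a : EuclideanSpace ℝ (Fin m)) {S : Matrix (Fin m) (Fin m) ℝ} (hS : S.PosDef) (f₀ : L2 μ) :
    ∫⁻ f, ENNReal.ofReal (‖f - f₀‖ ^ 2) ∂(variationalLaw b lam a S) =
      ∑ j : Fin m, ENNReal.ofReal ((a j - coord b j f₀) ^ 2 + S j j) +
        ∑' j, ENNReal.ofReal (coord b (j + m) f₀ ^ 2 + lam (j + m)) := by
  have hterm : ∀ (j : ℕ) (a : ℝ) (v : ℝ≥0) (Ψ : Measure (L2 μ)),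
      Ψ.map (coord b j) = gaussianReal a v →
      ∫⁻ f, ENNReal.ofReal ((coord b j f - coord b j f₀) ^ 2) ∂Ψ =
        ENNReal.ofReal ((a - coord b j f₀) ^ 2 + v) := by
    intro j a v Ψ h
    rw [← lintegral_sq_sub_gaussianReal, ← h, lintegral_map (by fun_prop) (measurable_coord b j)]
  simp_rw [ofReal_norm_sq_eq_tsum b, coord_sub]
  rw [lintegral_tsum fun j => by
    have := measurable_coord b j
    exact Measurable.aemeasurable (by fun_prop), tsum_eq_sum_add_tsum_tail _ m,
    Finset.sum_range]
  congr 1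
  · refine Finset.sum_congr rfl fun j _ => ?_
    rw [hterm j _ _ _ (map_coord_variationalLaw_of_lt b hs hlam a hS j),
      Real.coe_toNNReal _ hS.diag_pos.le]
  · refine tsum_congr fun j => ?_
    rw [hterm _ _ _ _ (map_coord_variationalLaw b hs hlam a hS (Nat.le_add_left m j)), zero_sub,
      neg_sq]

lemma measure_le_norm_sub_le (Ψ : Measure (L2 μ)) (f₀ : L2 μ) {δ : ℝ} (hδ : 0 < δ) :
    Ψ {f | δ ≤ ‖f - f₀‖} ≤
      (∫⁻ f, ENNReal.ofReal (‖f - f₀‖ ^ 2) ∂Ψ) / ENNReal.ofReal (δ ^ 2) := by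
  have hm : Measurable fun f : L2 μ => ENNReal.ofReal (‖f - f₀‖ ^ 2) := by fun_prop
  refine (measure_mono fun f hf => ?_).trans
    (meas_ge_le_lintegral_div hm.aemeasurable (by positivity) ENNReal.ofReal_ne_top)
  exact ENNReal.ofReal_le_ofReal (pow_le_pow_left₀ hδ.le hf 2)

/-- The part of `f` orthogonal to the first `J` basis functions. -/
def remainder (φ : ℕ → 𝒳 → ℝ) (J : ℕ) (f : L2 μ) (x : 𝒳) : ℝ :=
  f x - ∑ j ∈ Finset.range J, coord b j f * φ j x

lemma measurable_remainder {φ : ℕ → 𝒳 → ℝ} (hφmeas : ∀ j, Measurable (φ j)) (J : ℕ) (f : L2 μ) :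
    Measurable (remainder b φ J f) :=
  (measurable_L2 f).sub (Finset.measurable_sum _ fun j _ => (hφmeas j).const_mul _)

/-- Ties the pointwise remainder, which enters the regression as bias at the design points, to the
tail of the coefficients. -/
lemma lintegral_remainder_sq {φ : ℕ → 𝒳 → ℝ} (hφb : ∀ j, b j =ᵐ[μ] φ j) (J : ℕ) (f : L2 μ) :
    ∫⁻ x, ENNReal.ofReal (remainder b φ J f x ^ 2) ∂μ =
      ∑' j, ENNReal.ofReal (coord b (j + J) f ^ 2) := by
  set g : L2 μ := f - ∑ j ∈ Finset.range J, coord b j f • b j with hg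
  have hae : remainder b φ J f =ᵐ[μ] g := by
    have h1 := Lp.coeFn_finsetSum (Finset.range J) fun j => coord b j f • b j
    filter_upwards [ae_all_iff.2 hφb, Lp.coeFn_sub f (∑ j ∈ Finset.range J, coord b j f • b j), h1,
      ae_all_iff.2 fun j => Lp.coeFn_smul (coord b j f) (b j)] with x h1 h2 h3 h4
    rw [hg, h2, Pi.sub_apply, h3, remainder, Finset.sum_apply]
    congr 1
    exact Finset.sum_congr rfl fun j _ => by rw [h4, Pi.smul_apply, smul_eq_mul, h1]
  have h2 : ∫⁻ x, ENNReal.ofReal (remainder b φ J f x ^ 2) ∂μ = ENNReal.ofReal (‖g‖ ^ 2) := by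
    rw [norm_sq_eq_integral, ofReal_integral_eq_lintegral_ofReal (Lp.memLp g).integrable_sq
      (ae_of_all _ fun x => sq_nonneg _)]
    exact lintegral_congr_ae (hae.mono fun x hx => by simp only [hx])
  rw [h2, ofReal_norm_sq_eq_tsum b, tsum_eq_sum_add_tsum_tail _ J, Finset.sum_eq_zero, zero_add]
  · refine tsum_congr fun j => ?_
    rw [hg, coord_sub, coord_sum_smul, if_neg (by omega), sub_zero]
  · intro j hj
    rw [hg, coord_sub, coord_sum_smul, if_pos (Finset.mem_range.1 hj), sub_self]
    simp

lemma lintegral_sum_eval {Z : Type*} [MeasurableSpace Z] (ν : Measure Z) [IsProbabilityMeasure ν]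
    (n : ℕ) {g : Z → ℝ≥0∞} (hg : Measurable g) :
    ∫⁻ z, ∑ i, g (z i) ∂(Measure.pi fun _ : Fin n => ν) = n * ∫⁻ x, g x ∂ν := by
  have hm : ∀ i : Fin n, Measurable fun z : Fin n → Z => g (z i) := fun i =>
    hg.comp (measurable_pi_apply i)
  rw [lintegral_finsetSum _ fun i _ => hm i]
  have : ∀ i : Fin n, ∫⁻ z, g (z i) ∂(Measure.pi fun _ : Fin n => ν) = ∫⁻ x, g x ∂ν := fun i =>
    (measurePreserving_eval (fun _ : Fin n => ν) i).lintegral_comp hg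
  simp [this]

variable {φ : ℕ → 𝒳 → ℝ} {K : ℝ} {σ : ℝ≥0}

lemma lintegral_fst_obsLaw (f₀ : L2 μ) {g : 𝒳 → ℝ≥0∞} (hg : Measurable g) :
    ∫⁻ p, g p.1 ∂(obsLaw σ f₀) = ∫⁻ x, g x ∂μ := by
  have hm : Measurable fun p : 𝒳 × ℝ => g p.1 := hg.comp measurable_fst
  rw [obsLaw, lintegral_map hm (measurable_observation f₀)]
  exact (measurePreserving_fst (μ := μ) (ν := gaussianReal 0 (σ ^ 2))).lintegral_comp hg

lemma integral_fst_obsLaw (f₀ : L2 μ) {g : 𝒳 → ℝ} (hg : Measurable g) :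
    ∫ p, g p.1 ∂(obsLaw σ f₀) = ∫ x, g x ∂μ := by
  have hm : Measurable fun p : 𝒳 × ℝ => g p.1 := hg.comp measurable_fst
  rw [obsLaw, integral_map (measurable_observation f₀).aemeasurable hm.aestronglyMeasurable,
    integral_fun_fst]
  simp

/-- The mean squared size of the empirical noise coefficients. -/
lemma lintegral_sq_noise_le (hφmeas : ∀ j, Measurable (φ j)) (hK : ∀ j x, |φ j x| ≤ K) (f₀ : L2 μ)
    (j : ℕ) {n : ℕ} (hn : 0 < n) :
    ∫⁻ z, ENNReal.ofReal ((∑ i, φ j (z i).1 * ((z i).2 - f₀ (z i).1)) ^ 2) ∂(dataLaw σ f₀ n) ≤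
      ENNReal.ofReal (n * (K ^ 2 * σ ^ 2)) := by
  have hn' : (0 : ℝ) < n := by exact_mod_cast hn
  set g : 𝒳 × ℝ → ℝ := fun p => φ j p.1 * (p.2 - f₀ p.1) with hg
  have hgm : Measurable g := by
    have := hφmeas j
    have := measurable_L2 f₀
    fun_prop
  have hφL : MemLp (φ j) 2 μ := MemLp.of_bound (hφmeas j).aestronglyMeasurable K
    (ae_of_all _ fun x => hK j x)
  have he := memLp_gaussian_id (σ ^ 2)
  have hcomp : (g ∘ fun p : 𝒳 × ℝ => (p.1, f₀ p.1 + p.2)) = fun p => φ j p.1 * p.2 := by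
    ext p
    simp [hg]
  have hgL : MemLp g 2 (obsLaw σ f₀) := by
    rw [obsLaw, memLp_map_measure_iff hgm.aestronglyMeasurable
      (measurable_observation f₀).aemeasurable, hcomp]
    refine ((he.comp_snd μ).const_mul K).of_le
      (((hφmeas j).comp measurable_fst).mul measurable_snd).aestronglyMeasurable
      (ae_of_all _ fun p => ?_)
    have hK0 : 0 ≤ K := (abs_nonneg _).trans (hK j p.1)
    simp only [norm_mul, Real.norm_eq_abs, abs_of_nonneg hK0]
    exact mul_le_mul_of_nonneg_right (hK _ _) (abs_nonneg _)
  have hmean : ∫ p, g p ∂(obsLaw σ f₀) = 0 := by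
    rw [obsLaw, integral_map (measurable_observation f₀).aemeasurable hgm.aestronglyMeasurable]
    have h := integral_prod_mul (μ := μ) (ν := gaussianReal 0 (σ ^ 2)) (φ j) (fun e : ℝ => e)
    rw [integral_id_gaussianReal, mul_zero] at h
    exact (integral_congr_ae (ae_of_all _ fun p => congrFun hcomp p)).trans h
  have hsq : ∫ p, g p ^ 2 ∂(obsLaw σ f₀) ≤ K ^ 2 * σ ^ 2 := by
    rw [obsLaw, integral_map (measurable_observation f₀).aemeasurable
      (hgm.pow_const 2).aestronglyMeasurable]
    have h1 : ∀ p : 𝒳 × ℝ, g (p.1, f₀ p.1 + p.2) ^ 2 = φ j p.1 ^ 2 * p.2 ^ 2 := fun p => by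
      rw [← mul_pow]
      exact congrArg (· ^ 2) (congrFun hcomp p)
    simp_rw [h1]
    rw [integral_prod_mul (fun x => φ j x ^ 2) (fun e : ℝ => e ^ 2), integral_sq_gaussianReal]
    push_cast
    refine mul_le_mul_of_nonneg_right ?_ (by positivity)
    refine (integral_mono_of_nonneg (g := fun _ => K ^ 2) (ae_of_all _ fun x => sq_nonneg _)
      (integrable_const _) (ae_of_all _ fun x => ?_)).trans_eq (by simp)
    exact sq_le_sq' (abs_le.1 (hK j x)).1 (abs_le.1 (hK j x)).2
  have hav := lintegral_sq_average_le hn hgL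
  rw [hmean] at hav
  have hrw : ∀ z : Fin n → 𝒳 × ℝ,
      ENNReal.ofReal ((∑ i, φ j (z i).1 * ((z i).2 - f₀ (z i).1)) ^ 2) =
        ENNReal.ofReal ((n : ℝ) ^ 2) * ENNReal.ofReal (((n : ℝ)⁻¹ * ∑ i, g (z i) - 0) ^ 2) := by
    intro z
    rw [← ENNReal.ofReal_mul (by positivity), sub_zero, mul_pow, ← mul_assoc, inv_pow,
      mul_inv_cancel₀ (by positivity), one_mul]
  simp_rw [hrw]
  rw [lintegral_const_mul' _ _ ENNReal.ofReal_ne_top]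
  refine (mul_le_mul_right hav _).trans ?_
  rw [← ENNReal.ofReal_mul (by positivity)]
  refine ENNReal.ofReal_le_ofReal ?_
  calc (n : ℝ) ^ 2 * ((n : ℝ)⁻¹ * ∫ p, g p ^ 2 ∂(obsLaw σ f₀))
      = n * ∫ p, g p ^ 2 ∂(obsLaw σ f₀) := by field_simp
    _ ≤ _ := mul_le_mul_of_nonneg_left hsq hn'.le

/-- The squared Frobenius distance between the empirical Gram matrix and the identity. -/
def gramDeviation (φ : ℕ → 𝒳 → ℝ) (m : ℕ) {n : ℕ} (x : Fin n → 𝒳) : ℝ :=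
  ∑ j : Fin m, ∑ k : Fin m,
    ((n : ℝ)⁻¹ * ∑ i, φ j (x i) * φ k (x i) - if j = k then 1 else 0) ^ 2

/-- Each of the m² entries is an average of n independent variables bounded by K² whose mean is the
identity entry, so its variance is at most K⁴/n. -/
lemma lintegral_gramDeviation_le (hφmeas : ∀ j, Measurable (φ j)) (hφb : ∀ j, b j =ᵐ[μ] φ j)
    (hK : ∀ j x, |φ j x| ≤ K) (f₀ : L2 μ) (m : ℕ) {n : ℕ} (hn : 0 < n) :
    ∫⁻ z, ENNReal.ofReal (gramDeviation φ m fun i => (z i).1) ∂(dataLaw σ f₀ n) ≤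
      ENNReal.ofReal (m ^ 2 * ((n : ℝ)⁻¹ * K ^ 4)) := by
  have hint : ∀ j k : ℕ, ∫ x, φ j x * φ k x ∂μ = if j = k then 1 else 0 := fun j k => by
    rw [← orthonormal_iff_ite.1 b.orthonormal j k, L2.inner_def]
    refine integral_congr_ae ?_
    filter_upwards [hφb j, hφb k] with x h1 h2
    rw [h1, h2]
    exact mul_comm _ _
  have hbd : ∀ j k x, |φ j x * φ k x| ≤ K ^ 2 := fun j k x => by
    rw [abs_mul, sq]
    exact mul_le_mul (hK j x) (hK k x) (abs_nonneg _) ((abs_nonneg _).trans (hK j x))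
  have hterm : ∀ j k : Fin m, ∫⁻ z, ENNReal.ofReal
      (((n : ℝ)⁻¹ * ∑ i, φ j (z i).1 * φ k (z i).1 - if j = k then 1 else 0) ^ 2)
        ∂(dataLaw σ f₀ n) ≤ ENNReal.ofReal ((n : ℝ)⁻¹ * K ^ 4) := by
    intro j k
    have hm : Measurable fun x => φ j x * φ k x := (hφmeas j).mul (hφmeas k)
    have hL : MemLp (fun p : 𝒳 × ℝ => φ j p.1 * φ k p.1) 2 (obsLaw σ f₀) :=
      MemLp.of_bound (hm.comp measurable_fst).aestronglyMeasurable (K ^ 2)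
        (ae_of_all _ fun p => hbd j k p.1)
    have h := lintegral_sq_average_le hn hL
    rw [integral_fst_obsLaw f₀ hm, hint] at h
    simp only [Fin.val_inj] at h
    refine h.trans (ENNReal.ofReal_le_ofReal (mul_le_mul_of_nonneg_left ?_ (by positivity)))
    refine (integral_mono_of_nonneg (g := fun _ => K ^ 4) (ae_of_all _ fun x => sq_nonneg _)
      (integrable_const _) (ae_of_all _ fun p => ?_)).trans_eq (by simp)
    calc (φ j p.1 * φ k p.1) ^ 2 ≤ (K ^ 2) ^ 2 :=
          sq_le_sq' (abs_le.1 (hbd j k p.1)).1 (abs_le.1 (hbd j k p.1)).2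
      _ = K ^ 4 := by ring
  have hsplit : ∀ z : Fin n → 𝒳 × ℝ, ENNReal.ofReal (gramDeviation φ m fun i => (z i).1) =
      ∑ j : Fin m, ∑ k : Fin m, ENNReal.ofReal
        (((n : ℝ)⁻¹ * ∑ i, φ j (z i).1 * φ k (z i).1 - if j = k then 1 else 0) ^ 2) := fun z => by
    rw [gramDeviation, ENNReal.ofReal_sum_of_nonneg fun j _ =>
      Finset.sum_nonneg fun k _ => sq_nonneg _]
    exact Finset.sum_congr rfl fun j _ => ENNReal.ofReal_sum_of_nonneg fun k _ => sq_nonneg _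
  simp_rw [hsplit]
  have hmeas : ∀ j k : Fin m, Measurable fun z : Fin n → 𝒳 × ℝ => ENNReal.ofReal
        (((n : ℝ)⁻¹ * ∑ i, φ j (z i).1 * φ k (z i).1 - if j = k then 1 else 0) ^ 2) := fun j k => by
    have := hφmeas j
    have := hφmeas k
    fun_prop
  rw [lintegral_finsetSum _ fun j _ => Finset.measurable_sum _ fun k _ => hmeas j k]
  simp_rw [lintegral_finsetSum _ fun k _ => hmeas _ k]
  refine (Finset.sum_le_sum fun j _ => Finset.sum_le_sum fun k _ => hterm j k).trans_eq ?_
  simp only [Finset.sum_const, Finset.card_univ, Fintype.card_fin, nsmul_eq_mul]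
  rw [ENNReal.ofReal_mul (p := (m : ℝ) ^ 2) (by positivity), ← mul_assoc,
    ENNReal.ofReal_pow (Nat.cast_nonneg m), ENNReal.ofReal_natCast, sq]

end Moments

/-! ### Second moment bound for the variational posterior. -/

section Risk

open Matrix

variable {𝒳 : Type*} [MeasurableSpace 𝒳] [MeasurableSpace.CountablyGenerated 𝒳]
  {μ : Measure 𝒳} [IsProbabilityMeasure μ] (b : HilbertBasis ℕ ℝ (L2 μ)) {lam : ℕ → ℝ≥0}
  {φ : ℕ → 𝒳 → ℝ} {σ : ℝ≥0} {n m : ℕ} {K : ℝ}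

/-- The mean squared distance to `f₀` under the variational posterior, for a well-conditioned
design. -/
lemma lintegral_sq_dist_optPosterior_le (hs : Summable lam) (hlam : ∀ j, 0 < lam j) (hσ : 0 < σ)
    (hn : 0 < n) {J : ℕ} (hJ : J ≤ m) (f₀ : L2 μ) (z : Fin n → 𝒳 × ℝ)
    (hG : gramDeviation φ m (fun i => (z i).1) ≤ 1 / 4) :
    ∫⁻ f, ENNReal.ofReal (‖f - f₀‖ ^ 2) ∂(optPosterior b lam φ σ m z) ≤
      ∑ j : Fin m, ENNReal.ofReal (16 / (n * (σ : ℝ) ^ 2) * shrinkage lam σ n j) *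
          ENNReal.ofReal ((∑ i, φ j (z i).1 * ((z i).2 - f₀ (z i).1)) ^ 2) +
        ENNReal.ofReal (16 / n) * ∑ i, ENNReal.ofReal (remainder b φ J f₀ (z i).1 ^ 2) +
        ENNReal.ofReal (16 * (σ : ℝ) ^ 2 / n *
          ∑ j ∈ Finset.range J, (lam j : ℝ)⁻¹ * coord b j f₀ ^ 2) +
        (∑ j : Fin m, ENNReal.ofReal (shrinkage lam σ n j) +
          ∑' j, ENNReal.ofReal (lam (j + m))) +
        2 * ∑' j, ENNReal.ofReal (coord b (j + J) f₀ ^ 2) := by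
  have hσ' : (0 : ℝ) < σ := hσ
  have hn' : (0 : ℝ) < n := by exact_mod_cast hn
  set Φ := design φ m fun i => (z i).1 with hΦ
  set y : Fin n → ℝ := fun i => (z i).2 with hy
  -- The target is cut at J, not at m: beyond the effective dimension λ_j⁻¹ is too large for the
  -- coefficients to be charged to the prior penalty, so they count as bias and are carried by `g`.
  set a : Fin m → ℝ := fun j => if (j : ℕ) < J then coord b j f₀ else 0 with ha
  set g : ℕ → ℝ := fun j => if j < J then 0 else coord b j f₀ with hg
  set e : Fin n → ℝ := fun i => (z i).2 - f₀ (z i).1 with he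
  set r : Fin n → ℝ := fun i => remainder b φ J f₀ (z i).1 with hr
  have hGv := gram_lower_bound (Φ := Φ) hn hG
  have hΦa : ∀ i, (Φ *ᵥ a) i = ∑ j ∈ Finset.range J, coord b j f₀ * φ j (z i).1 := by
    intro i
    have h1 : (Φ *ᵥ a) i = ∑ j ∈ Finset.range m,
        if j < J then coord b j f₀ * φ j (z i).1 else 0 := by
      rw [Finset.sum_range, mulVec, dotProduct]
      refine Finset.sum_congr rfl fun j _ => ?_
      simp only [hΦ, design, Matrix.of_apply, ha]
      split_ifs <;> ring
    rw [h1, ← Finset.sum_filter]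
    congr 1
    ext j
    simp only [Finset.mem_filter, Finset.mem_range]
    omega
  have hyd : y = Φ *ᵥ a + e + r := by
    ext i
    simp only [Pi.add_apply, hΦa, hy, he, hr, remainder]
    ring
  have hdist := sq_dist_optMean_le hlam hσ hn hGv hyd
  have hPinv := (posDef_precision (σ := σ) hlam Φ).inv
  rw [optPosterior, lintegral_sq_dist_variationalLaw b hs hlam _ hPinv]
  -- Uses (x - a - g)² ≤ 2(x - a)² + 2g²; the factor 2 turns the constant 8 of `sq_dist_optMean_le`
  -- into 16.
  have hfin : ∀ j : Fin m, ENNReal.ofReal ((optMean lam σ Φ y j - coord b j f₀) ^ 2 +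
      (precision lam σ Φ)⁻¹ j j) ≤ ENNReal.ofReal (2 * (optMean lam σ Φ y j - a j) ^ 2) +
        2 * ENNReal.ofReal (g j ^ 2) + ENNReal.ofReal (shrinkage lam σ n j) := by
    intro j
    have h2 : 2 * ENNReal.ofReal (g j ^ 2) = ENNReal.ofReal (2 * g j ^ 2) := by
      rw [ENNReal.ofReal_mul zero_le_two, ENNReal.ofReal_ofNat]
    rw [h2, ← ENNReal.ofReal_add (by positivity) (by positivity),
      ← ENNReal.ofReal_add (by positivity) (shrinkage_pos hlam j).le]
    refine ENNReal.ofReal_le_ofReal (add_le_add ?_ (precision_inv_apply_le hlam hGv j))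
    have h1 : coord b j f₀ = a j + g j := by
      simp only [ha, hg]
      split_ifs <;> ring
    rw [h1]
    nlinarith [sq_nonneg (optMean lam σ Φ y j - a j + g j)]
  have htail : ∑' j, ENNReal.ofReal (coord b (j + m) f₀ ^ 2 + lam (j + m)) =
      ∑' j, ENNReal.ofReal (g (j + m) ^ 2) + ∑' j, ENNReal.ofReal (lam (j + m)) := by
    rw [← ENNReal.tsum_add]
    refine tsum_congr fun j => ?_
    have : g (j + m) = coord b (j + m) f₀ := if_neg (by omega)
    rw [ENNReal.ofReal_add (sq_nonneg _) (NNReal.coe_nonneg _), this]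
  have hgsum : ∑ j : Fin m, 2 * ENNReal.ofReal (g j ^ 2) + ∑' j, ENNReal.ofReal (g (j + m) ^ 2) ≤
      2 * ∑' j, ENNReal.ofReal (coord b (j + J) f₀ ^ 2) := by
    have h1 : ∑' j, ENNReal.ofReal (g j ^ 2) = ∑' j, ENNReal.ofReal (coord b (j + J) f₀ ^ 2) := by
      rw [tsum_eq_sum_add_tsum_tail _ J, Finset.sum_eq_zero, zero_add]
      · exact tsum_congr fun j => by rw [show g (j + J) = coord b (j + J) f₀ from if_neg (by omega)]
      · intro j hj
        rw [show g j = 0 from if_pos (Finset.mem_range.1 hj)]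
        simp
    rw [← h1, tsum_eq_sum_add_tsum_tail (fun j => ENNReal.ofReal (g j ^ 2)) m, Finset.sum_range,
      mul_add, Finset.mul_sum]
    refine add_le_add_right ?_ _
    rw [two_mul]
    exact le_self_add
  have hsq : ∑ j : Fin m, ENNReal.ofReal (2 * (optMean lam σ Φ y j - a j) ^ 2) ≤
      ∑ j : Fin m, ENNReal.ofReal (16 / (n * (σ : ℝ) ^ 2) * shrinkage lam σ n j) *
          ENNReal.ofReal ((∑ i, φ j (z i).1 * ((z i).2 - f₀ (z i).1)) ^ 2) +
        ENNReal.ofReal (16 / n) * ∑ i, ENNReal.ofReal (remainder b φ J f₀ (z i).1 ^ 2) +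
        ENNReal.ofReal (16 * (σ : ℝ) ^ 2 / n *
          ∑ j ∈ Finset.range J, (lam j : ℝ)⁻¹ * coord b j f₀ ^ 2) := by
    have hq := fun j : ℕ => (shrinkage_pos (σ := σ) (n := n) hlam j).le
    rw [← ENNReal.ofReal_sum_of_nonneg fun j _ => by positivity]
    have hs1 : ∑ j : Fin m, ENNReal.ofReal (16 / (n * (σ : ℝ) ^ 2) * shrinkage lam σ n j) *
          ENNReal.ofReal ((∑ i, φ j (z i).1 * ((z i).2 - f₀ (z i).1)) ^ 2) =
        ENNReal.ofReal (∑ j : Fin m, 16 / (n * (σ : ℝ) ^ 2) * shrinkage lam σ n j *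
          (∑ i, φ j (z i).1 * ((z i).2 - f₀ (z i).1)) ^ 2) := by
      have hc : 0 ≤ 16 / (n * (σ : ℝ) ^ 2) := by positivity
      have hnn : ∀ j : Fin m, 0 ≤ 16 / (n * (σ : ℝ) ^ 2) * shrinkage lam σ n j *
          (∑ i, φ j (z i).1 * ((z i).2 - f₀ (z i).1)) ^ 2 := fun j =>
        mul_nonneg (mul_nonneg hc (hq j)) (sq_nonneg _)
      rw [ENNReal.ofReal_sum_of_nonneg fun j _ => hnn j]
      refine Eq.symm ?_
      exact Finset.sum_congr rfl fun j _ => ENNReal.ofReal_mul (mul_nonneg hc (hq j))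
    rw [hs1, ← ENNReal.ofReal_sum_of_nonneg fun i _ => sq_nonneg _,
      ← ENNReal.ofReal_mul (by positivity), ← ENNReal.ofReal_add, ← ENNReal.ofReal_add]
    · refine ENNReal.ofReal_le_ofReal ?_
      have hasum : ∑ j : Fin m, (lam j : ℝ)⁻¹ * a j ^ 2 =
          ∑ j ∈ Finset.range J, (lam j : ℝ)⁻¹ * coord b j f₀ ^ 2 := by
        have h1 : ∑ j : Fin m, (lam j : ℝ)⁻¹ * a j ^ 2 = ∑ j ∈ Finset.range m,
            if j < J then (lam j : ℝ)⁻¹ * coord b j f₀ ^ 2 else 0 := by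
          rw [Finset.sum_range]
          refine Finset.sum_congr rfl fun j _ => ?_
          simp only [ha]
          split_ifs <;> simp
        rw [h1, ← Finset.sum_filter]
        congr 1
        ext j
        simp only [Finset.mem_filter, Finset.mem_range]
        omega
      rw [hasum] at hdist
      rw [← Finset.mul_sum]
      refine (mul_le_mul_of_nonneg_left hdist zero_le_two).trans_eq ?_
      rw [mul_add, mul_add, mul_add, mul_add, Finset.mul_sum, Finset.mul_sum]
      congr 1
      · congr 1
        · refine Finset.sum_congr rfl fun j _ => ?_
          have hN : (Φᵀ *ᵥ e) j = ∑ i, φ j (z i).1 * ((z i).2 - f₀ (z i).1) := rfl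
          rw [hN]
          field_simp
          ring
        · field_simp
          ring
      · ring
    · refine add_nonneg (Finset.sum_nonneg fun j _ =>
        mul_nonneg (mul_nonneg (by positivity) (hq j)) (sq_nonneg _)) (by positivity)
    · positivity
    · exact Finset.sum_nonneg fun j _ => mul_nonneg (mul_nonneg (by positivity) (hq j)) (sq_nonneg _)
    · positivity
  refine (add_le_add_left (Finset.sum_le_sum fun j _ => hfin j) _).trans ?_
  rw [Finset.sum_add_distrib, Finset.sum_add_distrib, htail]
  refine le_trans (le_of_eq ?_) (add_le_add (add_le_add_left hsq _) hgsum)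
  ring

/-- A non-asymptotic bound for the mass which the variational posterior puts far from `f₀`. -/
lemma lintegral_optPosterior_le (hs : Summable lam)  (hlam : ∀ j, 0 < lam j) (hσ : 0 < σ)
    (hφmeas : ∀ j, Measurable (φ j)) (hφb : ∀ j, b j =ᵐ[μ] φ j) (hK : ∀ j x, |φ j x| ≤ K)
    (hn : 0 < n) {J : ℕ} (hJ : J ≤ m) (f₀ : L2 μ) {δ : ℝ} (hδ : 0 < δ) :
    ∫⁻ z, optPosterior b lam φ σ m z {f | δ ≤ ‖f - f₀‖} ∂(dataLaw σ f₀ n) ≤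
      ENNReal.ofReal (4 * K ^ 4 * (m ^ 2 * (n : ℝ)⁻¹)) +
      (ENNReal.ofReal (16 * K ^ 2 + 1) * (ENNReal.ofReal (J * (2 * (σ : ℝ) ^ 2 / n)) +
          ∑' j, ENNReal.ofReal (lam (j + J))) +
        18 * ∑' j, ENNReal.ofReal (coord b (j + J) f₀ ^ 2) +
        ENNReal.ofReal (16 * (σ : ℝ) ^ 2 / n *
          ∑ j ∈ Finset.range J, (lam j : ℝ)⁻¹ * coord b j f₀ ^ 2)) / ENNReal.ofReal (δ ^ 2) := by
  have hσ' : (0 : ℝ) < σ := hσ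
  have hn' : (0 : ℝ) < n := by exact_mod_cast hn
  have hnoise : ∀ j, Measurable fun z : Fin n → 𝒳 × ℝ =>
      ENNReal.ofReal ((∑ i, φ j (z i).1 * ((z i).2 - f₀ (z i).1)) ^ 2) := fun j => by
    have := hφmeas j
    have := measurable_L2 f₀
    fun_prop
  have hrem : Measurable fun p : 𝒳 × ℝ => ENNReal.ofReal (remainder b φ J f₀ p.1 ^ 2) := by
    have := measurable_remainder b hφmeas J f₀
    fun_prop
  have hgram : Measurable fun z : Fin n → 𝒳 × ℝ =>
      ENNReal.ofReal (4 * gramDeviation φ m fun i => (z i).1) := by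
    unfold gramDeviation
    fun_prop
  set V := ∑ j : Fin m, ENNReal.ofReal (shrinkage lam σ n j) + ∑' j, ENNReal.ofReal (lam (j + m))
    with hV
  set T := ∑' j, ENNReal.ofReal (coord b (j + J) f₀ ^ 2) with hT
  set U := ENNReal.ofReal (16 * (σ : ℝ) ^ 2 / n *
    ∑ j ∈ Finset.range J, (lam j : ℝ)⁻¹ * coord b j f₀ ^ 2) with hU
  set B : (Fin n → 𝒳 × ℝ) → ℝ≥0∞ := fun z =>
    ∑ j : Fin m, ENNReal.ofReal (16 / (n * (σ : ℝ) ^ 2) * shrinkage lam σ n j) *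
        ENNReal.ofReal ((∑ i, φ j (z i).1 * ((z i).2 - f₀ (z i).1)) ^ 2) +
      ENNReal.ofReal (16 / n) * ∑ i, ENNReal.ofReal (remainder b φ J f₀ (z i).1 ^ 2) + U + V + 2 * T
    with hB
  have hpt : ∀ z, optPosterior b lam φ σ m z {f | δ ≤ ‖f - f₀‖} ≤
      ENNReal.ofReal (4 * gramDeviation φ m fun i => (z i).1) + B z / ENNReal.ofReal (δ ^ 2) := by
    intro z
    have hprob : IsProbabilityMeasure (optPosterior b lam φ σ m z) :=
      isProbabilityMeasure_variationalLaw b hs hlam _ (posDef_precision hlam _).inv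
    -- On an ill-conditioned design the trivial bound 1 is at most four times the Gram deviation, so
    -- no separate probability of a bad event is needed.
    rcases le_or_gt (gramDeviation φ m fun i => (z i).1) (1 / 4) with h | h
    · refine le_trans ?_ le_add_self
      exact (measure_le_norm_sub_le _ f₀ hδ).trans (ENNReal.div_le_div_right
        (lintegral_sq_dist_optPosterior_le b hs hlam hσ hn hJ f₀ z h) _)
    · refine prob_le_one.trans (le_trans ?_ le_self_add)
      rw [← ENNReal.ofReal_one]
      exact ENNReal.ofReal_le_ofReal (by linarith)
  -- Below J the shrinkage is bounded by 2σ²/n, from J on by the eigenvalue. This keeps the variance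
  -- of order J/n even if m is much larger than J.
  have hVle : V ≤ ENNReal.ofReal (J * (2 * (σ : ℝ) ^ 2 / n)) + ∑' j, ENNReal.ofReal (lam (j + J)) := by
    set p : ℕ → ℝ≥0∞ := fun j =>
      if j < J then ENNReal.ofReal (2 * (σ : ℝ) ^ 2 / n) else ENNReal.ofReal (lam j) with hp
    have h1 : V ≤ ∑' j, p j := by
      rw [tsum_eq_sum_add_tsum_tail _ m, Finset.sum_range, hV]
      refine add_le_add (Finset.sum_le_sum fun j _ => ?_) (ENNReal.tsum_le_tsum fun j => ?_)
      · simp only [hp]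
        split_ifs
        · exact ENNReal.ofReal_le_ofReal (shrinkage_le_div hσ hn _)
        · exact ENNReal.ofReal_le_ofReal (shrinkage_le_eigenvalue hlam _)
      · rw [hp]
        simp only
        rw [if_neg (by omega)]
    refine h1.trans_eq ?_
    rw [tsum_eq_sum_add_tsum_tail _ J]
    congr 1
    · rw [Finset.sum_congr rfl fun j hj => if_pos (Finset.mem_range.1 hj), Finset.sum_const,
        Finset.card_range, nsmul_eq_mul, ENNReal.ofReal_mul (Nat.cast_nonneg J),
        ENNReal.ofReal_natCast]
    · exact tsum_congr fun j => if_neg (by omega)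
  -- The weight 16 q_j / (nσ²) against a noise second moment of n K² σ² leaves 16 K² q_j. The bias
  -- at the design points averages to 16 T, which with 2 T gives the constant 18.
  have hBint : ∫⁻ z, B z ∂(dataLaw σ f₀ n) ≤ ENNReal.ofReal (16 * K ^ 2) * V +
      ENNReal.ofReal (16 / n) * (n * T) + U + V + 2 * T := by
    have hm0 : ∀ j : Fin m, Measurable fun z : Fin n → 𝒳 × ℝ =>
        ENNReal.ofReal (16 / (n * (σ : ℝ) ^ 2) * shrinkage lam σ n j) *
          ENNReal.ofReal ((∑ i, φ j (z i).1 * ((z i).2 - f₀ (z i).1)) ^ 2) :=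
      fun j => (hnoise j).const_mul _
    have hm1 := Finset.measurable_sum Finset.univ fun j _ => hm0 j
    rw [hB, lintegral_add_right _ measurable_const, lintegral_add_right _ measurable_const,
      lintegral_add_right _ measurable_const, lintegral_add_left hm1,
      lintegral_const_mul' _ _ ENNReal.ofReal_ne_top,
      lintegral_finsetSum _ fun j _ => hm0 j]
    simp only [lintegral_const, measure_univ, mul_one]
    refine add_le_add_left (add_le_add_left (add_le_add_left (add_le_add ?_ ?_) _) _) _
    · refine le_trans ?_ (mul_le_mul_right (le_self_add :
        ∑ j : Fin m, ENNReal.ofReal (shrinkage lam σ n j) ≤ V) _)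
      rw [Finset.mul_sum]
      refine Finset.sum_le_sum fun j _ => ?_
      have hq := (shrinkage_pos (σ := σ) (n := n) hlam j).le
      rw [lintegral_const_mul' _ _ ENNReal.ofReal_ne_top]
      refine (mul_le_mul_right (lintegral_sq_noise_le hφmeas hK f₀ j hn) _).trans_eq ?_
      rw [← ENNReal.ofReal_mul (mul_nonneg (by positivity) hq), ← ENNReal.ofReal_mul (by positivity)]
      congr 1
      field_simp
    · refine mul_le_mul_right (le_of_eq ?_) _
      rw [dataLaw, lintegral_sum_eval (obsLaw σ f₀) n hrem]
      congr 1
      rw [lintegral_fst_obsLaw f₀ (by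
        have := measurable_remainder b hφmeas J f₀
        fun_prop : Measurable fun x => ENNReal.ofReal (remainder b φ J f₀ x ^ 2)),
        lintegral_remainder_sq b hφb]
  refine (lintegral_mono hpt).trans ?_
  rw [lintegral_add_left hgram]
  refine add_le_add ?_ ?_
  · simp_rw [ENNReal.ofReal_mul (zero_le_four : (0 : ℝ) ≤ 4)]
    rw [lintegral_const_mul' _ _ ENNReal.ofReal_ne_top]
    refine (mul_le_mul_right (lintegral_gramDeviation_le b hφmeas hφb hK f₀ m hn) _).trans_eq ?_
    rw [← ENNReal.ofReal_mul zero_le_four]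
    congr 1
    ring
  · simp_rw [div_eq_mul_inv]
    rw [lintegral_mul_const' _ _ (ENNReal.inv_ne_top.2 (by positivity))]
    refine mul_le_mul_left (hBint.trans ?_) _
    have hnT : ENNReal.ofReal (16 / n) * (n * T) = 16 * T := by
      rw [← mul_assoc, ← ENNReal.ofReal_natCast n, ← ENNReal.ofReal_mul (by positivity),
        div_mul_cancel₀ _ hn'.ne']
      simp
    have hKV : ENNReal.ofReal (16 * K ^ 2 + 1) * V = ENNReal.ofReal (16 * K ^ 2) * V + V := by
      rw [ENNReal.ofReal_add (by positivity) zero_le_one, add_mul, ENNReal.ofReal_one, one_mul]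
    rw [hnT]
    refine le_trans (le_of_eq ?_)
      (add_le_add_left (add_le_add_left (mul_le_mul_right hVle _) _) _)
    rw [hKV]
    ring

end Risk

/-! ### Prior trace and prior penalty at the effective dimension. -/

section Eigenvalues

lemma tsum_inv_sq_tail_le (J : ℕ) :
    ∑' j : ℕ, ENNReal.ofReal ((((j + J : ℕ) : ℝ) + 1) ^ 2)⁻¹ ≤ ENNReal.ofReal (2 / (J + 1)) := by
  refine ENNReal.tsum_le_of_sum_range_le fun r => ?_
  rw [← ENNReal.ofReal_sum_of_nonneg fun j _ => by positivity]
  refine ENNReal.ofReal_le_ofReal (le_trans (le_of_eq ?_)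
    (sum_Ioo_inv_sq_le (α := ℝ) J (r + (J + 1))))
  have h := Finset.sum_Ico_add' (fun i : ℕ => (((i : ℝ)) ^ 2)⁻¹) 0 r (J + 1)
  have hset : Finset.Ioo J (r + (J + 1)) = Finset.Ico (0 + (J + 1)) (r + (J + 1)) := by
    ext i
    simp only [Finset.mem_Ioo, Finset.mem_Ico]
    omega
  rw [hset, ← h, Finset.range_eq_Ico]
  refine Finset.sum_congr rfl fun i _ => ?_
  push_cast
  rw [add_assoc]

variable {d : ℕ} {α β c C : ℝ} {n : ℕ} {lam : ℕ → ℝ≥0}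

lemma one_le_log_natCast (hn : 3 ≤ n) : 1 ≤ Real.log n := by
  rw [Real.le_log_iff_exp_le (by positivity)]
  have : (3 : ℝ) ≤ n := by exact_mod_cast hn
  linarith [Real.exp_one_lt_d9]

lemma rescaling_eq : rescaling d α n = ((n : ℝ) ^ (1 / ((d : ℝ) + 2 * α)))⁻¹ * Real.log n := by
  rw [rescaling, neg_div, Real.rpow_neg (Nat.cast_nonneg n)]

lemma rpow_effectiveDim :
    ((n : ℝ) ^ (1 / ((d : ℝ) + 2 * α))) ^ d = (n : ℝ) ^ ((d : ℝ) / (d + 2 * α)) := by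
  rw [← Real.rpow_mul_natCast (Nat.cast_nonneg n)]
  congr 1
  ring

/-- The trace of the prior covariance beyond the effective dimension. -/
lemma tsum_eigenvalue_tail_le (hd : 0 < d) (hn : 3 ≤ n) (hC : 0 ≤ C)
    (h : ∀ j : ℕ, (lam j : ℝ) ≤
      C * Real.exp (-(rescaling d α n * ((j : ℝ) + 1) ^ (1 / (d : ℝ)))))
    {J : ℕ} (hJ : (n : ℝ) ^ ((d : ℝ) / (d + 2 * α)) ≤ J + 1) :
    ∑' j, ENNReal.ofReal (lam (j + J)) ≤
      ENNReal.ofReal (C * (Real.exp 1 * (2 * d).factorial * 2) *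
        ((n : ℝ) ^ ((d : ℝ) / (d + 2 * α)) / n)) := by
  have hn' : (0 : ℝ) < n := by positivity
  set ρ := (n : ℝ) ^ (1 / ((d : ℝ) + 2 * α)) with hρ
  set N := (n : ℝ) ^ ((d : ℝ) / (d + 2 * α)) with hN
  have hρN : ρ ^ d = N := rpow_effectiveDim
  have hρ0 : 0 < ρ := by positivity
  have hN0 : 0 < N := by positivity
  have hlog := one_le_log_natCast hn
  set A := C * (Real.exp 1 * (2 * d).factorial * N ^ 2 / n) with hA
  have hA0 : 0 ≤ A := by positivity
  have hterm : ∀ j, ENNReal.ofReal (lam (j + J)) ≤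
      ENNReal.ofReal A * ENNReal.ofReal ((((j + J : ℕ) : ℝ) + 1) ^ 2)⁻¹ := by
    intro j
    rw [← ENNReal.ofReal_mul hA0]
    refine ENNReal.ofReal_le_ofReal ((h _).trans ?_)
    set x : ℝ := ((j + J : ℕ) : ℝ) + 1 with hx
    have hx0 : 0 < x := by positivity
    have hNx : N ≤ x := hJ.trans (by rw [hx]; push_cast; linarith [(Nat.cast_nonneg j : (0:ℝ) ≤ j)])
    -- The frequency relative to the effective one: the exponential factor in the eigenvalue bound
    -- is n^{-s}, and s ≥ 1 beyond the effective dimension.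
    set s := x ^ (1 / (d : ℝ)) / ρ with hs
    have hs0 : 0 < s := by positivity
    have hspow : s ^ (2 * d) = x ^ 2 / N ^ 2 := by
      rw [hs, div_pow, rpow_one_div_pow_two_mul hd hx0.le, mul_comm 2 d, pow_mul, hρN]
    have hs1 : 1 ≤ s := by
      by_contra! hlt
      have h1 : s ^ (2 * d) < 1 := pow_lt_one₀ hs0.le hlt (by omega)
      rw [hspow, div_lt_one (by positivity)] at h1
      exact absurd (pow_le_pow_left₀ hN0.le hNx 2) (not_le.2 h1)
    have hτ : rescaling d α n * x ^ (1 / (d : ℝ)) = s * Real.log n := by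
      rw [rescaling_eq, hs]
      ring
    -- One factor 1/n is split off; since s ≥ 1 and log n ≥ 1, the remaining n^{-(s-1)} is at most
    -- e^{1-s}, which still decays in j.
    have hexp : Real.exp (-(s * Real.log n)) ≤ Real.exp 1 / n * Real.exp (-s) := by
      have h1 : Real.exp (-(s * Real.log n)) = Real.exp (-((s - 1) * Real.log n)) / n := by
        nth_rw 3 [← Real.exp_log hn']
        rw [← Real.exp_sub]
        congr 1
        ring
      rw [h1, div_mul_eq_mul_div, ← Real.exp_add]
      refine div_le_div_of_nonneg_right (Real.exp_le_exp.2 ?_) hn'.le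
      nlinarith
    rw [hτ, hA, mul_assoc]
    refine mul_le_mul_of_nonneg_left (hexp.trans ?_) hC
    refine (mul_le_mul_of_nonneg_left (exp_neg_le_factorial_div hs0 (2 * d))
      (by positivity)).trans_eq ?_
    rw [hspow]
    field_simp
  refine (ENNReal.tsum_le_tsum hterm).trans ?_
  rw [ENNReal.tsum_mul_left]
  refine (mul_le_mul_right (tsum_inv_sq_tail_le J) _).trans ?_
  rw [← ENNReal.ofReal_mul hA0]
  refine ENNReal.ofReal_le_ofReal ?_
  calc A * (2 / (J + 1)) ≤ A * (2 / N) :=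
        mul_le_mul_of_nonneg_left (div_le_div_of_nonneg_left zero_le_two hN0 hJ) hA0
    _ = _ := by
        rw [hA]
        field_simp

/-- On the effective frequencies the eigenvalues are not much smaller than the Sobolev weights. -/
lemma exp_mul_rpow_neg_le (hα : 0 < α) (hβ : 0 < β) (hn : 3 ≤ n) {t : ℝ} (ht1 : 1 ≤ t)
    (ht : t ≤ (n : ℝ) ^ (1 / ((d : ℝ) + 2 * α))) :
    Real.exp (rescaling d α n * t) * t ^ (-(2 * β)) ≤
      Real.exp (d + 2 * α) + n * (n : ℝ) ^ (-(2 * β) / ((d : ℝ) + 2 * α)) := by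
  have hn' : (0 : ℝ) < n := by positivity
  set D : ℝ := (d : ℝ) + 2 * α with hD
  have hD0 : 0 < D := by positivity
  set ρ := (n : ℝ) ^ (1 / D) with hρ
  have hρ0 : 0 < ρ := by positivity
  set τ := rescaling d α n with hτ
  have hτρ : τ * ρ = Real.log n := by
    rw [hτ, rescaling_eq, ← hD, ← hρ]
    field_simp
  -- From log n ≤ D n^{1/D}. It settles the endpoint t = 1.
  have hτD : τ ≤ D := by
    have h := Real.log_le_rpow_div hn'.le (one_div_pos.2 hD0)
    rw [← hρ, ← hτρ, div_div_eq_mul_div, div_one, mul_comm] at h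
    exact le_of_mul_le_mul_left h hρ0
  -- The logarithm of the left side is convex in t, so its maximum over [1, ρ] is at an endpoint. At
  -- t = ρ the identity τρ = log n gives n · n^{-2β/D}.
  set g : ℝ → ℝ := fun t => τ * t + 2 * β * (-Real.log t) with hg
  have hconv : ConvexOn ℝ (Set.Ioi 0) g := by
    refine ConvexOn.add ?_ ?_
    · exact (convexOn_id (convex_Ioi 0)).smul (rescaling_pos (by omega)).le
    · exact strictConcaveOn_log_Ioi.concaveOn.neg.smul (by positivity)
  have hexpg : ∀ t, 0 < t → Real.exp (τ * t) * t ^ (-(2 * β)) = Real.exp (g t) := by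
    intro t ht
    rw [Real.rpow_def_of_pos ht, ← Real.exp_add]
    congr 1
    rw [hg]
    ring
  have hmax := hconv.le_max_of_mem_Icc (Set.mem_Ioi.2 one_pos) (Set.mem_Ioi.2 hρ0) ⟨ht1, ht⟩
  rw [hexpg t (by linarith)]
  have h1 : Real.exp (g 1) ≤ Real.exp D := by
    refine Real.exp_le_exp.2 ?_
    simpa [hg] using hτD
  have h2 : Real.exp (g ρ) = n * (n : ℝ) ^ (-(2 * β) / D) := by
    rw [← hexpg ρ hρ0, hτρ, Real.exp_log hn', hρ, ← Real.rpow_mul hn'.le]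
    congr 2
    ring
  rcases le_max_iff.1 hmax with h | h
  · exact ((Real.exp_le_exp.2 h).trans h1).trans (le_add_of_nonneg_right (by positivity))
  · exact ((Real.exp_le_exp.2 h).trans_eq h2).trans (le_add_of_nonneg_left (Real.exp_pos _).le)

variable {𝒳 : Type*} [MeasurableSpace 𝒳] {μ : Measure 𝒳} [IsProbabilityMeasure μ]
  [MeasurableSpace.CountablyGenerated 𝒳] {b : HilbertBasis ℕ ℝ (L2 μ)}

/-- The squared norm of the first coefficients in the reproducing kernel Hilbert space. -/
lemma sum_inv_eigenvalue_mul_sq_le (hd : 0 < d) (hα : 0 < α) (hβ : 0 < β) (hn : 3 ≤ n) (hc : 0 < c)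
    (h : ∀ j : ℕ, c * Real.exp (-(rescaling d α n * ((j : ℝ) + 1) ^ (1 / (d : ℝ)))) ≤ lam j)
    {J : ℕ} (hJ : (J : ℝ) ≤ (n : ℝ) ^ ((d : ℝ) / (d + 2 * α))) {f : L2 μ}
    (hf : f ∈ sobolevSpace b d β) :
    ∑ j ∈ Finset.range J, (lam j : ℝ)⁻¹ * coord b j f ^ 2 ≤
      c⁻¹ * (Real.exp (d + 2 * α) + n * (n : ℝ) ^ (-(2 * β) / ((d : ℝ) + 2 * α))) *
        (sobolevNormSq b d β f).toReal := by
  have hd' : (0 : ℝ) < d := by exact_mod_cast hd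
  set E := Real.exp (d + 2 * α) + n * (n : ℝ) ^ (-(2 * β) / ((d : ℝ) + 2 * α)) with hE
  have hE0 : 0 ≤ E := by positivity
  have hsum : ∑ j ∈ Finset.range J, ((j : ℝ) + 1) ^ (2 * β / d) * coord b j f ^ 2 ≤
      (sobolevNormSq b d β f).toReal := by
    rw [← ENNReal.ofReal_le_iff_le_toReal (ne_of_lt hf),
      ENNReal.ofReal_sum_of_nonneg fun j _ => by positivity]
    exact ENNReal.sum_le_tsum _
  refine le_trans ?_ (mul_le_mul_of_nonneg_left hsum (by positivity))
  rw [Finset.mul_sum]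
  refine Finset.sum_le_sum fun j hj => ?_
  have hjJ : (j : ℝ) + 1 ≤ J := by exact_mod_cast Finset.mem_range.1 hj
  set t := ((j : ℝ) + 1) ^ (1 / (d : ℝ)) with ht
  have ht1 : 1 ≤ t := Real.one_le_rpow (by linarith [(Nat.cast_nonneg j : (0 : ℝ) ≤ j)])
    (by positivity)
  have htρ : t ≤ (n : ℝ) ^ (1 / ((d : ℝ) + 2 * α)) := by
    rw [ht]
    refine (Real.rpow_le_rpow (by positivity) (hjJ.trans hJ) (by positivity)).trans_eq ?_
    rw [← Real.rpow_mul (Nat.cast_nonneg n)]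
    congr 1
    field_simp
  have hkey := exp_mul_rpow_neg_le (β := β) hα hβ hn ht1 htρ
  -- With t = (j + 1)^{1/d}, t^{2β} is the Sobolev weight, so multiplying by 1 in this form exposes
  -- the bounded quantity `hkey`.
  have htw : t ^ (-(2 * β)) * ((j : ℝ) + 1) ^ (2 * β / d) = 1 := by
    rw [ht, ← Real.rpow_mul (by positivity), ← Real.rpow_add (by positivity)]
    rw [show 1 / (d : ℝ) * -(2 * β) + 2 * β / d = 0 by ring, Real.rpow_zero]
  have hlam : (lam j : ℝ)⁻¹ ≤ c⁻¹ * Real.exp (rescaling d α n * t) := by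
    refine (inv_anti₀ (by positivity) (h j)).trans_eq ?_
    rw [mul_inv, Real.exp_neg, inv_inv]
  rw [← mul_assoc]
  refine mul_le_mul_of_nonneg_right (hlam.trans ?_) (sq_nonneg _)
  rw [mul_assoc]
  refine mul_le_mul_of_nonneg_left ?_ (by positivity)
  calc Real.exp (rescaling d α n * t) = Real.exp (rescaling d α n * t) *
        (t ^ (-(2 * β)) * ((j : ℝ) + 1) ^ (2 * β / d)) := by rw [htw, mul_one]
    _ = (Real.exp (rescaling d α n * t) * t ^ (-(2 * β))) * ((j : ℝ) + 1) ^ (2 * β / d) := by ring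
    _ ≤ _ := mul_le_mul_of_nonneg_right hkey (by positivity)

end Eigenvalues

/-! ### The contraction rate. -/

section Contraction

variable {𝒳 : Type*} [MeasurableSpace 𝒳] [MeasurableSpace.CountablyGenerated 𝒳]
  {μ : Measure 𝒳} [IsProbabilityMeasure μ] (b : HilbertBasis ℕ ℝ (L2 μ))
  {φ : ℕ → 𝒳 → ℝ} {σ : ℝ≥0} {K : ℝ}

/-- With sufficiently many inducing variables the variational posterior contracts at the rate of
the full posterior. -/
theorem contractsAtRate_optPosterior {d : ℕ} (hd : 0 < d) {α β c C : ℝ} (hα : 0 < α) (hβ : 0 < β)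
    (hc : 0 < c) (hC : 0 ≤ C) {lam : ℕ → ℕ → ℝ≥0}
    (hlow : ∀ n : ℕ, 2 ≤ n → ∀ j : ℕ,
      c * Real.exp (-(rescaling d α n * ((j : ℝ) + 1) ^ (1 / (d : ℝ)))) ≤ lam n j)
    (hup : ∀ n : ℕ, 2 ≤ n → ∀ j : ℕ,
      (lam n j : ℝ) ≤ C * Real.exp (-(rescaling d α n * ((j : ℝ) + 1) ^ (1 / (d : ℝ)))))
    (hφmeas : ∀ j, Measurable (φ j)) (hφb : ∀ j, b j =ᵐ[μ] φ j) (hK : ∀ j x, |φ j x| ≤ K)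
    (hσ : 0 < σ) {m : ℕ → ℕ}
    (hm : ∀ᶠ n : ℕ in atTop, (n : ℝ) ^ ((d : ℝ) / (d + 2 * α)) ≤ m n)
    (hmn : Tendsto (fun n : ℕ => (m n : ℝ) ^ 2 * (n : ℝ)⁻¹ * Real.log n) atTop (𝓝 0))
    {Ψ : ∀ n : ℕ, (Fin n → 𝒳 × ℝ) → Measure (L2 μ)}
    (hΨ : ∀ n : ℕ, 2 ≤ n → ∀ z, Ψ n z = optPosterior b (lam n) φ σ (m n) z)
    {f₀ : L2 μ} (hf₀ : f₀ ∈ sobolevSpace b d β) :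
    ContractsAtRate σ f₀ Ψ fun n => (n : ℝ) ^ (-(min β α) / (d + 2 * α)) := by
  intro M hM
  have hd' : (0 : ℝ) < d := by exact_mod_cast hd
  set D : ℝ := (d : ℝ) + 2 * α with hD
  have hD0 : 0 < D := by positivity
  set γ := min β α with hγ
  set s := (sobolevNormSq b d β f₀).toReal with hs
  have hs0 : 0 ≤ s := ENNReal.toReal_nonneg
  -- Constants of variance, bias and penalty, each relative to η². Dividing by (M_n η)² leaves A /
  -- M_n².
  set A := (16 * K ^ 2 + 1) * (2 * (σ : ℝ) ^ 2 + C * (Real.exp 1 * (2 * d).factorial * 2)) +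
    18 * s + 16 * (σ : ℝ) ^ 2 * (c⁻¹ * (Real.exp D + 1) * s) with hA
  have hlim : Tendsto (fun n : ℕ => ENNReal.ofReal (4 * K ^ 4 *
      ((m n : ℝ) ^ 2 * (n : ℝ)⁻¹ * Real.log n)) + ENNReal.ofReal (A * (M n ^ 2)⁻¹)) atTop (𝓝 0) := by
    have h1 := ENNReal.tendsto_ofReal (hmn.const_mul (4 * K ^ 4))
    have h2 : Tendsto (fun n => (M n ^ 2)⁻¹) atTop (𝓝 0) :=
      ((tendsto_pow_atTop two_ne_zero).comp hM).inv_tendsto_atTop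
    have h3 := h1.add (ENNReal.tendsto_ofReal (h2.const_mul A))
    simpa using h3
  refine tendsto_of_tendsto_of_tendsto_of_le_of_le' tendsto_const_nhds hlim
    (Eventually.of_forall fun _ => zero_le) ?_
  filter_upwards [hm, hM.eventually_gt_atTop 0, eventually_ge_atTop 3] with n hmN hMn hn
  have hn2 : 2 ≤ n := by omega
  have hn0 : 0 < n := by omega
  have hn' : (0 : ℝ) < n := by positivity
  have hn1 : (1 : ℝ) ≤ n := by exact_mod_cast hn0
  set N := (n : ℝ) ^ ((d : ℝ) / D) with hN
  have hN0 : 0 < N := by positivity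
  set J := ⌊N⌋₊ with hJ
  have hJN : (J : ℝ) ≤ N := Nat.floor_le hN0.le
  have hNJ : N ≤ J + 1 := (Nat.lt_floor_add_one N).le
  have hJm : J ≤ m n := Nat.floor_le_of_le hmN
  set η := (n : ℝ) ^ (-γ / D) with hη
  have hη0 : 0 < η := by positivity
  have hη2 : η ^ 2 = (n : ℝ) ^ (-(2 * γ) / D) := rpow_neg_div_sq γ
  have hmono : ∀ a : ℝ, γ ≤ a → (n : ℝ) ^ (-(2 * a) / D) ≤ η ^ 2 := fun a ha => by
    rw [hη2]
    refine Real.rpow_le_rpow_of_exponent_le hn1 (div_le_div_of_nonneg_right ?_ hD0.le)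
    linarith
  have hβη := hmono β (min_le_left _ _)
  -- The variance order is N/n = n^{-2α/D}, while bias and penalty give n^{-2β/D}; the slower of the
  -- two is the one with min(β, α).
  have hNη : N / n ≤ η ^ 2 :=
    (rpow_div_self hn0 hD0.ne' hD.symm).trans_le (hmono α (min_le_right _ _))
  have hnη : (n : ℝ)⁻¹ ≤ η ^ 2 := by
    refine le_trans ?_ hNη
    rw [div_eq_mul_inv]
    exact le_mul_of_one_le_left (by positivity) (one_le_rpow_natCast hn0 (by positivity))
  have hlam0 := eigenvalue_pos hc (hlow n hn2)
  have hbound := lintegral_optPosterior_le b (summable_eigenvalue hd hn2 (hup n hn2)) hlam0 hσ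
    hφmeas hφb hK hn0 hJm f₀ (mul_pos hMn hη0)
  simp_rw [hΨ n hn2]
  refine hbound.trans (add_le_add (ENNReal.ofReal_le_ofReal ?_) ?_)
  -- The Gram term is m²/n without logarithm; n ≥ 3 gives log n ≥ 1, so the assumed limit covers it.
  · refine mul_le_mul_of_nonneg_left ?_ (by positivity)
    exact le_mul_of_one_le_right (by positivity) (one_le_log_natCast hn)
  · have htrace : ENNReal.ofReal (J * (2 * (σ : ℝ) ^ 2 / n)) +
        ∑' j, ENNReal.ofReal (lam n (j + J)) ≤ ENNReal.ofReal
          ((2 * (σ : ℝ) ^ 2 + C * (Real.exp 1 * (2 * d).factorial * 2)) * η ^ 2) := by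
      rw [add_mul, ENNReal.ofReal_add (by positivity) (by positivity)]
      refine add_le_add (ENNReal.ofReal_le_ofReal ?_)
        ((tsum_eigenvalue_tail_le hd hn hC (hup n hn2) hNJ).trans (ENNReal.ofReal_le_ofReal
          (mul_le_mul_of_nonneg_left hNη (by positivity))))
      calc J * (2 * (σ : ℝ) ^ 2 / n) ≤ N * (2 * (σ : ℝ) ^ 2 / n) :=
            mul_le_mul_of_nonneg_right hJN (by positivity)
        _ = 2 * (σ : ℝ) ^ 2 * (N / n) := by ring
        _ ≤ _ := mul_le_mul_of_nonneg_left hNη (by positivity)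
    have htail : ∑' j, ENNReal.ofReal (coord b (j + J) f₀ ^ 2) ≤ ENNReal.ofReal (s * η ^ 2) := by
      refine (tsum_tail_le_sobolevNormSq (b := b) (d := d) hβ.le f₀ hN0 hNJ).trans ?_
      rw [rpow_div_rpow_neg hd'.ne', ← ENNReal.ofReal_toReal (ne_of_lt hf₀), ← hs,
        ← ENNReal.ofReal_mul (by positivity), mul_comm s]
      exact ENNReal.ofReal_le_ofReal (mul_le_mul_of_nonneg_right hβη hs0)
    have hrkhs : 16 * (σ : ℝ) ^ 2 / n * ∑ j ∈ Finset.range J, (lam n j : ℝ)⁻¹ * coord b j f₀ ^ 2 ≤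
        16 * (σ : ℝ) ^ 2 * (c⁻¹ * (Real.exp D + 1) * s) * η ^ 2 := by
      have h1 := sum_inv_eigenvalue_mul_sq_le hd hα hβ hn hc (hlow n hn2) hJN hf₀
      refine (mul_le_mul_of_nonneg_left h1 (by positivity)).trans ?_
      rw [← hD, ← hs]
      calc 16 * (σ : ℝ) ^ 2 / n * (c⁻¹ * (Real.exp D + n * (n : ℝ) ^ (-(2 * β) / D)) * s)
          = 16 * (σ : ℝ) ^ 2 * (c⁻¹ * (Real.exp D * (n : ℝ)⁻¹ + (n : ℝ) ^ (-(2 * β) / D)) * s) := by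
            field_simp
        _ ≤ 16 * (σ : ℝ) ^ 2 * (c⁻¹ * (Real.exp D * η ^ 2 + η ^ 2) * s) := by gcongr
        _ = _ := by ring
    have hnum : ENNReal.ofReal (16 * K ^ 2 + 1) * (ENNReal.ofReal (J * (2 * (σ : ℝ) ^ 2 / n)) +
          ∑' j, ENNReal.ofReal (lam n (j + J))) +
        18 * ∑' j, ENNReal.ofReal (coord b (j + J) f₀ ^ 2) +
        ENNReal.ofReal (16 * (σ : ℝ) ^ 2 / n *
          ∑ j ∈ Finset.range J, (lam n j : ℝ)⁻¹ * coord b j f₀ ^ 2) ≤ ENNReal.ofReal (A * η ^ 2) := by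
      refine (add_le_add (add_le_add (mul_le_mul_right htrace _) (mul_le_mul_right htail _))
        (ENNReal.ofReal_le_ofReal hrkhs)).trans_eq ?_
      rw [← ENNReal.ofReal_ofNat 18, ← ENNReal.ofReal_mul (by positivity),
        ← ENNReal.ofReal_mul (by positivity), ← ENNReal.ofReal_add (by positivity) (by positivity),
        ← ENNReal.ofReal_add (by positivity) (by positivity)]
      congr 1
      rw [hA]
      ring
    refine (ENNReal.div_le_div_right hnum _).trans_eq ?_
    rw [← ENNReal.ofReal_div_of_pos (by positivity)]
    congr 1
    field_simp

end Contraction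

end SparseGP

end

/-! ### Assembly. -/

theorem corollary5p3
    {d : ℕ} (hd : 0 < d) {X : Set (EuclideanSpace ℝ (Fin d))}
    (μ : Measure X) [IsProbabilityMeasure μ]
    (b : HilbertBasis ℕ ℝ (SparseGP.L2 μ)) (φ : ℕ → X → ℝ)
    (hφmeas : ∀ j, Measurable (φ j)) (hφb : ∀ j, b j =ᵐ[μ] φ j)
    (hφbdd : ∃ K : ℝ, ∀ j x, |φ j x| ≤ K)
    (σ : ℝ≥0) (hσ : 0 < σ) (α β : ℝ) (hα : 0 < α) (hβ : 0 < β)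
    (lam : ℕ → ℕ → ℝ≥0)
    (hlam : ∃ c C : ℝ, 0 < c ∧ ∀ n : ℕ, 2 ≤ n → ∀ j : ℕ,
      c * Real.exp (-(SparseGP.rescaling d α n * ((j : ℝ) + 1) ^ (1 / (d : ℝ)))) ≤ lam n j ∧
      lam n j ≤ C * Real.exp (-(SparseGP.rescaling d α n * ((j : ℝ) + 1) ^ (1 / (d : ℝ))))) :
    -- the variational posterior exists and is unique
    (∀ n : ℕ, 2 ≤ n → ∀ (m : ℕ) (z : Fin n → X × ℝ),
      ∃! Ψ, SparseGP.IsVariationalPosterior φ b (lam n) σ m z Ψ) ∧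
    -- contraction rate for sufficiently many inducing variables
    (∀ (m : ℕ → ℕ) (Ψ : ∀ n : ℕ, (Fin n → X × ℝ) → Measure (SparseGP.L2 μ)),
      (∀ n : ℕ, 2 ≤ n → ∀ z, SparseGP.IsVariationalPosterior φ b (lam n) σ (m n) z (Ψ n z)) →
      (∀ᶠ n : ℕ in atTop, (n : ℝ) ^ ((d : ℝ) / (d + 2 * α)) ≤ m n) →
      Tendsto (fun n : ℕ => (m n : ℝ) ^ 2 * (n : ℝ)⁻¹ * Real.log n) atTop (𝓝 0) →
      ∀ f₀ ∈ SparseGP.sobolevSpace b d β, (∃ K : ℝ, ∀ᵐ x ∂μ, |f₀ x| ≤ K) →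
        SparseGP.ContractsAtRate σ f₀ Ψ (fun n => (n : ℝ) ^ (-(min β α) / (d + 2 * α)))) ∧
    -- minimax optimality of this rate if `α = β`
    (α = β →
      SparseGP.IsMinimaxRate b d β σ (fun n => (n : ℝ) ^ (-(min β α) / (d + 2 * α)))) ∧
    -- suboptimality for too few inducing variables
    (α = β → ∀ r : ℝ, r < d / (d + 2 * α) →
      ∀ (m : ℕ → ℕ) (Ψ : ∀ n : ℕ, (Fin n → X × ℝ) → Measure (SparseGP.L2 μ)),
      (∀ n : ℕ, 2 ≤ n → ∀ z, SparseGP.IsVariationalPosterior φ b (lam n) σ (m n) z (Ψ n z)) →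
      (∃ C : ℝ, ∀ n : ℕ, 2 ≤ n → (m n : ℝ) ≤ C * (n : ℝ) ^ r) →
      ∃ f₀ ∈ SparseGP.sobolevSpace b d β, ∃ p : ℝ, 0 < p ∧ p < β / (d + 2 * β) ∧
        SparseGP.ContractsAtBestAtRate σ f₀ Ψ (fun n => (n : ℝ) ^ (-p))) := by
  obtain ⟨K, hK⟩ := hφbdd
  obtain ⟨c, C, hc, hlamb⟩ := hlam
  have hlow := fun n hn j => (hlamb n hn j).1
  have hup := fun n hn j => (hlamb n hn j).2
  have hC : 0 ≤ C := by
    have h := (mul_pos hc (Real.exp_pos _)).le.trans ((hlow 2 le_rfl 0).trans (hup 2 le_rfl 0))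
    exact nonneg_of_mul_nonneg_left h (Real.exp_pos _)
  have hiff : ∀ n : ℕ, 2 ≤ n → ∀ (m : ℕ) (z : Fin n → X × ℝ) (Ψ : Measure (SparseGP.L2 μ)),
      SparseGP.IsVariationalPosterior φ b (lam n) σ m z Ψ ↔
        Ψ = SparseGP.optPosterior b (lam n) φ σ m z := fun n hn m z Ψ =>
    SparseGP.isVariationalPosterior_iff b (SparseGP.summable_eigenvalue hd hn (hup n hn))
      (SparseGP.summable_sqrt_eigenvalue hd hn (hup n hn))
      (SparseGP.eigenvalue_pos hc (hlow n hn)) hK hσ m z Ψ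
  refine ⟨fun n hn m z => ?_, fun m Ψ hΨ hm hmn f₀ hf₀ _ => ?_, ?_, ?_⟩
  · exact ⟨_, (hiff n hn m z _).2 rfl, fun Ψ hΨ => (hiff n hn m z Ψ).1 hΨ⟩
  · exact SparseGP.contractsAtRate_optPosterior b hd hα hβ hc hC hlow hup hφmeas hφb hK hσ hm hmn
      (fun n hn z => (hiff n hn (m n) z _).1 (hΨ n hn z)) hf₀
  · rintro rfl
    rw [min_self]
    exact SparseGP.isMinimaxRate b hd hα hφmeas hφb hK hσ
  · rintro rfl r hr m Ψ hΨ ⟨C', hm⟩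
    -- The obstruction holds for every true function and every p > 0; the zero function and half the
    -- minimax exponent serve as witnesses.
    refine ⟨0, by simp [SparseGP.sobolevSpace, SparseGP.sobolevNormSq], α / (d + 2 * α) / 2,
      by positivity, half_lt_self (by positivity), ?_⟩
    exact SparseGP.contractsAtBestAtRate_of_few_inducing b hd hα (by positivity) hc hlow
      (fun n hn => SparseGP.summable_eigenvalue hd hn (hup n hn)) hr hm
      (fun n hn z => (hΨ n hn z).1) 0
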